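/- Setting. Let $k\ge 1$, $m\ge 0$, $n=k+m$ and $p\ge 2$ be integers. Let $D\subset\mathbb C^n$ be a bounded pseudoconvex domain, $S\subset D$ a (relatively) closed complex submanifold of codimension $k$, and $\phi:D\to\mathbb R$ a continuous plurisubharmonic function. Let $G:D\to[-\infty,0)$ be plurisubharmonic, real-valued and continuous on $D\setminus S$, and such that near every point of $S$ there are holomorphic coordinates $z=(z',z'')\in\mathbb C^k\times\mathbb C^m$, called *adapted*, in which $S=\{z'=0\}$ and $G=\log|z'|^2+\gamma$ with $\gamma$ a continuous real function. Let $\mathcal I_S$ be the ideal sheaf of $S$ and $J^{(p-1)}=\mathcal I_S^{p-1}/\mathcal I_S^{p}$, a vector bundle on $S$ whose fibre at $x$ is $J^{(p-1)}_x=\mathcal I_{S,x}^{p-1}/(\mathcal I_{S,x}^{p}+\mathfrak m_x\mathcal I_{S,x}^{p-1})$. Let $dV_S$ be the volume measure on $S$ induced by the Euclidean metric. For $x\in S$, adapted coordinates $z$ around $x$, and an open neighbourhood $U$ of $x$ that is relatively compact in the domain of $z$, put $U_x=\{q\in U: z''(q)=z''(x)\}$ and let $dV_{U_x}$ be the measure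 on $U_x$ determined by $dV_{U_x}(z')\cdot dV_S(z'')=dV_{\mathbb C^n}$; that is, $dV_{U_x}$ has density with respect to $d\lambda(z')$ equal to the density of $dV_{\mathbb C^n}$ with respect to $d\lambda(z')\,d\lambda(z'')$ at $(z',z''(x))$ divided by the density of $dV_S$ with respect to $d\lambda(z'')$ at $x$. Every $f_x\in J_x^{(p-1)}$ is the class of exactly one homogeneous polynomial of degree $p-1$ in $z_1,\dots,z_k$, denoted by the same symbol. For $f_x,g_x\in J^{(p-1)}_x$ consider $$\langle f_x,g_x\rangle_{J^{(p-1)}_x}:=\lim_{t\to-\infty}\int_{U_x\cap\{t<G<t+1\}}f_x\,\overline{g_x}\,e^{-\phi-(p+k-1)G}\,dV_{U_x}.\qquad(*)$$ Proposition. In $(*)$, and in the limits in (2) and (4), the integrals converge absolutely for all $t$ sufficiently close to $-\infty$, and: (1) The limit $(*)$ exists. (2) If $\widetilde f_x,\widetilde g_x$ are measurable functions on $U_x$ with $\widetilde f_x=f_x+o(|z'|^{p-1})$ and $\widetilde g_x=g_x+o(|z'|^{p-1})$ as $z'\to0$, $z'\neq 0$, then replacing $f_x,g_x$ in $(*)$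 by $\widetilde f_x,\widetilde g_x$ does not change the limit. (3) The value $\langle f_x,g_x\rangle_{J_x^{(p-1)}}$ does not depend on the adapted coordinates $z$ and the neighbourhood $U$. (4) Let $f,g$ be smooth sections of $J^{(p-1)}$ over $S$, and let $\widetilde f,\widetilde g\in C^\infty(D)$ be smooth extensions of them (at each $x\in S$, $\widetilde f$ agrees with a holomorphic germ in $\mathcal I_{S,x}^{p-1}$ representing $f_x$ up to $o(|y-x|^{p-1})$ as $y\to x$, and likewise for $\widetilde g$) such that $\widetilde f\,\overline{\widetilde g}$ vanishes outside a compact subset of $D$ (for instance, $f$ and $g$ have compact support and the extensions are chosen with compact support in $D$). Then $x\mapsto\langle f_x,g_x\rangle_{J^{(p-1)}_x}$ is integrable with respect to $dV_S$ and $$\int_S\langle f,g\rangle_{J^{(p-1)}}\,dV_S=\lim_{t\to-\infty}\int_{D\cap\{t<G<t+1\}}\widetilde f\,\overline{\widetilde g}\,e^{-\phi-(p+k-1)G}\,dV_{\mathbb C^n}.$$ -/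

import Mathlib

open Filter Topology MeasureTheory Asymptotics
open scoped ENNReal ContDiff ComplexConjugate

noncomputable section

namespace JetMetric

/-- `ℂⁿ` with its Euclidean norm; its `volume` is the Lebesgue measure. -/
abbrev Cn (n : ℕ) : Type := EuclideanSpace ℂ (Fin n)

/-! ### Plurisubharmonic functions and pseudoconvex domains -/

/-- `u : D → [-∞, ∞)` is plurisubharmonic: upper semicontinuous, and on every closed affine complex
disc in `D` the value at the centre is at most the mean of `u` over the boundary circle. Since `u`
is upper semicontinuous, that mean (possibly `-∞`) is the infimum of the means of the continuous
real functions `h ≥ u` on the circle. -/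
def IsPSHOn {n : ℕ} (u : Cn n → EReal) (D : Set (Cn n)) : Prop :=
  UpperSemicontinuousOn u D ∧ (∀ z ∈ D, u z < ⊤) ∧
    ∀ a b : Cn n, (∀ ζ : ℂ, ‖ζ‖ ≤ 1 → a + ζ • b ∈ D) →
      ∀ h : ℂ → ℝ, Continuous h → (∀ ζ : ℂ, ‖ζ‖ = 1 → u (a + ζ • b) ≤ (h ζ : EReal)) →
        u a ≤ ((Real.circleAverage h 0 1 : ℝ) : EReal)

/-- A pseudoconvex domain: a connected non-empty open set with a continuous plurisubharmonic
exhaustion function. -/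
def IsPseudoconvexDomain {n : ℕ} (D : Set (Cn n)) : Prop :=
  IsOpen D ∧ IsConnected D ∧
    ∃ u : Cn n → ℝ, ContinuousOn u D ∧ IsPSHOn (fun z => (u z : EReal)) D ∧
      ∀ c : ℝ, IsCompact {z ∈ D | u z ≤ c}

/-! ### Coordinates adapted to a submanifold -/

/-- Local holomorphic coordinates `z = (z', z'')` on `ℂⁿ`, with `z' ∈ ℂᵏ` and `z'' ∈ ℂᵐ`. -/
abbrev Coord (n k m : ℕ) : Type := OpenPartialHomeomorph (Cn n) (Cn k × Cn m)

/-- The coordinates are biholomorphic and `S` is `{z' = 0}` on their domain. -/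
structure IsSubmanifoldCoord {n k m : ℕ} (S : Set (Cn n)) (e : Coord n k m) : Prop where
  holo : DifferentiableOn ℂ e e.source
  holo_symm : DifferentiableOn ℂ e.symm e.target
  mem_iff : ∀ y ∈ e.source, y ∈ S ↔ (e y).1 = 0

/-- Adapted coordinates: their domain lies in `D`, there `S = {z' = 0}` and
`G = log |z'|² + γ` with `γ` continuous (so `G = -∞` exactly on `S`). -/
structure IsAdaptedCoord {n k m : ℕ} (D S : Set (Cn n)) (G : Cn n → EReal) (e : Coord n k m) :
    Prop extends IsSubmanifoldCoord S e where
  source_subset : e.source ⊆ D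
  green : ∃ γ : Cn n → ℝ, ContinuousOn γ e.source ∧ ∀ y ∈ e.source,
    G y = ENNReal.log (ENNReal.ofReal (‖(e y).1‖ ^ 2)) + (γ y : EReal)

/-- `G` is a Green-type function on `D` with poles along `S`; in particular `S` is a complex
submanifold of dimension `m` and codimension `k`. -/
structure IsGreenType {n : ℕ} (k m : ℕ) (D S : Set (Cn n)) (G : Cn n → EReal) : Prop where
  neg : ∀ z ∈ D, G z < 0
  psh : IsPSHOn G D
  finite : ∀ z ∈ D \ S, G z ≠ ⊥
  cont : ContinuousOn G (D \ S)
  coord : ∀ x ∈ S, ∃ e : Coord n k m, x ∈ e.source ∧ IsAdaptedCoord D S G e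

/-- `U` is a coordinate neighbourhood of the point `x` of `S`, relatively compact in the domain of
the adapted coordinates `e`. -/
structure IsAdaptedNhd {n k m : ℕ} (D S : Set (Cn n)) (G : Cn n → EReal) (e : Coord n k m)
    (U : Set (Cn n)) (x : Cn n) : Prop where
  adapted : IsAdaptedCoord D S G e
  isOpen : IsOpen U
  compact_closure : IsCompact (closure U)
  closure_subset : closure U ⊆ e.source
  mem : x ∈ U
  mem_S : x ∈ S

/-- The slice `U_x = {q ∈ U : z''(q) = z''(x)}`. -/
def slice {n k m : ℕ} (e : Coord n k m) (U : Set (Cn n)) (x : Cn n) : Set (Cn n) :=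
  {q ∈ U | (e q).2 = (e x).2}

/-! ### Volume forms -/

/-- The Gram determinant of a family of vectors of `ℂⁿ`; for `n` vectors it is `|det|²`. -/
def gramDet {n : ℕ} {ι : Type} [Fintype ι] [DecidableEq ι] (v : ι → Cn n) : ℝ :=
  (Matrix.gram ℂ v).det.re

/-- The density of `dV_{ℂⁿ}` with respect to `dλ(z') dλ(z'')` at the point with coordinates `w`:
the squared modulus of the complex Jacobian determinant of the inverse of `e`. -/
def ambientDensity {n k m : ℕ} (e : Coord n k m) (w : Cn k × Cn m) : ℝ :=
  gramDet (fun s : Fin k ⊕ Fin m => fderiv ℂ e.symm w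
    (Sum.elim (fun i => (EuclideanSpace.single i (1 : ℂ), (0 : Cn m)))
      (fun j => ((0 : Cn k), EuclideanSpace.single j (1 : ℂ))) s))

/-- The density of `dV_S` with respect to `dλ(z'')` at the point `(0, w)` of `S`. The square root
of the Gram determinant of the `2m` real coordinate vectors is the complex Gram determinant. -/
def subDensity {n k m : ℕ} (e : Coord n k m) (w : Cn m) : ℝ :=
  gramDet (fun j : Fin m => fderiv ℂ e.symm ((0 : Cn k), w)
    ((0 : Cn k), EuclideanSpace.single j (1 : ℂ)))

/-- The volume measure of `S` on the part of `S` in the domain of the coordinates `e`. -/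
def chartVolume {n k m : ℕ} (e : Coord n k m) : Measure (Cn n) :=
  Measure.map (fun w : Cn m => e.symm (0, w))
    ((volume.restrict {w : Cn m | ((0 : Cn k), w) ∈ e.target}).withDensity
      (fun w => ENNReal.ofReal (subDensity e w)))

/-- `dV_S`, the volume measure on `S` of the metric induced by `ℂⁿ`, as a measure on `ℂⁿ`
carried by `S`. The measures `chartVolume e` are its restrictions to the coordinate patches of `S`,
which cover `S`, so it is the least measure above all of them. -/
def subVolume {n : ℕ} (k m : ℕ) (S : Set (Cn n)) : Measure (Cn n) :=
  ⨆ (e : Coord n k m) (_ : IsSubmanifoldCoord S e), chartVolume e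

/-- `dV_{U_x}`, as a measure on `ℂⁿ` carried by the slice `U_x`: the measure `A dλ(z')` for which
`dV_{U_x}(z') · dV_S(z'') = dV_{ℂⁿ}`. -/
def sliceVolume {n k m : ℕ} (e : Coord n k m) (U : Set (Cn n)) (x : Cn n) : Measure (Cn n) :=
  Measure.map (fun w : Cn k => e.symm (w, (e x).2))
    ((volume.restrict {w : Cn k | (w, (e x).2) ∈ e.target ∧ e.symm (w, (e x).2) ∈ U}).withDensity
      (fun w => ENNReal.ofReal (ambientDensity e (w, (e x).2) / subDensity e (e x).2)))

/-! ### The bundle `J^{(p-1)}` -/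

/-- The ring `𝒪_x` of germs of holomorphic functions at `x`. -/
def holGerm {n : ℕ} (x : Cn n) : Subring (Germ (𝓝 x) ℂ) where
  carrier := {a | ∃ F : Cn n → ℂ, AnalyticAt ℂ F x ∧ (F : Germ (𝓝 x) ℂ) = a}
  mul_mem' := by
    rintro _ _ ⟨F, hF, rfl⟩ ⟨H, hH, rfl⟩
    exact ⟨F * H, hF.mul hH, rfl⟩
  one_mem' := ⟨1, analyticAt_const, rfl⟩
  add_mem' := by
    rintro _ _ ⟨F, hF, rfl⟩ ⟨H, hH, rfl⟩
    exact ⟨F + H, hF.add hH, rfl⟩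
  zero_mem' := ⟨0, analyticAt_const, rfl⟩
  neg_mem' := by
    rintro _ ⟨F, hF, rfl⟩
    exact ⟨-F, hF.neg, rfl⟩

/-- The stalk at `x` of the ideal sheaf of holomorphic functions vanishing on `S`. -/
def idealStalk {n : ℕ} (S : Set (Cn n)) (x : Cn n) : Ideal (holGerm x) where
  carrier := {a | ∃ F : Cn n → ℂ, (F : Germ (𝓝 x) ℂ) = a.1 ∧ ∀ᶠ y in 𝓝 x, y ∈ S → F y = 0}
  add_mem' := by
    rintro a b ⟨F, hF, hF'⟩ ⟨H, hH, hH'⟩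
    refine ⟨F + H, by simp [← hF, ← hH], ?_⟩
    filter_upwards [hF', hH'] with y h1 h2 hy
    simp [h1 hy, h2 hy]
  zero_mem' := ⟨0, rfl, Eventually.of_forall fun _ _ => rfl⟩
  smul_mem' := by
    rintro ⟨_, F, hF, rfl⟩ b ⟨H, hH, hH'⟩
    refine ⟨F * H, by simp [← hH], ?_⟩
    filter_upwards [hH'] with y h hy
    simp [h hy]

/-- The fibre at `x` of `J^{(p-1)} = I_S^{p-1} / I_S^p`, i.e. its stalk modulo the maximal ideal
`𝔪_x` (the germs vanishing at `x`): `I_{S,x}^{p-1} / (I_{S,x}^p + 𝔪_x I_{S,x}^{p-1})`. -/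
abbrev JetFibre {n : ℕ} (S : Set (Cn n)) (p : ℕ) (x : Cn n) : Type :=
  ↥(idealStalk S x ^ (p - 1)) ⧸
    Submodule.comap (Submodule.subtype (idealStalk S x ^ (p - 1)))
      (idealStalk S x ^ p ⊔ idealStalk {x} x * idealStalk S x ^ (p - 1))

/-- The germ of `F` at `x` is holomorphic, belongs to `I_S^{p-1}`, and its class in the fibre of
`J^{(p-1)}` at `x` is `f`. -/
def Represents {n : ℕ} (S : Set (Cn n)) (p : ℕ) (x : Cn n) (F : Cn n → ℂ) (f : JetFibre S p x) :
    Prop :=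
  ∃ a : ↥(idealStalk S x ^ (p - 1)), (F : Germ (𝓝 x) ℂ) = a.1.1 ∧ Submodule.Quotient.mk a = f

/-- The function `P(z₁, …, z_k)`, for a polynomial `P`. -/
def coordPoly {n k m : ℕ} (e : Coord n k m) (P : MvPolynomial (Fin k) ℂ) (y : Cn n) : ℂ :=
  MvPolynomial.eval (fun i => (e y).1 i) P

/-- `f ∈ J_x^{(p-1)}` corresponds to the homogeneous polynomial `P` of degree `p - 1` in
`z₁, …, z_k`. -/
def CorrespondsTo {n k m : ℕ} (S : Set (Cn n)) (p : ℕ) (e : Coord n k m) (x : Cn n)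
    (f : JetFibre S p x) (P : MvPolynomial (Fin k) ℂ) : Prop :=
  P.IsHomogeneous (p - 1) ∧ Represents S p x (coordPoly e P) f

/-- A smooth section of `J^{(p-1)}` over `S` (the values off `S` play no role): in the local
frames given by the monomials of degree `p - 1` in `z'`, its coefficients are smooth. -/
def IsSmoothSection {n : ℕ} (k m : ℕ) (S : Set (Cn n)) (p : ℕ) (f : ∀ x, JetFibre S p x) : Prop :=
  ∀ x₀ ∈ S, ∃ e : Coord n k m, x₀ ∈ e.source ∧ IsSubmanifoldCoord S e ∧
    ∃ P : Cn n → MvPolynomial (Fin k) ℂ,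
      (∀ x ∈ e.source ∩ S, CorrespondsTo S p e x (f x) (P x)) ∧
      ∀ α : Fin k →₀ ℕ, ContDiffOn ℝ ∞ (fun w : Cn m => (P (e.symm (0, w))).coeff α)
        {w : Cn m | ((0 : Cn k), w) ∈ e.target}

/-- `F` is a smooth function on `D` extending the section `f`: at each `x ∈ S` it agrees with a
representative of `f x` up to `o(|y - x|^{p-1})`. -/
def IsSmoothExtension {n : ℕ} (D S : Set (Cn n)) (p : ℕ) (f : ∀ x, JetFibre S p x)
    (F : Cn n → ℂ) : Prop :=
  ContDiffOn ℝ ∞ F D ∧ ∀ x ∈ S, ∃ H : Cn n → ℂ, Represents S p x H (f x) ∧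
    (fun y => F y - H y) =o[𝓝 x] fun y => ‖y - x‖ ^ (p - 1)

/-! ### The metric -/

/-- `f ḡ e^{-φ-(p+k-1)G}`. -/
def integrand {n : ℕ} (k p : ℕ) (G : Cn n → EReal) (φ : Cn n → ℝ) (f g : Cn n → ℂ)
    (y : Cn n) : ℂ :=
  f y * conj (g y) * (Real.exp (-φ y - ((p : ℝ) + k - 1) * (G y).toReal) : ℂ)

/-- The shell `{t < G < t + 1}`. -/
def shell {n : ℕ} (G : Cn n → EReal) (t : ℝ) : Set (Cn n) :=
  {y | (t : EReal) < G y ∧ G y < ((t + 1 : ℝ) : EReal)}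

/-- `∫_{t < G < t+1} f ḡ e^{-φ-(p+k-1)G} dμ` converges absolutely for `t` near `-∞` and tends to
`c` as `t → -∞`. -/
def HasShellLimit {n : ℕ} (k p : ℕ) (G : Cn n → EReal) (φ : Cn n → ℝ) (μ : Measure (Cn n))
    (f g : Cn n → ℂ) (c : ℂ) : Prop :=
  (∀ᶠ t : ℝ in atBot, IntegrableOn (integrand k p G φ f g) (shell G t) μ) ∧
    Tendsto (fun t : ℝ => ∫ y in shell G t, integrand k p G φ f g y ∂μ) atBot (𝓝 c)

/-- `⟨f, g⟩` for `f, g ∈ J_x^{(p-1)}`: the limit computed in some adapted coordinates at `x`. -/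
def jetInner {n : ℕ} (k m : ℕ) (D S : Set (Cn n)) (G : Cn n → EReal) (φ : Cn n → ℝ) (p : ℕ)
    (x : Cn n) (f g : JetFibre S p x) : ℂ :=
  Classical.epsilon fun c : ℂ =>
    ∃ (e : Coord n k m) (U : Set (Cn n)) (P Q : MvPolynomial (Fin k) ℂ),
      IsAdaptedNhd D S G e U x ∧ CorrespondsTo S p e x f P ∧ CorrespondsTo S p e x g Q ∧
      HasShellLimit k p G φ (sliceVolume e U x) (coordPoly e P) (coordPoly e Q) c

end JetMetric

end

noncomputable section

namespace JetMetric

/-! ### Osgood's lemma -/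

/-- Cauchy's integral formula on a polydisc. -/
theorem torusIntegral_prod_sub_inv_smul {F : Type*} [NormedAddCommGroup F] [NormedSpace ℂ F]
    [CompleteSpace F] {r : ℝ} (hr : 0 < r) : ∀ (N : ℕ) (c z : Fin N → ℂ) (f : (Fin N → ℂ) → F),
    DifferentiableOn ℂ f (Metric.closedBall c r) → z ∈ Metric.ball c r →
    (∯ ζ in T(c, fun _ => r), (∏ i, (ζ i - z i))⁻¹ • f ζ)
      = (2 * Real.pi * Complex.I : ℂ) ^ N • f z := by
  intro N
  induction N with
  | zero =>
    intro c z f _ _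
    have h : c = z := Subsingleton.elim _ _
    simp [torusIntegral_dim0, h]
  | succ N ih =>
    intro c z f hf hz
    have hz' : ∀ i, dist (z i) (c i) < r := (dist_pi_lt_iff hr).1 hz
    have hmem : ∀ θ, torusMap c (fun _ => r) θ ∈ Metric.closedBall c r := by
      intro θ
      rw [Metric.mem_closedBall, dist_pi_le_iff hr.le]
      intro i
      simp [torusMap, dist_eq_norm, abs_of_pos hr]
    have hne : ∀ θ i, torusMap c (fun _ => r) θ i - z i ≠ 0 := by
      intro θ i h
      have h1 : dist (torusMap c (fun _ => r) θ i) (c i) = r := by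
        simp [torusMap, dist_eq_norm, abs_of_pos hr]
      rw [sub_eq_zero.1 h] at h1
      exact (hz' i).ne h1
    have hcm : Continuous (torusMap c (fun _ => r)) := by
      unfold torusMap
      fun_prop
    have hint : TorusIntegrable (fun ζ => (∏ i, (ζ i - z i))⁻¹ • f ζ) c (fun _ => r) := by
      unfold TorusIntegrable
      refine ContinuousOn.integrableOn_compact isCompact_Icc (Continuous.continuousOn ?_)
      refine Continuous.smul (Continuous.inv₀ (by fun_prop) ?_) ?_
      · intro θ
        exact Finset.prod_ne_zero_iff.2 fun i _ => hne θ i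
      · exact hf.continuousOn.comp_continuous hcm hmem
    rw [torusIntegral_succ hint]
    have key : ∀ x ∈ Metric.sphere (c 0) r,
        (∯ y in T(c ∘ Fin.succ, (fun _ => r) ∘ Fin.succ),
          (∏ i, ((Fin.cons x y : Fin (N + 1) → ℂ) i - z i))⁻¹ • f (Fin.cons x y))
        = (x - z 0)⁻¹ • ((2 * Real.pi * Complex.I : ℂ) ^ N •
            f (Fin.cons x (z ∘ Fin.succ))) := by
      intro x hx
      have h1 := ih (c ∘ Fin.succ) (z ∘ Fin.succ) (fun y => f (Fin.cons x y)) ?_ ?_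
      · rw [← h1, ← torusIntegral_smul]
        congr 1
        ext y
        simp only [Fin.prod_univ_succ, Fin.cons_zero, Fin.cons_succ, mul_inv, mul_smul,
          Function.comp]
      · refine hf.comp ?_ ?_
        · intro y _
          refine DifferentiableAt.differentiableWithinAt ?_
          rw [differentiableAt_pi]
          intro i
          refine Fin.cases ?_ (fun j => ?_) i
          · simp
          · simp only [Fin.cons_succ]
            fun_prop
        · intro y hy
          rw [Metric.mem_closedBall, dist_pi_le_iff hr.le] at hy ⊢
          intro i
          refine Fin.cases ?_ (fun j => ?_) i
          · simpa using (Metric.mem_sphere.1 hx).le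
          · simpa using hy j
      · rw [Metric.mem_ball, dist_pi_lt_iff hr]
        intro i
        exact hz' _
    rw [circleIntegral.integral_congr hr.le key]
    have h2 : DiffContOnCl ℂ (fun x => (2 * Real.pi * Complex.I : ℂ) ^ N •
            f (Fin.cons x (z ∘ Fin.succ))) (Metric.ball (c 0) r) := by
      apply DifferentiableOn.diffContOnCl
      rw [closure_ball _ hr.ne']
      refine DifferentiableOn.const_smul (hf.comp ?_ ?_) _
      · intro y _
        refine DifferentiableAt.differentiableWithinAt ?_
        rw [differentiableAt_pi]
        intro i
        refine Fin.cases ?_ (fun j => ?_) i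
        · simp only [Fin.cons_zero]
          fun_prop
        · simp
      · intro y hy
        rw [Metric.mem_closedBall, dist_pi_le_iff hr.le]
        intro i
        refine Fin.cases ?_ (fun j => ?_) i
        · simpa using hy
        · simpa using (hz' j.succ).le
    rw [h2.circleIntegral_sub_inv_smul (by simpa using hz' 0), smul_smul, pow_succ']
    congr 2
    ext i
    refine Fin.cases ?_ (fun j => ?_) i <;> simp

/-- Integration against a continuous function on a compact space, as a continuous linear map. -/
def integralSMulCLM {K F : Type*} [TopologicalSpace K] [CompactSpace K] [MeasurableSpace K]
    [BorelSpace K] (μ : Measure K) [IsFiniteMeasure μ] [NormedAddCommGroup F] [NormedSpace ℂ F]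
    (h : C(K, F)) : C(K, ℂ) →L[ℂ] F :=
  LinearMap.mkContinuous
    { toFun := fun g => ∫ θ, g θ • h θ ∂μ
      map_add' := by
        intro g g'
        simp only [ContinuousMap.add_apply, add_smul]
        refine integral_add ?_ ?_ <;>
        · rw [← integrableOn_univ]
          exact ContinuousOn.integrableOn_compact' isCompact_univ MeasurableSet.univ (by fun_prop)
      map_smul' := by
        intro a g
        simp only [ContinuousMap.smul_apply, smul_assoc, RingHom.id_apply]
        exact integral_smul _ _ }
    (‖h‖ * μ.real Set.univ) (by
      intro g
      refine (norm_integral_le_of_norm_le_const (C := ‖g‖ * ‖h‖) ?_).trans (le_of_eq (by ring))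
      refine Eventually.of_forall fun θ => ?_
      rw [norm_smul]
      gcongr
      · exact g.norm_coe_le_norm θ
      · exact h.norm_coe_le_norm θ)

theorem analyticAt_of_differentiableOn_pi {F : Type*} [NormedAddCommGroup F] [NormedSpace ℂ F]
    [CompleteSpace F] {N : ℕ} {f : (Fin N → ℂ) → F} {s : Set (Fin N → ℂ)} {c : Fin N → ℂ}
    (hf : DifferentiableOn ℂ f s) (hs : s ∈ 𝓝 c) : AnalyticAt ℂ f c := by
  obtain ⟨r, hr, hrs⟩ := Metric.nhds_basis_closedBall.mem_iff.1 hs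
  have hf := hf.mono hrs
  have hmem : ∀ θ, torusMap c (fun _ => r) θ ∈ Metric.closedBall c r := by
    intro θ
    rw [Metric.mem_closedBall, dist_pi_le_iff hr.le]
    intro i
    simp [torusMap, dist_eq_norm, abs_of_pos hr]
  have hcm : Continuous (torusMap c (fun _ : Fin N => r)) := by
    unfold torusMap
    fun_prop
  let K : Set (Fin N → ℝ) := Set.Icc 0 (fun _ => 2 * Real.pi)
  have hK : IsCompact K := isCompact_Icc
  have : CompactSpace K := isCompact_iff_compactSpace.1 hK
  let μ : Measure K := Measure.comap Subtype.val volume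
  have : IsFiniteMeasure μ := by
    constructor
    rw [show μ Set.univ = volume K from ?_]
    · exact hK.measure_lt_top
    · simp only [μ]
      rw [comap_subtype_coe_apply measurableSet_Icc, Set.image_univ, Subtype.range_coe]
  let h : C(K, F) := ⟨fun θ => (∏ i, (r * Complex.exp (θ.1 i * Complex.I) * Complex.I)) •
      f (torusMap c (fun _ => r) θ.1), by
    refine Continuous.smul (continuous_finsetProd _ fun i _ => ?_) ?_
    · have : Continuous fun θ : K => θ.1 i := (continuous_apply i).comp continuous_subtype_val
      exact (continuous_const.mul (Complex.continuous_exp.comp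
        ((Complex.continuous_ofReal.comp this).mul continuous_const))).mul continuous_const
    exact hf.continuousOn.comp_continuous (hcm.comp continuous_subtype_val) fun θ => hmem _⟩
  let ζ : Fin N → C(K, ℂ) := fun i => ⟨fun θ => torusMap c (fun _ => r) θ.1 i, by fun_prop⟩
  let Φ : (Fin N → ℂ) → C(K, ℂ) := fun z => ∏ i, Ring.inverse (ζ i - algebraMap ℂ C(K, ℂ) (z i))
  have hunit : ∀ z ∈ Metric.ball c r, ∀ i, IsUnit (ζ i - algebraMap ℂ C(K, ℂ) (z i)) := by
    intro z hz i
    rw [ContinuousMap.isUnit_iff_forall_ne_zero]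
    intro θ h0
    have h1 : dist (torusMap c (fun _ => r) θ.1 i) (c i) = r := by
      simp [torusMap, dist_eq_norm, abs_of_pos hr]
    have h2 : torusMap c (fun _ => r) θ.1 i = z i := sub_eq_zero.1 h0
    rw [h2] at h1
    exact ((dist_pi_lt_iff hr).1 hz i).ne h1
  have hΦ : AnalyticAt ℂ Φ c := by
    refine Finset.analyticAt_fun_prod _ fun i _ => ?_
    obtain ⟨u, hu⟩ := hunit c (Metric.mem_ball_self hr) i
    have h1 : AnalyticAt ℂ (Ring.inverse : C(K, ℂ) → C(K, ℂ))
        (ζ i - algebraMap ℂ C(K, ℂ) (c i)) := hu ▸ analyticAt_inverse u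
    refine h1.comp (f := fun z : Fin N → ℂ => ζ i - algebraMap ℂ C(K, ℂ) (z i)) ?_
    refine analyticAt_const.sub ?_
    exact ((Algebra.linearMap ℂ C(K, ℂ)).toContinuousLinearMap.comp
      (ContinuousLinearMap.proj (R := ℂ) (φ := fun _ : Fin N => ℂ) i)).analyticAt c
  have hA : AnalyticAt ℂ (fun z => ((2 * Real.pi * Complex.I : ℂ) ^ N)⁻¹ •
      integralSMulCLM μ h (Φ z)) c :=
    ((integralSMulCLM μ h).analyticAt _ |>.comp hΦ).const_smul
  refine hA.congr ?_
  filter_upwards [Metric.ball_mem_nhds c hr] with z hz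
  have h1 := torusIntegral_prod_sub_inv_smul hr N c z f hf hz
  rw [inv_smul_eq_iff₀ (pow_ne_zero _ Complex.two_pi_I_ne_zero), ← h1]
  simp only [torusIntegral, integralSMulCLM, LinearMap.mkContinuous_apply, LinearMap.coe_mk,
    AddHom.coe_mk]
  change ∫ θ : K, _ ∂(Measure.comap Subtype.val volume) = ∫ θ in K, _
  rw [← integral_subtype_comap measurableSet_Icc]
  refine integral_congr_ae (Eventually.of_forall fun θ => ?_)
  have h3 : Φ z θ = (∏ i, (torusMap c (fun _ => r) θ.1 i - z i))⁻¹ := by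
    simp only [Φ]
    rw [ContinuousMap.prod_apply, ← Finset.prod_inv_distrib]
    refine Finset.prod_congr rfl fun i _ => ?_
    have h4 := Ring.mul_inverse_cancel _ (hunit z hz i)
    have h5 := congrArg (fun g : C(K, ℂ) => g θ) h4
    exact eq_inv_of_mul_eq_one_right h5
  simp only [h3, h, ContinuousMap.coe_mk]
  rw [smul_comm]

/-- **Osgood's lemma**: in finite dimension, a complex differentiable function is analytic. -/
theorem analyticAt_of_differentiableOn {E F : Type*} [NormedAddCommGroup E] [NormedSpace ℂ E]
    [FiniteDimensional ℂ E] [NormedAddCommGroup F] [NormedSpace ℂ F]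
    [CompleteSpace F] {f : E → F} {s : Set E} {c : E}
    (hf : DifferentiableOn ℂ f s) (hs : s ∈ 𝓝 c) : AnalyticAt ℂ f c := by
  let L : E ≃L[ℂ] (Fin (Module.finrank ℂ E) → ℂ) :=
    ContinuousLinearEquiv.ofFinrankEq (by simp)
  have h1 : AnalyticAt ℂ (f ∘ L.symm) (L c) := by
    refine analyticAt_of_differentiableOn_pi (s := L.symm ⁻¹' s)
      (hf.comp L.symm.differentiableOn (Set.mapsTo_preimage _ _)) ?_
    refine L.symm.continuous.continuousAt.preimage_mem_nhds ?_
    simpa using hs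
  have h2 := h1.comp (L.analyticAt c)
  refine h2.congr (Eventually.of_forall fun y => ?_)
  simp

/-! ### Integrals over thin shells around the origin -/

section Shell

variable {E : Type*} [NormedAddCommGroup E]

/-- The shell `{t < g < t + 1}` in a punctured region `W \ {0}`. -/
def vshell (W : Set E) (g : E → ℝ) (t : ℝ) : Set E :=
  {w | w ∈ W ∧ w ≠ 0 ∧ t < g w ∧ g w < t + 1}

theorem measurableSet_vshell_log [MeasurableSpace E] [BorelSpace E] (γ t : ℝ) :
    MeasurableSet (vshell Set.univ (fun w : E => 2 * Real.log ‖w‖ + γ) t) := by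
  have hm : Measurable fun w : E => 2 * Real.log ‖w‖ + γ := by fun_prop
  have : vshell Set.univ (fun w : E => 2 * Real.log ‖w‖ + γ) t =
      {0}ᶜ ∩ ((fun w : E => 2 * Real.log ‖w‖ + γ) ⁻¹' Set.Ioo t (t + 1)) := by
    ext w
    simp [vshell]
  rw [this]
  exact (measurableSet_singleton _).compl.inter (hm measurableSet_Ioo)

variable [NormedSpace ℝ E] [FiniteDimensional ℝ E]

/-- A function homogeneous of degree `-d` and continuous off the origin is `O(‖w‖^(-d))`. -/
theorem exists_norm_pow_mul_le_of_homogeneous {d : ℕ} {Θ : E → ℂ} (hc : ContinuousOn Θ {0}ᶜ)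
    (hom : ∀ s : ℝ, 0 < s → ∀ w, w ≠ 0 → (s ^ d : ℝ) • Θ (s • w) = Θ w) :
    ∃ M, ∀ w, w ≠ 0 → ‖w‖ ^ d * ‖Θ w‖ ≤ M := by
  have : ProperSpace E := FiniteDimensional.proper_real E
  obtain ⟨M, hM⟩ := (isCompact_sphere (0 : E) 1).exists_bound_of_continuousOn
    (hc.mono fun w hw => by
      rintro rfl
      simp at hw)
  refine ⟨M, fun w hw => ?_⟩
  have hn : 0 < ‖w‖ := norm_pos_iff.2 hw
  have h1 : ‖w‖⁻¹ • w ∈ Metric.sphere (0 : E) 1 := by simp [norm_smul, hn.ne']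
  have h2 := hom ‖w‖⁻¹ (inv_pos.2 hn) w hw
  have h3 := hM _ h1
  rw [← h2, norm_smul, norm_pow, norm_inv, norm_norm, ← mul_assoc, ← mul_pow,
    mul_inv_cancel₀ hn.ne', one_pow, one_mul]
  exact h3

variable [MeasurableSpace E] [BorelSpace E] (μ : Measure E) [μ.IsAddHaarMeasure]

theorem tendsto_integral_vshell [Nontrivial E] {Θ Θ₀ : E → ℂ} {g : E → ℝ} {γ : ℝ} {W : Set E}
    (hW : W ∈ 𝓝 0) (hmeas : ∀ t, MeasurableSet (vshell W g t))
    (hΘ : ∀ t, AEStronglyMeasurable Θ (μ.restrict (vshell W g t)))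
    (hlow : ∃ C, ∀ w ∈ W, w ≠ 0 → 2 * Real.log ‖w‖ - C ≤ g w)
    (hg : Tendsto (fun w => g w - 2 * Real.log ‖w‖) (𝓝[≠] 0) (𝓝 γ))
    (hc : ContinuousOn Θ₀ {0}ᶜ)
    (hom : ∀ s : ℝ, 0 < s → ∀ w, w ≠ 0 → (s ^ Module.finrank ℝ E : ℝ) • Θ₀ (s • w) = Θ₀ w)
    (hdiff : Tendsto (fun w => (‖w‖ ^ Module.finrank ℝ E : ℝ) • (Θ w - Θ₀ w)) (𝓝[≠] 0) (𝓝 0)) :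
    (∀ᶠ t in atBot, IntegrableOn Θ (vshell W g t) μ) ∧
    Tendsto (fun t => ∫ w in vshell W g t, Θ w ∂μ) atBot
      (𝓝 (∫ w in vshell Set.univ (fun w => 2 * Real.log ‖w‖ + γ) 0, Θ₀ w ∂μ)) := by
  set d := Module.finrank ℝ E with hd
  obtain ⟨C, hC⟩ := hlow
  obtain ⟨M, hM⟩ := exists_norm_pow_mul_le_of_homogeneous hc hom
  have hev : ∀ᶠ w in 𝓝[≠] (0 : E), w ∈ W ∧ |g w - 2 * Real.log ‖w‖ - γ| < 1 ∧
      ‖w‖ ^ d * ‖Θ w‖ ≤ M + 1 := by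
    have h1 := (Metric.tendsto_nhds.1 hg 1 one_pos)
    have h2 := (Metric.tendsto_nhds.1 hdiff 1 one_pos)
    filter_upwards [h1, h2, nhdsWithin_le_nhds hW, self_mem_nhdsWithin] with w h1 h2 h3 h4
    refine ⟨h3, h1, ?_⟩
    rw [dist_zero_right, norm_smul, norm_pow, norm_norm] at h2
    have h5 : ‖Θ w‖ ≤ ‖Θ w - Θ₀ w‖ + ‖Θ₀ w‖ := by
      simpa using norm_add_le (Θ w - Θ₀ w) (Θ₀ w)
    have h6 := hM w h4
    calc ‖w‖ ^ d * ‖Θ w‖ ≤ ‖w‖ ^ d * (‖Θ w - Θ₀ w‖ + ‖Θ₀ w‖) := by gcongr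
      _ = ‖w‖ ^ d * ‖Θ w - Θ₀ w‖ + ‖w‖ ^ d * ‖Θ₀ w‖ := mul_add _ _ _
      _ ≤ M + 1 := by linarith
  rw [eventually_nhdsWithin_iff, Metric.eventually_nhds_iff] at hev
  obtain ⟨δ, hδ, hball⟩ := hev
  replace hball : ∀ w : E, ‖w‖ < δ → w ≠ 0 → w ∈ W ∧ |g w - 2 * Real.log ‖w‖ - γ| < 1 ∧
      ‖w‖ ^ d * ‖Θ w‖ ≤ M + 1 := fun w h1 h2 => hball (by simpa using h1) h2
  have hsmall : ∀ t ≤ 2 * Real.log δ - 1 - C, ∀ w ∈ vshell W g t, ‖w‖ < δ := by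
    rintro t ht w ⟨h1, h2, h3, h4⟩
    have h5 := hC w h1 h2
    rw [← Real.log_lt_log_iff (norm_pos_iff.2 h2) hδ]
    linarith
  set Ψ : ℝ → E → ℂ := fun t u =>
    (Real.exp (t / 2) ^ d : ℝ) • (vshell W g t).indicator Θ (Real.exp (t / 2) • u) with hΨ
  set a := Real.exp ((-γ - 1) / 2) with ha
  set b := Real.exp ((2 - γ) / 2) with hb
  have hnorm : ∀ (t : ℝ) (u : E), u ≠ 0 →
      2 * Real.log ‖Real.exp (t / 2) • u‖ = t + 2 * Real.log ‖u‖ := by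
    intro t u hu
    rw [norm_smul, Real.norm_eq_abs, Real.abs_exp, Real.log_mul (Real.exp_ne_zero _)
      (norm_ne_zero_iff.2 hu), Real.log_exp]
    ring
  have hbound : ∀ t ≤ 2 * Real.log δ - 1 - C, ∀ u, ‖Ψ t u‖ ≤
      (Metric.closedBall (0 : E) b).indicator (fun _ => (M + 1) / a ^ d) u := by
    intro t ht u
    have hM0 : 0 ≤ M + 1 := by
      obtain ⟨w, hw⟩ := exists_ne (0 : E)
      have := hM w hw
      have : 0 ≤ ‖w‖ ^ d * ‖Θ₀ w‖ := by positivity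
      linarith
    by_cases hu : Real.exp (t / 2) • u ∈ vshell W g t
    · have hu0 : u ≠ 0 := fun h => hu.2.1 (by simp [h])
      have hn : 0 < ‖u‖ := norm_pos_iff.2 hu0
      obtain ⟨-, h2, h3⟩ := hball _ (hsmall t ht _ hu) hu.2.1
      have hu' := hu
      obtain ⟨-, -, h4, h5⟩ := hu'
      rw [hnorm t u hu0, abs_lt] at h2
      have hua : a ≤ ‖u‖ := by
        rw [ha, ← Real.le_log_iff_exp_le hn]
        linarith [h2.1, h2.2]
      have hub : ‖u‖ ≤ b := by
        rw [hb, ← Real.log_le_iff_le_exp hn]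
        linarith [h2.1, h2.2]
      rw [Set.indicator_of_mem (by simpa using hub)]
      simp only [hΨ]
      rw [Set.indicator_of_mem hu, norm_smul, norm_pow, Real.norm_eq_abs,
        Real.abs_exp, le_div_iff₀ (by positivity)]
      rw [norm_smul, Real.norm_eq_abs, Real.abs_exp, mul_pow] at h3
      refine le_trans ?_ h3
      rw [mul_right_comm]
      gcongr
    · simp only [hΨ]
      rw [Set.indicator_of_notMem hu]
      simp only [smul_zero, norm_zero]
      exact Set.indicator_nonneg (fun _ _ => by positivity) _
  have hqmp : ∀ t : ℝ, Measure.QuasiMeasurePreserving (fun u : E => Real.exp (t / 2) • u) μ μ := by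
    intro t
    refine ⟨measurable_const_smul _, ?_⟩
    rw [Measure.map_addHaar_smul μ (Real.exp_ne_zero _)]
    exact Measure.smul_absolutelyContinuous
  have hmΨ : ∀ t, AEStronglyMeasurable (Ψ t) μ := by
    intro t
    have h1 : AEStronglyMeasurable ((vshell W g t).indicator Θ) μ :=
      (aestronglyMeasurable_indicator_iff (hmeas t)).2 (hΘ t)
    exact (h1.comp_quasiMeasurePreserving (hqmp t)).const_smul (Real.exp (t / 2) ^ d)
  have hbint : Integrable ((Metric.closedBall (0 : E) b).indicator
      (fun _ => (M + 1) / a ^ d)) μ := by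
    have : ProperSpace E := FiniteDimensional.proper_real E
    rw [integrable_indicator_iff measurableSet_closedBall]
    exact integrableOn_const (isCompact_closedBall (0 : E) b).measure_lt_top.ne
  have hevt : ∀ᶠ t : ℝ in atBot, t ≤ 2 * Real.log δ - 1 - C := eventually_le_atBot _
  have hintΨ : ∀ t, ∫ w in vshell W g t, Θ w ∂μ = ∫ u, Ψ t u ∂μ := by
    intro t
    simp only [hΨ]
    rw [integral_smul, Measure.integral_comp_smul, ← integral_indicator (hmeas t), smul_smul,
      abs_of_pos (by positivity), ← hd, mul_inv_cancel₀ (by positivity), one_smul]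
  constructor
  · filter_upwards [hevt] with t ht
    have h1 : Integrable (Ψ t) μ :=
      hbint.mono' (hmΨ t) (Eventually.of_forall (hbound t ht))
    rw [← integrable_indicator_iff (hmeas t), ← integrable_comp_smul_iff μ _
      (Real.exp_ne_zero (t / 2))]
    have h2 := h1.smul (Real.exp (t / 2) ^ d)⁻¹
    refine h2.congr (Eventually.of_forall fun u => ?_)
    simp only [hΨ, Pi.smul_apply]
    rw [smul_smul, inv_mul_cancel₀ (by positivity), one_smul]
  have hmeas0 := measurableSet_vshell_log (E := E) γ 0
  simp_rw [hintΨ]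
  rw [← integral_indicator hmeas0]
  refine tendsto_integral_filter_of_dominated_convergence _ (Eventually.of_forall hmΨ)
    (hevt.mono fun t ht => Eventually.of_forall (hbound t ht)) hbint ?_
  have hnull : ∀ᵐ u ∂μ, u ≠ 0 ∧ 2 * Real.log ‖u‖ + γ ≠ 0 ∧ 2 * Real.log ‖u‖ + γ ≠ 1 := by
    have h1 : ∀ᵐ u ∂μ, u ≠ 0 := by
      rw [ae_iff]
      simp
    have h2 : ∀ r : ℝ, ∀ᵐ u ∂μ, ‖u‖ ≠ r := by
      intro r
      rw [ae_iff]
      have := Measure.addHaar_sphere μ (0 : E) r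
      convert this using 2
      ext u
      simp
    filter_upwards [h1, h2 (Real.exp (-γ / 2)), h2 (Real.exp ((1 - γ) / 2))] with u h1 h2 h3
    refine ⟨h1, fun h => h2 ?_, fun h => h3 ?_⟩
    · rw [← Real.exp_log (norm_pos_iff.2 h1)]
      congr 1
      linarith
    · rw [← Real.exp_log (norm_pos_iff.2 h1)]
      congr 1
      linarith
  filter_upwards [hnull] with u hu
  obtain ⟨hu0, hu1, hu2⟩ := hu
  have hsc : Tendsto (fun t : ℝ => Real.exp (t / 2) • u) atBot (𝓝[≠] 0) := by
    refine tendsto_nhdsWithin_iff.2 ⟨?_, Eventually.of_forall fun t => ?_⟩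
    · have : Tendsto (fun t : ℝ => Real.exp (t / 2)) atBot (𝓝 0) :=
        Real.tendsto_exp_atBot.comp (tendsto_id.atBot_div_const two_pos)
      simpa using this.smul_const u
    · simp [hu0]
  have hgt : Tendsto (fun t : ℝ => g (Real.exp (t / 2) • u) - t) atBot
      (𝓝 (2 * Real.log ‖u‖ + γ)) := by
    have h1 := (hg.comp hsc).add_const (2 * Real.log ‖u‖)
    rw [add_comm γ] at h1
    refine h1.congr fun t => ?_
    simp only [Function.comp]
    rw [hnorm t u hu0]
    ring
  have hWt := hsc.eventually (nhdsWithin_le_nhds hW)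
  by_cases hin : u ∈ vshell Set.univ (fun w : E => 2 * Real.log ‖w‖ + γ) 0
  · rw [Set.indicator_of_mem hin]
    obtain ⟨-, -, hin1, hin2⟩ := hin
    have h1 : ∀ᶠ t : ℝ in atBot, Real.exp (t / 2) • u ∈ vshell W g t := by
      filter_upwards [hgt.eventually (eventually_gt_nhds hin1),
        hgt.eventually (eventually_lt_nhds hin2), hWt] with t h1 h2 h3
      exact ⟨h3, by simp [hu0], by linarith, by linarith⟩
    have h2 : Tendsto (fun t : ℝ => ((‖u‖ ^ d)⁻¹ : ℝ) • ((‖Real.exp (t / 2) • u‖ ^ d : ℝ) •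
        (Θ (Real.exp (t / 2) • u) - Θ₀ (Real.exp (t / 2) • u))) + Θ₀ u) atBot (𝓝 (Θ₀ u)) := by
      simpa using ((hdiff.comp hsc).const_smul ((‖u‖ ^ d)⁻¹ : ℝ)).add_const (Θ₀ u)
    refine h2.congr' ?_
    filter_upwards [h1] with t ht
    simp only [hΨ]
    rw [Set.indicator_of_mem ht, smul_smul, norm_smul, mul_pow, Real.norm_eq_abs, Real.abs_exp,
      mul_comm (Real.exp (t / 2) ^ d), inv_mul_cancel_left₀
        (pow_ne_zero _ (norm_ne_zero_iff.2 hu0)), smul_sub, hom _ (Real.exp_pos _) u hu0]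
    simp
  · rw [Set.indicator_of_notMem hin]
    have h1 : ∀ᶠ t : ℝ in atBot, Real.exp (t / 2) • u ∉ vshell W g t := by
      have hor : 2 * Real.log ‖u‖ + γ < 0 ∨ 1 < 2 * Real.log ‖u‖ + γ := by
        by_contra! hcon
        refine hin ⟨trivial, hu0, lt_of_le_of_ne hcon.1 (Ne.symm hu1), ?_⟩
        rw [zero_add]
        exact lt_of_le_of_ne hcon.2 hu2
      rcases hor with h | h
      · filter_upwards [hgt.eventually (eventually_lt_nhds h)] with t h1 h2
        linarith [h2.2.2.1]
      · filter_upwards [hgt.eventually (eventually_gt_nhds h)] with t h1 h2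
        linarith [h2.2.2.2]
    refine tendsto_const_nhds.congr' ?_
    filter_upwards [h1] with t ht
    simp only [hΨ]
    rw [Set.indicator_of_notMem ht, smul_zero]

theorem norm_integral_vshell_le {Θ : E → ℂ} {g : E → ℝ} {W : Set E} {C M : ℝ} (hM0 : 0 ≤ M)
    (hC : ∀ w ∈ W, w ≠ 0 → |g w - 2 * Real.log ‖w‖| ≤ C)
    (hM : ∀ w ∈ W, w ≠ 0 → ‖w‖ ^ Module.finrank ℝ E * ‖Θ w‖ ≤ M) (t : ℝ) :
    ‖∫ w in vshell W g t, Θ w ∂μ‖ ≤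
      M * Real.exp (C + 1 / 2) ^ Module.finrank ℝ E * μ.real (Metric.closedBall 0 1) := by
  set d := Module.finrank ℝ E with hd
  have : ProperSpace E := FiniteDimensional.proper_real E
  set a := Real.exp ((t - C) / 2) with ha
  set b := Real.exp ((t + 1 + C) / 2) with hb
  have hsub : vshell W g t ⊆ Metric.closedBall 0 b := by
    rintro w ⟨h1, h2, h3, h4⟩
    have h5 := abs_le.1 (hC w h1 h2)
    rw [mem_closedBall_zero_iff, hb, ← Real.log_le_iff_le_exp (norm_pos_iff.2 h2)]
    linarith [h5.1, h5.2]
  have hfin : μ (vshell W g t) < ⊤ :=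
    (measure_mono hsub).trans_lt (isCompact_closedBall (0 : E) b).measure_lt_top
  have hle : ∀ w ∈ vshell W g t, ‖Θ w‖ ≤ M / a ^ d := by
    rintro w ⟨h1, h2, h3, h4⟩
    have h5 := abs_le.1 (hC w h1 h2)
    have h6 : a ≤ ‖w‖ := by
      rw [ha, ← Real.le_log_iff_exp_le (norm_pos_iff.2 h2)]
      linarith [h5.1, h5.2]
    rw [le_div_iff₀ (by positivity)]
    refine le_trans ?_ (hM w h1 h2)
    rw [mul_comm]
    gcongr
  refine (norm_setIntegral_le_of_norm_le_const hfin hle).trans ?_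
  have h1 : μ.real (vshell W g t) ≤ b ^ d * μ.real (Metric.closedBall 0 1) := by
    refine (measureReal_mono hsub (isCompact_closedBall (0 : E) b).measure_lt_top.ne).trans ?_
    rw [Measure.addHaar_real_closedBall' μ 0 (Real.exp_pos _).le]
  have h2 : Real.exp (C + 1 / 2) = b / a := by
    rw [ha, hb, ← Real.exp_sub]
    congr 1
    ring
  calc M / a ^ d * μ.real (vshell W g t)
      ≤ M / a ^ d * (b ^ d * μ.real (Metric.closedBall 0 1)) := by gcongr
    _ = _ := by
      rw [h2, div_pow]
      ring

end Shell

/-! ### Holomorphic functions vanishing on a coordinate subspace -/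

/-- Averages of an analytic function along a path of linear contractions are analytic. -/
theorem analyticAt_integral_comp_clm {E : Type*} [NormedAddCommGroup E] [NormedSpace ℂ E]
    [FiniteDimensional ℂ E] {Φ : E → ℂ} {c : E} (hΦ : AnalyticAt ℂ Φ c) {T : ℝ → E →L[ℂ] E}
    (hT : Continuous T) (hTn : ∀ s ∈ Set.uIcc (0 : ℝ) 1, ‖T s‖ ≤ 1)
    (hTc : ∀ s ∈ Set.uIcc (0 : ℝ) 1, T s c = c) :
    AnalyticAt ℂ (fun z => ∫ s in (0 : ℝ)..1, Φ (T s z)) c := by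
  have hlt : ∀ᶠ z in 𝓝 c, ‖fderiv ℂ Φ z‖ < ‖fderiv ℂ Φ c‖ + 1 :=
    hΦ.fderiv.continuousAt.norm.tendsto.eventually_lt_const (lt_add_one _)
  obtain ⟨r, hr, hball⟩ := Metric.eventually_nhds_iff_ball.1 (hΦ.eventually_analyticAt.and hlt)
  generalize ‖fderiv ℂ Φ c‖ + 1 = M at hball
  have hTball : ∀ s ∈ Set.uIcc (0 : ℝ) 1, ∀ z ∈ Metric.ball c r, T s z ∈ Metric.ball c r := by
    intro s hs z hz
    rw [Metric.mem_ball, dist_eq_norm] at hz ⊢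
    have h1 : T s z - c = T s (z - c) := by rw [map_sub, hTc s hs]
    rw [h1]
    refine ((T s).le_opNorm _).trans_lt (lt_of_le_of_lt ?_ hz)
    exact mul_le_of_le_one_left (norm_nonneg _) (hTn s hs)
  have hTz : ∀ z, Continuous fun s => T s z := fun z => hT.clm_apply continuous_const
  have hcont : ∀ z ∈ Metric.ball c r, ContinuousOn (fun s => Φ (T s z)) (Set.uIcc (0 : ℝ) 1) := by
    intro z hz s hs
    exact (ContinuousAt.comp (f := fun s => T s z) (hball _ (hTball s hs z hz)).1.continuousAt
      (hTz z).continuousAt).continuousWithinAt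
  have hdiff : DifferentiableOn ℂ (fun z => ∫ s in (0 : ℝ)..1, Φ (T s z)) (Metric.ball c r) := by
    intro z₀ hz₀
    have := intervalIntegral.hasFDerivAt_integral_of_dominated_of_fderiv_le (𝕜 := ℂ)
      (μ := volume) (a := 0) (b := 1) (bound := fun _ => M)
      (F := fun z s => Φ (T s z)) (F' := fun z s => (fderiv ℂ Φ (T s z)).comp (T s))
      (x₀ := z₀) (Metric.isOpen_ball.mem_nhds hz₀) ?_ ?_ ?_ ?_ ?_ ?_
    · exact this.differentiableAt.differentiableWithinAt
    · filter_upwards [Metric.isOpen_ball.mem_nhds hz₀] with z hz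
      exact ((hcont z hz).mono Set.uIoc_subset_uIcc).aestronglyMeasurable measurableSet_uIoc
    · exact (hcont z₀ hz₀).intervalIntegrable
    · refine ContinuousOn.aestronglyMeasurable (fun s hs => ?_) measurableSet_uIoc
      have h1 := (hball _ (hTball s (Set.uIoc_subset_uIcc hs) z₀ hz₀)).1.fderiv.continuousAt
      have h3 : ContinuousAt (fun s => fderiv ℂ Φ (T s z₀)) s :=
        ContinuousAt.comp (f := fun s => T s z₀) h1 (hTz z₀).continuousAt
      exact (h3.clm_comp hT.continuousAt).continuousWithinAt
    · refine Eventually.of_forall fun s hs z hz => ?_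
      have hs' := Set.uIoc_subset_uIcc hs
      refine (ContinuousLinearMap.opNorm_comp_le _ _).trans ?_
      exact (mul_le_of_le_one_right (norm_nonneg _) (hTn s hs')).trans
        (hball _ (hTball s hs' z hz)).2.le
    · exact intervalIntegrable_const
    · refine Eventually.of_forall fun s hs z hz => ?_
      have h1 := (hball _ (hTball s (Set.uIoc_subset_uIcc hs) z hz)).1.differentiableAt.hasFDerivAt
      exact h1.comp z (T s).hasFDerivAt
  exact analyticAt_of_differentiableOn hdiff (Metric.ball_mem_nhds _ hr)

/-- The contraction `(w, v) ↦ (s w, v)`. -/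
def fstScale (k m : ℕ) (s : ℝ) : (Cn k × Cn m) →L[ℂ] (Cn k × Cn m) :=
  ((s : ℂ) • ContinuousLinearMap.fst ℂ (Cn k) (Cn m)).prod (ContinuousLinearMap.snd ℂ (Cn k) (Cn m))

theorem fstScale_apply {k m : ℕ} (s : ℝ) (z : Cn k × Cn m) :
    fstScale k m s z = ((s : ℂ) • z.1, z.2) := rfl

theorem continuous_fstScale (k m : ℕ) : Continuous (fstScale k m) := by
  have h1 : fstScale k m = fun s : ℝ => (s : ℂ) • ((ContinuousLinearMap.fst ℂ (Cn k) (Cn m)).prod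
      (0 : (Cn k × Cn m) →L[ℂ] Cn m)) + (0 : (Cn k × Cn m) →L[ℂ] Cn k).prod
      (ContinuousLinearMap.snd ℂ (Cn k) (Cn m)) := by
    funext s
    refine ContinuousLinearMap.ext fun z => Prod.ext ?_ ?_ <;> simp [fstScale]
  rw [h1]
  exact (Complex.continuous_ofReal.smul continuous_const).add continuous_const

theorem norm_fstScale_le {k m : ℕ} {s : ℝ} (hs : s ∈ Set.uIcc (0 : ℝ) 1) :
    ‖fstScale k m s‖ ≤ 1 := by
  rw [Set.uIcc_of_le zero_le_one] at hs
  refine ContinuousLinearMap.opNorm_le_bound _ zero_le_one fun z => ?_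
  rw [fstScale_apply, one_mul, Prod.norm_def, Prod.norm_def]
  refine max_le_max ?_ le_rfl
  rw [norm_smul, Complex.norm_real, Real.norm_eq_abs, abs_of_nonneg hs.1]
  nlinarith [hs.1, hs.2, norm_nonneg z.1]

theorem prod_zero_eq_sum {k m : ℕ} (w : Cn k) :
    ((w, 0) : Cn k × Cn m) = ∑ i, w i • (EuclideanSpace.single i (1 : ℂ), (0 : Cn m)) := by
  have h2 := (EuclideanSpace.basisFun (Fin k) ℂ).sum_repr w
  simp only [EuclideanSpace.basisFun_repr, EuclideanSpace.basisFun_apply] at h2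
  refine Prod.ext ?_ ?_
  · rw [Prod.fst_sum]
    simp only [Prod.smul_mk]
    rw [h2]
  · rw [Prod.snd_sum]
    simp

/-- Hadamard's lemma: a holomorphic function vanishing on `{w = 0}` is a combination of the
coordinates `w₁, …, w_k` with holomorphic coefficients. -/
theorem exists_eq_sum_coord_mul {k m : ℕ} {F : Cn k × Cn m → ℂ} {v₀ : Cn m}
    (hF : AnalyticAt ℂ F (0, v₀)) (h0 : ∀ᶠ v in 𝓝 v₀, F (0, v) = 0) :
    ∃ h : Fin k → Cn k × Cn m → ℂ, (∀ i, AnalyticAt ℂ (h i) (0, v₀)) ∧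
      ∀ᶠ z in 𝓝 ((0, v₀) : Cn k × Cn m), F z = ∑ i, z.1 i * h i z := by
  have hT0 : ∀ s : ℝ, fstScale k m s (0, v₀) = (0, v₀) := fun s => by simp [fstScale_apply]
  have hT := continuous_fstScale k m
  obtain ⟨r, hr, hball⟩ := Metric.eventually_nhds_iff_ball.1 hF.eventually_analyticAt
  have hTball : ∀ s ∈ Set.uIcc (0 : ℝ) 1, ∀ z ∈ Metric.ball ((0, v₀) : Cn k × Cn m) r,
      fstScale k m s z ∈ Metric.ball ((0, v₀) : Cn k × Cn m) r := by
    intro s hs z hz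
    rw [Metric.mem_ball, dist_eq_norm] at hz ⊢
    have h1 : fstScale k m s z - (0, v₀) = fstScale k m s (z - (0, v₀)) := by rw [map_sub, hT0]
    rw [h1]
    refine ((fstScale k m s).le_opNorm _).trans_lt (lt_of_le_of_lt ?_ hz)
    exact mul_le_of_le_one_left (norm_nonneg _) (norm_fstScale_le hs)
  let b : Fin k → Cn k × Cn m := fun i => (EuclideanSpace.single i (1 : ℂ), 0)
  have hcont : ∀ i, ∀ z ∈ Metric.ball ((0, v₀) : Cn k × Cn m) r,
      ContinuousOn (fun s => fderiv ℂ F (fstScale k m s z) (b i)) (Set.uIcc (0 : ℝ) 1) := by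
    intro i z hz s hs
    have h1 : ContinuousAt (fderiv ℂ F) (fstScale k m s z) :=
      (hball _ (hTball s hs z hz)).fderiv.continuousAt
    have h3 : ContinuousAt (fun s => fderiv ℂ F (fstScale k m s z)) s :=
      ContinuousAt.comp (f := fun s => fstScale k m s z) h1
        (hT.clm_apply continuous_const).continuousAt
    exact (h3.clm_apply continuousAt_const).continuousWithinAt
  refine ⟨fun i z => ∫ s in (0 : ℝ)..1, fderiv ℂ F (fstScale k m s z) (b i), fun i => ?_, ?_⟩
  · refine analyticAt_integral_comp_clm (Φ := fun z => fderiv ℂ F z (b i)) ?_ hT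
      (fun s hs => norm_fstScale_le hs) (fun s _ => hT0 s)
    exact ((ContinuousLinearMap.apply ℂ ℂ (b i)).analyticAt _).comp hF.fderiv
  have h0' : ∀ᶠ z in 𝓝 ((0, v₀) : Cn k × Cn m), F (0, z.2) = 0 :=
    (continuous_snd.tendsto ((0, v₀) : Cn k × Cn m)).eventually h0
  filter_upwards [h0', Metric.ball_mem_nhds _ hr] with z hz0 hz
  have hder : ∀ s ∈ Set.uIcc (0 : ℝ) 1, HasDerivAt (fun s : ℝ => F (fstScale k m s z))
      (fderiv ℂ F (fstScale k m s z) (z.1, 0)) s := by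
    intro s hs
    have h1 := (hball _ (hTball s hs z hz)).differentiableAt.hasFDerivAt
    have h2 : HasDerivAt (fun s : ℝ => fstScale k m s z) (z.1, 0) s := by
      have h3 : HasDerivAt (fun s : ℝ => (s : ℂ)) 1 s := Complex.ofRealCLM.hasDerivAt
      have h4 := h3.smul_const z.1
      rw [one_smul] at h4
      exact h4.prodMk (hasDerivAt_const s z.2)
    exact (h1.restrictScalars ℝ).comp_hasDerivAt s h2
  have hexp : ∀ s, fderiv ℂ F (fstScale k m s z) (z.1, 0) =
      ∑ i, z.1 i * fderiv ℂ F (fstScale k m s z) (b i) := by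
    intro s
    rw [prod_zero_eq_sum, map_sum]
    simp only [map_smul, smul_eq_mul, b]
  have hint := intervalIntegral.integral_eq_sub_of_hasDerivAt hder ?_
  · have e1 : fstScale k m 1 z = z := by simp [fstScale_apply]
    have e0 : fstScale k m 0 z = (0, z.2) := by simp [fstScale_apply]
    rw [e1, e0, hz0, sub_zero] at hint
    rw [← hint]
    simp_rw [hexp]
    rw [intervalIntegral.integral_finsetSum]
    · refine Finset.sum_congr rfl fun i _ => ?_
      rw [intervalIntegral.integral_const_mul]
    · intro i _
      exact ((hcont i z hz).intervalIntegrable).const_mul _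
  · simp_rw [hexp]
    refine ContinuousOn.intervalIntegrable ?_
    exact continuousOn_finsetSum _ fun i _ => continuousOn_const.mul (hcont i z hz)

/-! ### Submanifold coordinates -/

section Coord

variable {n k m : ℕ} {S : Set (Cn n)} {e : Coord n k m}

theorem IsSubmanifoldCoord.analyticAt (he : IsSubmanifoldCoord S e) {y : Cn n}
    (hy : y ∈ e.source) : AnalyticAt ℂ e y :=
  analyticAt_of_differentiableOn he.holo (e.open_source.mem_nhds hy)

theorem IsSubmanifoldCoord.analyticAt_symm (he : IsSubmanifoldCoord S e) {z : Cn k × Cn m}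
    (hz : z ∈ e.target) : AnalyticAt ℂ e.symm z :=
  analyticAt_of_differentiableOn he.holo_symm (e.open_target.mem_nhds hz)

theorem IsSubmanifoldCoord.apply_eq (he : IsSubmanifoldCoord S e) {x : Cn n}
    (hx : x ∈ e.source) (hxS : x ∈ S) : e x = (0, (e x).2) :=
  Prod.ext ((he.mem_iff x hx).1 hxS) rfl

theorem IsSubmanifoldCoord.zero_mem_target (he : IsSubmanifoldCoord S e) {x : Cn n}
    (hx : x ∈ e.source) (hxS : x ∈ S) : ((0 : Cn k), (e x).2) ∈ e.target := by
  rw [← he.apply_eq hx hxS]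
  exact e.map_source hx

theorem IsSubmanifoldCoord.symm_zero (he : IsSubmanifoldCoord S e) {x : Cn n}
    (hx : x ∈ e.source) (hxS : x ∈ S) : e.symm (0, (e x).2) = x := by
  rw [← he.apply_eq hx hxS]
  exact e.left_inv hx

theorem IsSubmanifoldCoord.symm_mem_iff (he : IsSubmanifoldCoord S e) {z : Cn k × Cn m}
    (hz : z ∈ e.target) : e.symm z ∈ S ↔ z.1 = 0 := by
  rw [he.mem_iff _ (e.map_target hz), e.right_inv hz]

theorem IsSubmanifoldCoord.analyticAt_coord (he : IsSubmanifoldCoord S e) {y : Cn n}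
    (hy : y ∈ e.source) (i : Fin k) : AnalyticAt ℂ (fun y => (e y).1 i) y := by
  have h := ((EuclideanSpace.proj (𝕜 := ℂ) i).comp
    (ContinuousLinearMap.fst ℂ (Cn k) (Cn m))).analyticAt (e y)
  exact h.comp (he.analyticAt hy)

end Coord

/-! ### Germs and their order of vanishing -/

section Germs

variable {n : ℕ} {x : Cn n}

/-- The germ of a holomorphic function. -/
def germOf (F : Cn n → ℂ) (hF : AnalyticAt ℂ F x) : holGerm x := ⟨F, F, hF, rfl⟩

/-- The ideal of germs that are `O(|y - x|^q)`. -/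
def ordIdeal (x : Cn n) (q : ℕ) : Ideal (holGerm x) where
  carrier := {a | ∃ F : Cn n → ℂ, (F : Germ (𝓝 x) ℂ) = a.1 ∧ F =O[𝓝 x] fun y => ‖y - x‖ ^ q}
  add_mem' := by
    rintro a b ⟨F, hF, hF'⟩ ⟨H, hH, hH'⟩
    exact ⟨F + H, by simp [← hF, ← hH], hF'.add hH'⟩
  zero_mem' := ⟨0, rfl, isBigO_zero _ _⟩
  smul_mem' := by
    rintro ⟨_, F, hF, rfl⟩ b ⟨H, hH, hH'⟩
    refine ⟨F * H, by simp [← hH], ?_⟩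
    have h1 : F =O[𝓝 x] fun _ => (1 : ℝ) := hF.continuousAt.tendsto.isBigO_one ℝ
    have h2 := h1.mul hH'
    simp only [one_mul] at h2
    exact h2

theorem isBigO_of_mem_ordIdeal {q : ℕ} {a : holGerm x} (ha : a ∈ ordIdeal x q) {F : Cn n → ℂ}
    (hF : (F : Germ (𝓝 x) ℂ) = a.1) : F =O[𝓝 x] fun y => ‖y - x‖ ^ q := by
  obtain ⟨H, hH, hH'⟩ := ha
  have h1 : H =ᶠ[𝓝 x] F := Germ.coe_eq.1 (hH.trans hF.symm)
  exact hH'.congr' h1 EventuallyEq.rfl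

theorem ordIdeal_mul_le (q r : ℕ) : ordIdeal x q * ordIdeal x r ≤ ordIdeal x (q + r) := by
  rw [Ideal.mul_le]
  rintro a ⟨F, hF, hF'⟩ b ⟨H, hH, hH'⟩
  refine ⟨F * H, by simp [← hF, ← hH], ?_⟩
  simp only [pow_add]
  exact hF'.mul hH'

theorem maximal_le_ordIdeal : idealStalk {x} x ≤ ordIdeal x 1 := by
  rintro ⟨_, F, hF, rfl⟩ ⟨H, hH, hH'⟩
  have h1 : H =ᶠ[𝓝 x] F := Germ.coe_eq.1 hH
  have h2 : F x = 0 := by rw [← h1.self_of_nhds]; exact hH'.self_of_nhds rfl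
  refine ⟨F, rfl, ?_⟩
  have h3 := hF.differentiableAt.isBigO_sub
  simp only [h2, sub_zero] at h3
  simpa using h3.norm_right

theorem idealStalk_le_maximal {S : Set (Cn n)} (hx : x ∈ S) : idealStalk S x ≤ idealStalk {x} x := by
  rintro a ⟨H, hH, hH'⟩
  refine ⟨H, hH, ?_⟩
  filter_upwards [] with y hy
  rw [Set.mem_singleton_iff.1 hy]
  exact hH'.self_of_nhds hx

theorem idealStalk_pow_le_ordIdeal {S : Set (Cn n)} (hx : x ∈ S) (q : ℕ) :
    idealStalk S x ^ q ≤ ordIdeal x q := by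
  induction q with
  | zero =>
    rintro ⟨_, F, hF, rfl⟩ -
    exact ⟨F, rfl, by simpa using hF.continuousAt.tendsto.isBigO_one ℝ⟩
  | succ q ih =>
    rw [pow_succ]
    exact (Ideal.mul_mono ih ((idealStalk_le_maximal hx).trans maximal_le_ordIdeal)).trans
      (ordIdeal_mul_le q 1)

theorem maximal_mul_le_ordIdeal {S : Set (Cn n)} (hx : x ∈ S) (q : ℕ) :
    idealStalk {x} x * idealStalk S x ^ q ≤ ordIdeal x (q + 1) := by
  rw [add_comm]
  exact (Ideal.mul_mono maximal_le_ordIdeal (idealStalk_pow_le_ordIdeal hx q)).trans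
    (ordIdeal_mul_le 1 q)

/-- Two representatives of an element of the fibre agree to order `p`. -/
theorem Represents.sub_isBigO {S : Set (Cn n)} (hx : x ∈ S) {p : ℕ} (hp : 1 ≤ p)
    {F H : Cn n → ℂ} {f : JetFibre S p x} (hF : Represents S p x F f)
    (hH : Represents S p x H f) : (fun y => F y - H y) =O[𝓝 x] fun y => ‖y - x‖ ^ p := by
  obtain ⟨a, ha, ha'⟩ := hF
  obtain ⟨b, hb, hb'⟩ := hH
  have h1 := (Submodule.Quotient.eq _).1 (ha'.trans hb'.symm)
  rw [Submodule.mem_comap] at h1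
  have h2 : idealStalk S x ^ p ⊔ idealStalk {x} x * idealStalk S x ^ (p - 1) ≤ ordIdeal x p := by
    refine sup_le (idealStalk_pow_le_ordIdeal hx p) ?_
    have := maximal_mul_le_ordIdeal hx (p - 1)
    rwa [Nat.sub_add_cancel hp] at this
  refine isBigO_of_mem_ordIdeal (h2 h1) ?_
  change ((F - H : Cn n → ℂ) : Germ (𝓝 x) ℂ) = a.1.1 - b.1.1
  rw [← ha, ← hb]
  rfl

end Germs

/-! ### Leading homogeneous polynomials -/

section Leading

variable {n k m : ℕ} {S : Set (Cn n)} {e : Coord n k m} {x : Cn n}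

/-- Constant germs. -/
def constGerm (x : Cn n) : ℂ →+* holGerm x where
  toFun c := germOf (fun _ => c) analyticAt_const
  map_one' := rfl
  map_mul' _ _ := rfl
  map_zero' := rfl
  map_add' _ _ := rfl

/-- The germ of the coordinate `z_i`. -/
def coordGerm (he : IsSubmanifoldCoord S e) (hx : x ∈ e.source) (i : Fin k) : holGerm x :=
  germOf (fun y => (e y).1 i) (he.analyticAt_coord hx i)

/-- The germ of a polynomial in `z₁, …, z_k`. -/
def polyGerm (he : IsSubmanifoldCoord S e) (hx : x ∈ e.source) :
    MvPolynomial (Fin k) ℂ →+* holGerm x :=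
  MvPolynomial.eval₂Hom (constGerm x) (coordGerm he hx)

theorem polyGerm_val (he : IsSubmanifoldCoord S e) (hx : x ∈ e.source)
    (P : MvPolynomial (Fin k) ℂ) : (polyGerm he hx P).1 = (coordPoly e P : Germ (𝓝 x) ℂ) := by
  induction P using MvPolynomial.induction_on with
  | C a =>
    have : coordPoly e (MvPolynomial.C a) = fun _ => a := by
      funext y
      simp [coordPoly]
    rw [this, polyGerm, MvPolynomial.eval₂Hom_C]
    rfl
  | add P Q hP hQ =>
    have : coordPoly e (P + Q) = coordPoly e P + coordPoly e Q := by
      funext y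
      simp [coordPoly]
    rw [this, map_add, Subring.coe_add, hP, hQ]
    rfl
  | mul_X P i hP =>
    have : coordPoly e (P * MvPolynomial.X i) = coordPoly e P * fun y => (e y).1 i := by
      funext y
      simp [coordPoly]
    rw [this, map_mul, Subring.coe_mul, hP, polyGerm, MvPolynomial.eval₂Hom_X']
    rfl

theorem coordGerm_mem (he : IsSubmanifoldCoord S e) (hx : x ∈ e.source) (i : Fin k) :
    coordGerm he hx i ∈ idealStalk S x := by
  refine ⟨_, rfl, ?_⟩
  filter_upwards [e.open_source.mem_nhds hx] with y hy hyS
  simp [(he.mem_iff y hy).1 hyS]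

theorem exists_eq_sum_coordGerm (he : IsSubmanifoldCoord S e) (hx : x ∈ e.source) (hxS : x ∈ S)
    {a : holGerm x} (ha : a ∈ idealStalk S x) :
    ∃ h : Fin k → holGerm x, a = ∑ i, coordGerm he hx i * h i := by
  obtain ⟨_, F, hF, rfl⟩ := a
  obtain ⟨H, hH, hH'⟩ := ha
  have hF0 : ∀ᶠ y in 𝓝 x, y ∈ S → F y = 0 := by
    filter_upwards [Germ.coe_eq.1 hH, hH'] with y h1 h2 hy
    rw [← h1, h2 hy]
  have hT := he.zero_mem_target hx hxS
  have hS := he.symm_zero hx hxS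
  have hA : AnalyticAt ℂ (F ∘ e.symm) (0, (e x).2) := by
    refine AnalyticAt.comp ?_ (he.analyticAt_symm hT)
    rwa [hS]
  have hz : ∀ᶠ v in 𝓝 (e x).2, (F ∘ e.symm) ((0 : Cn k), v) = 0 := by
    have hc : Tendsto (fun v : Cn m => ((0 : Cn k), v)) (𝓝 (e x).2) (𝓝 (0, (e x).2)) :=
      (Continuous.prodMk_right (0 : Cn k)).tendsto _
    have hc' : Tendsto (fun v : Cn m => e.symm ((0 : Cn k), v)) (𝓝 (e x).2) (𝓝 x) := by
      have := (e.continuousAt_symm hT).tendsto.comp hc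
      rwa [hS] at this
    filter_upwards [hc.eventually (e.open_target.mem_nhds hT), hc'.eventually hF0] with v h1 h2
    exact h2 ((he.symm_mem_iff h1).2 rfl)
  obtain ⟨h, hh, hsum⟩ := exists_eq_sum_coord_mul hA hz
  rw [← he.apply_eq hx hxS] at hh hsum
  refine ⟨fun i => germOf (h i ∘ e) ((hh i).comp (he.analyticAt hx)), Subtype.ext ?_⟩
  rw [AddSubmonoidClass.coe_finsetSum]
  have h1 : ∀ i, (coordGerm he hx i * germOf (h i ∘ e) ((hh i).comp (he.analyticAt hx))).1 =
      Germ.coeRingHom (𝓝 x) (fun y => (e y).1 i * h i (e y)) := fun i => rfl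
  simp only [h1, ← map_sum]
  refine Germ.coe_eq.2 ?_
  filter_upwards [(he.analyticAt hx).continuousAt.tendsto.eventually hsum,
    e.open_source.mem_nhds hx] with y h1 h2
  simp only [Function.comp, e.left_inv h2] at h1
  rw [h1]
  simp

/-- The part `h - h(x)` of a germ in the maximal ideal. -/
theorem exists_sub_constGerm_mem (h : holGerm x) : ∃ c : ℂ, h - constGerm x c ∈ idealStalk {x} x := by
  obtain ⟨_, F, hF, rfl⟩ := h
  refine ⟨F x, F - fun _ => F x, rfl, Eventually.of_forall fun y hy => ?_⟩
  rw [Set.mem_singleton_iff.1 hy]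
  simp

theorem exists_leading (he : IsSubmanifoldCoord S e) (hx : x ∈ e.source) (hxS : x ∈ S) (q : ℕ) :
    ∀ a ∈ idealStalk S x ^ q, ∃ P : MvPolynomial (Fin k) ℂ, P.IsHomogeneous q ∧
      a - polyGerm he hx P ∈ idealStalk {x} x * idealStalk S x ^ q := by
  induction q with
  | zero =>
    intro a _
    obtain ⟨c, hc⟩ := exists_sub_constGerm_mem a
    refine ⟨MvPolynomial.C c, MvPolynomial.isHomogeneous_C _ _, ?_⟩
    rw [pow_zero, Ideal.one_eq_top, Ideal.mul_top, polyGerm, MvPolynomial.eval₂Hom_C]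
    exact hc
  | succ q ih =>
    intro a ha
    rw [pow_succ'] at ha
    refine Submodule.mul_induction_on ha ?_ ?_
    · intro b hb c hc
      obtain ⟨P, hP, hcP⟩ := ih c hc
      obtain ⟨h, hh⟩ := exists_eq_sum_coordGerm he hx hxS hb
      choose w hw using fun i => exists_sub_constGerm_mem (h i)
      refine ⟨(∑ i, MvPolynomial.C (w i) * MvPolynomial.X i) * P, ?_, ?_⟩
      · rw [add_comm q 1]
        refine MvPolynomial.IsHomogeneous.mul ?_ hP
        refine MvPolynomial.IsHomogeneous.sum _ _ _ fun i _ => ?_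
        simpa using (MvPolynomial.isHomogeneous_C (Fin k) (w i)).mul
          (MvPolynomial.isHomogeneous_X ℂ i)
      · have h1 : polyGerm he hx (∑ i, MvPolynomial.C (w i) * MvPolynomial.X i) =
            ∑ i, coordGerm he hx i * constGerm x (w i) := by
          rw [map_sum]
          refine Finset.sum_congr rfl fun i _ => ?_
          rw [map_mul, polyGerm, MvPolynomial.eval₂Hom_C, MvPolynomial.eval₂Hom_X', mul_comm]
        have h2 : b - polyGerm he hx (∑ i, MvPolynomial.C (w i) * MvPolynomial.X i) ∈
            idealStalk {x} x * idealStalk S x := by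
          rw [h1, hh, ← Finset.sum_sub_distrib]
          refine Ideal.sum_mem _ fun i _ => ?_
          rw [← mul_sub, mul_comm (coordGerm he hx i)]
          exact Ideal.mul_mem_mul (hw i) (coordGerm_mem he hx i)
        have h3 : b * c - polyGerm he hx ((∑ i, MvPolynomial.C (w i) * MvPolynomial.X i) * P) =
            (b - polyGerm he hx (∑ i, MvPolynomial.C (w i) * MvPolynomial.X i)) * c +
            polyGerm he hx (∑ i, MvPolynomial.C (w i) * MvPolynomial.X i) *
              (c - polyGerm he hx P) := by
          rw [map_mul]
          ring
        rw [h3]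
        refine Ideal.add_mem _ ?_ ?_
        · rw [pow_succ', ← mul_assoc]
          exact Ideal.mul_mem_mul h2 hc
        · rw [pow_succ', mul_left_comm]
          refine Ideal.mul_mem_mul ?_ hcP
          rw [h1]
          exact Ideal.sum_mem _ fun i _ => Ideal.mul_mem_right _ _ (coordGerm_mem he hx i)
    · rintro b c ⟨P, hP, hbP⟩ ⟨Q, hQ, hcQ⟩
      refine ⟨P + Q, hP.add hQ, ?_⟩
      rw [map_add, add_sub_add_comm]
      exact Ideal.add_mem _ hbP hcQ

theorem coordPoly_mem_pow (he : IsSubmanifoldCoord S e) (hx : x ∈ e.source) {q : ℕ}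
    {P : MvPolynomial (Fin k) ℂ} (hP : P.IsHomogeneous q) :
    polyGerm he hx P ∈ idealStalk S x ^ q := by
  rw [P.as_sum, map_sum]
  refine Ideal.sum_mem _ fun α hα => ?_
  rw [polyGerm, MvPolynomial.coe_eval₂Hom, MvPolynomial.eval₂_monomial]
  refine Ideal.mul_mem_left _ _ ?_
  have h1 : ∑ i ∈ α.support, α i = q := by
    have := hP (MvPolynomial.mem_support_iff.1 hα)
    rwa [Pi.one_def, ← Finsupp.degree_eq_weight_one] at this
  rw [← h1, Finsupp.prod, ← Finset.prod_pow_eq_pow_sum]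
  exact Ideal.prod_mem_prod fun i _ => Ideal.pow_mem_pow (coordGerm_mem he hx i) _

theorem exists_correspondsTo (he : IsSubmanifoldCoord S e) (hx : x ∈ e.source) (hxS : x ∈ S)
    (p : ℕ) (f : JetFibre S p x) : ∃ P, CorrespondsTo S p e x f P := by
  obtain ⟨a, rfl⟩ := Submodule.Quotient.mk_surjective _ f
  obtain ⟨P, hP, haP⟩ := exists_leading he hx hxS (p - 1) a.1 a.2
  refine ⟨P, hP, ⟨polyGerm he hx P, coordPoly_mem_pow he hx hP⟩, (polyGerm_val he hx P).symm, ?_⟩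
  symm
  rw [Submodule.Quotient.eq, Submodule.mem_comap]
  exact Submodule.mem_sup_right haP

end Leading

/-! ### Gram determinants -/

theorem gramDet_comp {n : ℕ} {ι : Type} [Fintype ι] [DecidableEq ι] {V : Type*} [AddCommGroup V]
    [Module ℂ V] (β : Module.Basis ι ℂ V) (M : V →ₗ[ℂ] Cn n) (B : V →ₗ[ℂ] V) :
    gramDet (fun j => M (B (β j))) = ‖LinearMap.det B‖ ^ 2 * gramDet (fun j => M (β j)) := by
  set b := LinearMap.toMatrix β β B with hb
  have h1 : Matrix.gram ℂ (fun j => M (B (β j))) =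
      b.conjTranspose * Matrix.gram ℂ (fun j => M (β j)) * b := by
    have h2 : ∀ j, M (B (β j)) = ∑ l, b l j • M (β l) := by
      intro j
      conv_lhs => rw [← β.sum_repr (B (β j))]
      rw [map_sum]
      simp only [map_smul, hb, LinearMap.toMatrix_apply]
    ext i j
    simp only [Matrix.gram_apply, h2, sum_inner, inner_sum, inner_smul_left, inner_smul_right,
      Matrix.mul_apply, Matrix.conjTranspose_apply, Finset.sum_mul, Finset.mul_sum]
    refine Finset.sum_congr rfl fun l _ => Finset.sum_congr rfl fun l' _ => ?_
    simp only [RCLike.star_def]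
    ring
  unfold gramDet
  rw [h1, Matrix.det_mul, Matrix.det_mul, Matrix.det_conjTranspose, ← LinearMap.det_toMatrix β B,
    ← hb, mul_right_comm, RCLike.star_def, mul_comm (conj b.det), Complex.mul_conj,
    Complex.normSq_eq_norm_sq, Complex.re_ofReal_mul]

theorem gramDet_pos {n : ℕ} {ι : Type} [Fintype ι] [DecidableEq ι] {v : ι → Cn n}
    (hv : LinearIndependent ℂ v) : 0 < gramDet v := by
  have h := (Matrix.posDef_gram_of_linearIndependent hv).det_pos
  exact (Complex.lt_def.1 h).1

/-- The standard basis of `ℂᵏ × ℂᵐ`. -/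
def prodBasis (k m : ℕ) : Module.Basis (Fin k ⊕ Fin m) ℂ (Cn k × Cn m) :=
  (EuclideanSpace.basisFun (Fin k) ℂ).toBasis.prod (EuclideanSpace.basisFun (Fin m) ℂ).toBasis

theorem prodBasis_apply {k m : ℕ} (s : Fin k ⊕ Fin m) : prodBasis k m s =
    Sum.elim (fun i => (EuclideanSpace.single i (1 : ℂ), (0 : Cn m)))
      (fun j => ((0 : Cn k), EuclideanSpace.single j (1 : ℂ))) s := by
  rcases s with i | j <;> simp [prodBasis]

theorem det_of_block_triangular {k m : ℕ} (D : (Cn k × Cn m) →ₗ[ℂ] (Cn k × Cn m))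
    (h : ∀ v, (D (0, v)).1 = 0) : LinearMap.det D =
      LinearMap.det (LinearMap.fst ℂ (Cn k) (Cn m) ∘ₗ D ∘ₗ LinearMap.inl ℂ (Cn k) (Cn m)) *
      LinearMap.det (LinearMap.snd ℂ (Cn k) (Cn m) ∘ₗ D ∘ₗ LinearMap.inr ℂ (Cn k) (Cn m)) := by
  set βk := (EuclideanSpace.basisFun (Fin k) ℂ).toBasis
  set βm := (EuclideanSpace.basisFun (Fin m) ℂ).toBasis
  rw [← LinearMap.det_toMatrix (βk.prod βm), ← LinearMap.det_toMatrix βk,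
    ← LinearMap.det_toMatrix βm, ← Matrix.det_fromBlocks_zero₁₂ _
      (LinearMap.toMatrix βk βm (LinearMap.snd ℂ (Cn k) (Cn m) ∘ₗ D ∘ₗ LinearMap.inl ℂ _ _))]
  congr 1
  ext i j
  rcases i with i | i <;> rcases j with j | j <;> simp [LinearMap.toMatrix_apply, h]

theorem abs_det_restrictScalars {V : Type*} [NormedAddCommGroup V] [NormedSpace ℂ V]
    [FiniteDimensional ℂ V] (B : V →L[ℂ] V) :
    |(B.restrictScalars ℝ).det| = ‖LinearMap.det (B : V →ₗ[ℂ] V)‖ ^ 2 := by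
  have h : (B.restrictScalars ℝ).det = ‖LinearMap.det (B : V →ₗ[ℂ] V)‖ ^ 2 := by
    rw [← Complex.normSq_eq_norm_sq, ← Algebra.norm_complex_apply, ← LinearMap.det_restrictScalars]
    rfl
  rw [h, abs_of_nonneg (by positivity)]

/-! ### Change of coordinates -/

section Transition

variable {n k m : ℕ} {S : Set (Cn n)} {e e' : Coord n k m} {x : Cn n}

theorem IsSubmanifoldCoord.fderiv_symm_comp (he : IsSubmanifoldCoord S e) (hx : x ∈ e.source)
    (u : Cn n) : fderiv ℂ e.symm (e x) (fderiv ℂ e x u) = u := by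
  have h1 := (he.analyticAt_symm (e.map_source hx)).differentiableAt.hasFDerivAt
  have h2 := (he.analyticAt hx).differentiableAt.hasFDerivAt
  have h3 := h1.comp x h2
  have h4 : HasFDerivAt (e.symm ∘ e) (ContinuousLinearMap.id ℂ (Cn n)) x := by
    refine (hasFDerivAt_id x).congr_of_eventuallyEq ?_
    filter_upwards [e.open_source.mem_nhds hx] with y hy
    simp [e.left_inv hy]
  exact congrArg (fun L => L u) (h3.unique h4)

theorem IsSubmanifoldCoord.fderiv_comp_symm (he : IsSubmanifoldCoord S e) (hx : x ∈ e.source)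
    (u : Cn k × Cn m) : fderiv ℂ e x (fderiv ℂ e.symm (e x) u) = u := by
  have h1 := (he.analyticAt_symm (e.map_source hx)).differentiableAt.hasFDerivAt
  have h2 := (he.analyticAt hx).differentiableAt.hasFDerivAt
  rw [← e.left_inv hx] at h2
  have h3 := h2.comp (e x) h1
  have h4 : HasFDerivAt (e ∘ e.symm) (ContinuousLinearMap.id ℂ (Cn k × Cn m)) (e x) := by
    refine (hasFDerivAt_id (e x)).congr_of_eventuallyEq ?_
    filter_upwards [e.open_target.mem_nhds (e.map_source hx)] with y hy
    simp [e.right_inv hy]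
  rw [e.left_inv hx] at h3
  exact congrArg (fun L => L u) (h3.unique h4)

theorem IsSubmanifoldCoord.ambientDensity_pos (he : IsSubmanifoldCoord S e)
    {z : Cn k × Cn m} (hz : z ∈ e.target) : 0 < ambientDensity e z := by
  unfold ambientDensity
  refine gramDet_pos ?_
  simp_rw [← prodBasis_apply]
  refine (prodBasis k m).linearIndependent.map' (fderiv ℂ e.symm z : (Cn k × Cn m) →ₗ[ℂ] Cn n) ?_
  refine LinearMap.ker_eq_bot.2 fun u v huv => ?_
  have h1 := he.fderiv_comp_symm (e.map_target hz) u
  have h2 := he.fderiv_comp_symm (e.map_target hz) v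
  rw [e.right_inv hz] at h1 h2
  rw [← h1, ← h2]
  exact congrArg _ huv

theorem IsSubmanifoldCoord.subDensity_pos (he : IsSubmanifoldCoord S e)
    {w : Cn m} (hz : ((0 : Cn k), w) ∈ e.target) : 0 < subDensity e w := by
  unfold subDensity
  refine gramDet_pos ?_
  have h0 := ((prodBasis k m).linearIndependent.comp (Sum.inr : Fin m → Fin k ⊕ Fin m)
    Sum.inr_injective)
  have h3 := h0.map' (fderiv ℂ e.symm (0, w) : (Cn k × Cn m) →ₗ[ℂ] Cn n) ?_
  · have h4 : (fun j : Fin m => fderiv ℂ e.symm ((0 : Cn k), w)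
        ((0 : Cn k), EuclideanSpace.single j (1 : ℂ))) =
        (fderiv ℂ e.symm (0, w) : (Cn k × Cn m) →ₗ[ℂ] Cn n) ∘ prodBasis k m ∘ Sum.inr := by
      funext j
      simp [prodBasis_apply]
    rw [h4]
    exact h3
  refine LinearMap.ker_eq_bot.2 fun u v huv => ?_
  have h1 := he.fderiv_comp_symm (e.map_target hz) u
  have h2 := he.fderiv_comp_symm (e.map_target hz) v
  rw [e.right_inv hz] at h1 h2
  rw [← h1, ← h2]
  exact congrArg _ huv

/-- The derivative of the change of coordinates from `e` to `e'` at `x`. -/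
def transD (e e' : Coord n k m) (x : Cn n) : (Cn k × Cn m) →L[ℂ] (Cn k × Cn m) :=
  (fderiv ℂ e' x).comp (fderiv ℂ e.symm (e x))

/-- The normal part of the derivative of the change of coordinates. -/
def normalD (e e' : Coord n k m) (x : Cn n) : Cn k →L[ℂ] Cn k :=
  (ContinuousLinearMap.fst ℂ (Cn k) (Cn m)).comp
    ((transD e e' x).comp (ContinuousLinearMap.inl ℂ (Cn k) (Cn m)))

/-- The tangential part of the derivative of the change of coordinates. -/
def tangentD (e e' : Coord n k m) (x : Cn n) : Cn m →L[ℂ] Cn m :=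
  (ContinuousLinearMap.snd ℂ (Cn k) (Cn m)).comp
    ((transD e e' x).comp (ContinuousLinearMap.inr ℂ (Cn k) (Cn m)))

theorem hasFDerivAt_trans (he : IsSubmanifoldCoord S e) (he' : IsSubmanifoldCoord S e')
    (hx : x ∈ e.source) (hx' : x ∈ e'.source) :
    HasFDerivAt (fun z => e' (e.symm z)) (transD e e' x) (e x) := by
  have h1 := (he.analyticAt_symm (e.map_source hx)).differentiableAt.hasFDerivAt
  have h2 := (he'.analyticAt hx').differentiableAt.hasFDerivAt
  rw [← e.left_inv hx] at h2
  have h3 := h2.comp (e x) h1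
  rw [e.left_inv hx] at h3
  exact h3

theorem transD_tangent (he : IsSubmanifoldCoord S e) (he' : IsSubmanifoldCoord S e')
    (hx : x ∈ e.source) (hx' : x ∈ e'.source) (hxS : x ∈ S) (v : Cn m) :
    transD e e' x (0, v) = (0, tangentD e e' x v) := by
  refine Prod.ext ?_ rfl
  have h1 := hasFDerivAt_trans he he' hx hx'
  rw [he.apply_eq hx hxS] at h1
  have h2 := h1.comp (e x).2 (hasFDerivAt_prodMk_right (𝕜 := ℂ) (0 : Cn k) (e x).2)
  have h3 := h2.fst
  have h4 : HasFDerivAt (fun w : Cn m => (e' (e.symm ((0 : Cn k), w))).1)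
      (0 : Cn m →L[ℂ] Cn k) (e x).2 := by
    refine (hasFDerivAt_const (0 : Cn k) (e x).2).congr_of_eventuallyEq ?_
    have hT := he.zero_mem_target hx hxS
    have hc : Tendsto (fun v : Cn m => ((0 : Cn k), v)) (𝓝 (e x).2) (𝓝 (0, (e x).2)) :=
      (Continuous.prodMk_right (0 : Cn k)).tendsto _
    have hc' : Tendsto (fun v : Cn m => e.symm ((0 : Cn k), v)) (𝓝 (e x).2) (𝓝 x) := by
      have := (e.continuousAt_symm hT).tendsto.comp hc
      rwa [he.symm_zero hx hxS] at this
    filter_upwards [hc.eventually (e.open_target.mem_nhds hT),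
      hc'.eventually (e'.open_source.mem_nhds hx')] with w h5 h6
    exact (he'.mem_iff _ h6).1 ((he.symm_mem_iff h5).2 rfl)
  exact congrArg (fun L => L v) (h3.unique h4)

theorem fderiv_symm_eq (he' : IsSubmanifoldCoord S e') (hx' : x ∈ e'.source)
    (u : Cn k × Cn m) : fderiv ℂ e.symm (e x) u = fderiv ℂ e'.symm (e' x) (transD e e' x u) :=
  (he'.fderiv_symm_comp hx' _).symm

theorem det_transD (he : IsSubmanifoldCoord S e) (he' : IsSubmanifoldCoord S e')
    (hx : x ∈ e.source) (hx' : x ∈ e'.source) (hxS : x ∈ S) :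
    LinearMap.det (transD e e' x : (Cn k × Cn m) →ₗ[ℂ] (Cn k × Cn m)) =
      LinearMap.det (normalD e e' x : Cn k →ₗ[ℂ] Cn k) *
      LinearMap.det (tangentD e e' x : Cn m →ₗ[ℂ] Cn m) := by
  rw [det_of_block_triangular]
  · rfl
  · intro v
    exact congrArg Prod.fst (transD_tangent he he' hx hx' hxS v)

theorem ambientDensity_trans (he' : IsSubmanifoldCoord S e') (hx' : x ∈ e'.source) :
    ambientDensity e (e x) =
      ‖LinearMap.det (transD e e' x : (Cn k × Cn m) →ₗ[ℂ] (Cn k × Cn m))‖ ^ 2 *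
        ambientDensity e' (e' x) := by
  have h := gramDet_comp (prodBasis k m)
    (fderiv ℂ e'.symm (e' x) : (Cn k × Cn m) →ₗ[ℂ] Cn n) (transD e e' x)
  simp only [prodBasis_apply, ContinuousLinearMap.coe_coe] at h
  unfold ambientDensity
  rw [← h]
  simp only [fderiv_symm_eq (e := e) he' hx']

theorem subDensity_trans (he : IsSubmanifoldCoord S e) (he' : IsSubmanifoldCoord S e')
    (hx : x ∈ e.source) (hx' : x ∈ e'.source) (hxS : x ∈ S) :
    subDensity e (e x).2 =
      ‖LinearMap.det (tangentD e e' x : Cn m →ₗ[ℂ] Cn m)‖ ^ 2 * subDensity e' (e' x).2 := by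
  have h := gramDet_comp (EuclideanSpace.basisFun (Fin m) ℂ).toBasis
    ((fderiv ℂ e'.symm (e' x) : (Cn k × Cn m) →ₗ[ℂ] Cn n) ∘ₗ LinearMap.inr ℂ (Cn k) (Cn m))
    (tangentD e e' x)
  simp only [OrthonormalBasis.coe_toBasis, EuclideanSpace.basisFun_apply, LinearMap.comp_apply,
    LinearMap.inr_apply, ContinuousLinearMap.coe_coe] at h
  unfold subDensity
  rw [← he.apply_eq hx hxS, ← he'.apply_eq hx' hxS, ← h]
  simp only [fderiv_symm_eq (e := e) he' hx', transD_tangent he he' hx hx' hxS]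

theorem density_ratio_trans (he : IsSubmanifoldCoord S e) (he' : IsSubmanifoldCoord S e')
    (hx : x ∈ e.source) (hx' : x ∈ e'.source) (hxS : x ∈ S) :
    ambientDensity e (e x) / subDensity e (e x).2 =
      ‖LinearMap.det (normalD e e' x : Cn k →ₗ[ℂ] Cn k)‖ ^ 2 *
        (ambientDensity e' (e' x) / subDensity e' (e' x).2) := by
  have h1 := he.subDensity_pos (he.zero_mem_target hx hxS)
  rw [subDensity_trans he he' hx hx' hxS] at h1 ⊢
  have h2 : ‖LinearMap.det (tangentD e e' x : Cn m →ₗ[ℂ] Cn m)‖ ^ 2 ≠ 0 := fun h => by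
    simp [h] at h1
  rw [ambientDensity_trans he' hx', det_transD he he' hx hx' hxS, norm_mul, mul_pow]
  rw [mul_right_comm, mul_comm (_ * _) (‖_‖ ^ 2), mul_div_mul_left _ _ h2, mul_div_assoc]

end Transition

/-! ### Comparison of two systems of coordinates along curves transverse to `S` -/

theorem eval_smul_of_isHomogeneous {k q : ℕ} {P : MvPolynomial (Fin k) ℂ} (hP : P.IsHomogeneous q)
    (c : ℂ) (v : Fin k → ℂ) :
    MvPolynomial.eval (fun i => c * v i) P = c ^ q * MvPolynomial.eval v P := by
  rw [MvPolynomial.eval_eq, MvPolynomial.eval_eq, Finset.mul_sum]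
  refine Finset.sum_congr rfl fun α hα => ?_
  have h1 : ∑ i ∈ α.support, α i = q := by
    have := hP (MvPolynomial.mem_support_iff.1 hα)
    rwa [Pi.one_def, ← Finsupp.degree_eq_weight_one] at this
  simp only [mul_pow, Finset.prod_mul_distrib, Finset.prod_pow_eq_pow_sum, h1]
  ring

theorem continuous_eval_euclidean {k : ℕ} (P : MvPolynomial (Fin k) ℂ) :
    Continuous fun v : Cn k => MvPolynomial.eval (fun i => v i) P :=
  (MvPolynomial.continuous_eval P).comp (by fun_prop)

section Compare

variable {n k m : ℕ} {D S : Set (Cn n)} {G : Cn n → EReal} {e e' : Coord n k m} {x : Cn n}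

theorem IsSubmanifoldCoord.hasDerivAt_curve (he : IsSubmanifoldCoord S e) (hx : x ∈ e.source)
    (hxS : x ∈ S) (v : Cn k) :
    HasDerivAt (fun s : ℝ => e.symm ((s : ℂ) • v, (e x).2)) (fderiv ℂ e.symm (e x) (v, 0)) 0 := by
  have h3 : HasDerivAt (fun s : ℝ => (s : ℂ)) 1 0 := Complex.ofRealCLM.hasDerivAt
  have h4 := h3.smul_const v
  rw [one_smul] at h4
  have h5 := h4.prodMk (hasDerivAt_const (0 : ℝ) (e x).2)
  have h1 := (he.analyticAt_symm (e.map_source hx)).differentiableAt.hasFDerivAt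
  have h6 : e x = (((0 : ℝ) : ℂ) • v, (e x).2) := by
    simpa using he.apply_eq hx hxS
  rw [h6] at h1
  have h7 := (h1.restrictScalars ℝ).comp_hasDerivAt (0 : ℝ) h5
  rw [← h6] at h7
  exact h7

theorem IsSubmanifoldCoord.tendsto_curve (he : IsSubmanifoldCoord S e) (hx : x ∈ e.source)
    (hxS : x ∈ S) (v : Cn k) :
    Tendsto (fun s : ℝ => e.symm ((s : ℂ) • v, (e x).2)) (𝓝 0) (𝓝 x) := by
  have h := (he.hasDerivAt_curve hx hxS v).continuousAt.tendsto
  simpa [he.symm_zero hx hxS] using h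

theorem IsSubmanifoldCoord.eventually_curve_mem (he : IsSubmanifoldCoord S e) (hx : x ∈ e.source)
    (hxS : x ∈ S) (v : Cn k) :
    ∀ᶠ s : ℝ in 𝓝 0, ((s : ℂ) • v, (e x).2) ∈ e.target := by
  have h : Tendsto (fun s : ℝ => ((s : ℂ) • v, (e x).2)) (𝓝 0) (𝓝 ((0 : Cn k), (e x).2)) := by
    have : Continuous fun s : ℝ => ((s : ℂ) • v, (e x).2) := by fun_prop
    simpa using this.tendsto 0
  exact h.eventually (e.open_target.mem_nhds (he.zero_mem_target hx hxS))

theorem tendsto_inv_smul_curve (he : IsSubmanifoldCoord S e) (he' : IsSubmanifoldCoord S e')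
    (hx : x ∈ e.source) (hx' : x ∈ e'.source) (hxS : x ∈ S) (v : Cn k) :
    Tendsto (fun s : ℝ => (s : ℂ)⁻¹ • (e' (e.symm ((s : ℂ) • v, (e x).2))).1) (𝓝[≠] 0)
      (𝓝 (normalD e e' x v)) := by
  have h1 := he.hasDerivAt_curve hx hxS v
  have h2 := (he'.analyticAt hx').differentiableAt.hasFDerivAt.restrictScalars ℝ
  have h3 : e.symm (((0 : ℝ) : ℂ) • v, (e x).2) = x := by simp [he.symm_zero hx hxS]
  have h4 := HasFDerivAt.comp_hasDerivAt_of_eq (0 : ℝ) h2 h1 h3.symm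
  have h5 := (ContinuousLinearMap.fst ℝ (Cn k) (Cn m)).hasFDerivAt.comp_hasDerivAt (0 : ℝ) h4
  have h6 := hasDerivAt_iff_tendsto_slope_zero.1 h5
  have h7 : (e' (e.symm (((0 : ℝ) : ℂ) • v, (e x).2))).1 = 0 := by
    rw [h3]
    exact (he'.mem_iff x hx').1 hxS
  refine (h6.congr fun s => ?_)
  simp only [Function.comp, zero_add, ContinuousLinearMap.coe_fst', h7, sub_zero]
  rw [← Complex.ofReal_inv]
  exact (Complex.coe_smul _ _).symm

theorem eval_eq_eval_normalD (he : IsSubmanifoldCoord S e) (he' : IsSubmanifoldCoord S e')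
    (hx : x ∈ e.source) (hx' : x ∈ e'.source) (hxS : x ∈ S) {q : ℕ}
    {P P' : MvPolynomial (Fin k) ℂ} (hP : P.IsHomogeneous q) (hP' : P'.IsHomogeneous q)
    (h : (fun y => coordPoly e P y - coordPoly e' P' y) =O[𝓝 x] fun y => ‖y - x‖ ^ (q + 1))
    (v : Cn k) : MvPolynomial.eval (fun i => v i) P =
      MvPolynomial.eval (fun i => normalD e e' x v i) P' := by
  have hcurve := he.tendsto_curve hx hxS v
  have hO : (fun s : ℝ => e.symm ((s : ℂ) • v, (e x).2) - x) =O[𝓝 0] fun s : ℝ => s := by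
    have := (he.hasDerivAt_curve hx hxS v).isBigO_sub
    simpa [he.symm_zero hx hxS] using this
  have h1 := (h.comp_tendsto hcurve).trans (hO.norm_left.pow (q + 1))
  have h2 : Tendsto (fun s : ℝ => MvPolynomial.eval (fun i => v i) P -
      MvPolynomial.eval (fun i => ((s : ℂ)⁻¹ • (e' (e.symm ((s : ℂ) • v, (e x).2))).1) i) P')
      (𝓝[≠] 0) (𝓝 (MvPolynomial.eval (fun i => v i) P -
        MvPolynomial.eval (fun i => normalD e e' x v i) P')) :=
    tendsto_const_nhds.sub (((continuous_eval_euclidean P').tendsto _).comp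
      (tendsto_inv_smul_curve he he' hx hx' hxS v))
  have h3 : (fun s : ℝ => MvPolynomial.eval (fun i => v i) P -
      MvPolynomial.eval (fun i => ((s : ℂ)⁻¹ • (e' (e.symm ((s : ℂ) • v, (e x).2))).1) i) P')
      =O[𝓝[≠] 0] fun s : ℝ => s := by
    have h4 : (fun s : ℝ => ((s : ℂ)⁻¹) ^ q) =O[𝓝[≠] 0] fun s : ℝ => (s⁻¹) ^ q := by
      refine IsBigO.of_bound 1 (Eventually.of_forall fun s => ?_)
      simp
    have h5 := h4.mul (h1.mono (nhdsWithin_le_nhds (s := {0}ᶜ)))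
    refine h5.congr' ?_ ?_
    · filter_upwards [self_mem_nhdsWithin,
        nhdsWithin_le_nhds (he.eventually_curve_mem hx hxS v)] with s hs hT
      have hs' : (s : ℂ) ≠ 0 := Complex.ofReal_ne_zero.2 hs
      simp only [Function.comp, coordPoly, e.right_inv hT]
      have e1 := eval_smul_of_isHomogeneous hP (s : ℂ) (fun i => v i)
      have e2 := eval_smul_of_isHomogeneous hP' (s : ℂ)⁻¹
        (fun i => (e' (e.symm ((s : ℂ) • v, (e x).2))).1 i)
      simp only [PiLp.smul_apply, smul_eq_mul]
      rw [e1, e2, mul_sub, ← mul_assoc, ← mul_pow, inv_mul_cancel₀ hs', one_pow, one_mul]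
    · filter_upwards [self_mem_nhdsWithin] with s hs
      rw [pow_succ, ← mul_assoc, ← mul_pow, inv_mul_cancel₀ hs, one_pow, one_mul]
  have h6 : Tendsto (fun s : ℝ => s) (𝓝[≠] 0) (𝓝 0) := tendsto_id.mono_left nhdsWithin_le_nhds
  exact sub_eq_zero.1 (tendsto_nhds_unique h2 (h3.trans_tendsto h6))

theorem normalD_self (he : IsSubmanifoldCoord S e) (hx : x ∈ e.source) (v : Cn k) :
    normalD e e x v = v :=
  congrArg Prod.fst (he.fderiv_comp_symm hx (v, 0))

/-- Elements of the fibre correspond to unique homogeneous polynomials. -/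
theorem CorrespondsTo.unique (he : IsSubmanifoldCoord S e) (hx : x ∈ e.source) (hxS : x ∈ S)
    {p : ℕ} (hp : 1 ≤ p) {f : JetFibre S p x} {P Q : MvPolynomial (Fin k) ℂ}
    (hP : CorrespondsTo S p e x f P) (hQ : CorrespondsTo S p e x f Q) : P = Q := by
  have h1 := Represents.sub_isBigO hxS hp hP.2 hQ.2
  have h2 : p = p - 1 + 1 := by omega
  rw [h2] at h1
  refine MvPolynomial.funext fun v => ?_
  have := eval_eq_eval_normalD he he hx hx hxS hP.1 hQ.1 h1 (WithLp.toLp 2 v)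
  rw [normalD_self he hx] at this
  exact this

theorem CorrespondsTo.eval_trans (he : IsSubmanifoldCoord S e) (he' : IsSubmanifoldCoord S e')
    (hx : x ∈ e.source) (hx' : x ∈ e'.source) (hxS : x ∈ S)
    {p : ℕ} (hp : 1 ≤ p) {f : JetFibre S p x} {P P' : MvPolynomial (Fin k) ℂ}
    (hP : CorrespondsTo S p e x f P) (hP' : CorrespondsTo S p e' x f P') (v : Cn k) :
    MvPolynomial.eval (fun i => v i) P = MvPolynomial.eval (fun i => normalD e e' x v i) P' := by
  have h1 := Represents.sub_isBigO hxS hp hP.2 hP'.2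
  have h2 : p = p - 1 + 1 := by omega
  rw [h2] at h1
  exact eval_eq_eval_normalD he he' hx hx' hxS hP.1 hP'.1 h1 v

/-- `γ` is the continuous part of `G` in the coordinates `e`. -/
def IsGreenPart (G : Cn n → EReal) (e : Coord n k m) (γ : Cn n → ℝ) : Prop :=
  ContinuousOn γ e.source ∧ ∀ y ∈ e.source,
    G y = ENNReal.log (ENNReal.ofReal (‖(e y).1‖ ^ 2)) + (γ y : EReal)

theorem IsGreenPart.eq_coe {γ : Cn n → ℝ} (hγ : IsGreenPart G e γ) {y : Cn n} (hy : y ∈ e.source)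
    (h0 : (e y).1 ≠ 0) : G y = ((2 * Real.log ‖(e y).1‖ + γ y : ℝ) : EReal) := by
  have h1 : 0 < ‖(e y).1‖ ^ 2 := by
    have := norm_pos_iff.2 h0
    positivity
  rw [hγ.2 y hy, ENNReal.log_ofReal_of_pos h1, Real.log_pow, EReal.coe_add]
  rfl

theorem IsGreenPart.eq_bot {γ : Cn n → ℝ} (hγ : IsGreenPart G e γ) {y : Cn n} (hy : y ∈ e.source)
    (h0 : (e y).1 = 0) : G y = ⊥ := by
  rw [hγ.2 y hy, h0]
  simp

/-- Two systems of adapted coordinates measure the normal directions in the same way. -/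
theorem normalD_green (he : IsSubmanifoldCoord S e) (he' : IsSubmanifoldCoord S e')
    (hx : x ∈ e.source) (hx' : x ∈ e'.source) (hxS : x ∈ S) {γ γ' : Cn n → ℝ}
    (hγ : IsGreenPart G e γ) (hγ' : IsGreenPart G e' γ') (v : Cn k) :
    ‖normalD e e' x v‖ = Real.exp ((γ x - γ' x) / 2) * ‖v‖ := by
  rcases eq_or_ne v 0 with rfl | hv
  · simp
  have hlim := (tendsto_inv_smul_curve he he' hx hx' hxS v).norm
  have hcurve : Tendsto (fun s : ℝ => e.symm ((s : ℂ) • v, (e x).2)) (𝓝[≠] 0) (𝓝 x) :=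
    (he.tendsto_curve hx hxS v).mono_left nhdsWithin_le_nhds
  have h1 : Tendsto (fun s : ℝ => γ (e.symm ((s : ℂ) • v, (e x).2)) -
      γ' (e.symm ((s : ℂ) • v, (e x).2))) (𝓝[≠] 0) (𝓝 (γ x - γ' x)) :=
    ((hγ.1.continuousAt (e.open_source.mem_nhds hx)).tendsto.comp hcurve).sub
      ((hγ'.1.continuousAt (e'.open_source.mem_nhds hx')).tendsto.comp hcurve)
  have h2 := ((Real.continuous_exp.tendsto _).comp (h1.div_const 2)).mul_const ‖v‖
  refine tendsto_nhds_unique hlim (h2.congr' ?_)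
  filter_upwards [self_mem_nhdsWithin, nhdsWithin_le_nhds (he.eventually_curve_mem hx hxS v),
    hcurve.eventually (e'.open_source.mem_nhds hx')] with s hs hT hsrc'
  have hs' : s ≠ 0 := hs
  set y := e.symm ((s : ℂ) • v, (e x).2) with hy
  have hsrc : y ∈ e.source := e.map_target hT
  have hey : (e y).1 = (s : ℂ) • v := by rw [hy, e.right_inv hT]
  have hne : (e y).1 ≠ 0 := by
    rw [hey]
    simp [hs', hv]
  have hne' : (e' y).1 ≠ 0 := fun h => hne ((he.mem_iff y hsrc).1 ((he'.mem_iff y hsrc').2 h))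
  have h3 := (hγ.eq_coe hsrc hne).symm.trans (hγ'.eq_coe hsrc' hne')
  rw [EReal.coe_eq_coe_iff, hey] at h3
  have hn : 0 < ‖(s : ℂ) • v‖ := by
    rw [← hey]
    exact norm_pos_iff.2 hne
  have h4 : Real.log ‖(e' y).1‖ = (γ y - γ' y) / 2 + Real.log ‖(s : ℂ) • v‖ := by linarith
  have h5 : ‖(e' y).1‖ = Real.exp ((γ y - γ' y) / 2) * ‖(s : ℂ) • v‖ := by
    rw [← Real.exp_log (norm_pos_iff.2 hne'), h4, Real.exp_add, Real.exp_log hn]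
  simp only [Function.comp, ← hy]
  rw [norm_smul, h5, norm_smul, norm_inv]
  have h6 : ‖(s : ℂ)‖ ≠ 0 := by simpa using hs'
  field_simp

end Compare

/-! ### The limit form on the normal space -/

/-- The integral of `P Q̄ N^{-(p+k-1)}` over `{1 < N < e}`, where `N = e^γ |u|²`. -/
def normalForm (k p : ℕ) (γ : ℝ) (P Q : MvPolynomial (Fin k) ℂ) : ℂ :=
  ∫ u in vshell Set.univ (fun u : Cn k => 2 * Real.log ‖u‖ + γ) 0,
    MvPolynomial.eval (fun i => u i) P * conj (MvPolynomial.eval (fun i => u i) Q) *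
      (Real.exp (-((p : ℝ) + k - 1) * (2 * Real.log ‖u‖ + γ)) : ℂ)

theorem normalForm_comp {k p : ℕ} {γ γ' : ℝ} {P Q P' Q' : MvPolynomial (Fin k) ℂ}
    (a : Cn k →L[ℂ] Cn k) (ha : ∀ v, ‖a v‖ = Real.exp ((γ - γ') / 2) * ‖v‖)
    (hP : ∀ v : Cn k, MvPolynomial.eval (fun i => v i) P = MvPolynomial.eval (fun i => a v i) P')
    (hQ : ∀ v : Cn k, MvPolynomial.eval (fun i => v i) Q = MvPolynomial.eval (fun i => a v i) Q') :
    normalForm k p γ' P' Q' =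
      ((‖LinearMap.det (a : Cn k →ₗ[ℂ] Cn k)‖ ^ 2 : ℝ) : ℂ) * normalForm k p γ P Q := by
  have hinj : Function.Injective a := by
    refine (injective_iff_map_eq_zero a).2 fun v hv => ?_
    have h := ha v
    rw [hv, norm_zero] at h
    exact norm_eq_zero.1 ((mul_eq_zero.1 h.symm).resolve_left (Real.exp_ne_zero _))
  have hsurj : Function.Surjective a := LinearMap.surjective_of_injective (f := (a : Cn k →ₗ[ℂ] Cn k)) hinj
  have hlog : ∀ v : Cn k, v ≠ 0 → 2 * Real.log ‖a v‖ + γ' = 2 * Real.log ‖v‖ + γ := by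
    intro v hv
    rw [ha, Real.log_mul (Real.exp_ne_zero _) (norm_ne_zero_iff.2 hv), Real.log_exp]
    ring
  have hne : ∀ v : Cn k, a v ≠ 0 ↔ v ≠ 0 := fun v => (map_ne_zero_iff a hinj)
  have himg : vshell Set.univ (fun u : Cn k => 2 * Real.log ‖u‖ + γ') 0 =
      a '' vshell Set.univ (fun u : Cn k => 2 * Real.log ‖u‖ + γ) 0 := by
    ext u
    obtain ⟨v, rfl⟩ := hsurj u
    rw [hinj.mem_set_image]
    simp only [vshell, Set.mem_ofPred_eq, hne]
    constructor
    · rintro ⟨h1, h2, h3⟩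
      rw [hlog v h2] at h3
      exact ⟨h1, h2, h3⟩
    · rintro ⟨h1, h2, h3⟩
      rw [← hlog v h2] at h3
      exact ⟨h1, h2, h3⟩
  have hmeas := measurableSet_vshell_log (E := Cn k) γ 0
  unfold normalForm
  rw [himg, integral_image_eq_integral_abs_det_fderiv_smul volume hmeas
    (f := a) (f' := fun _ => a.restrictScalars ℝ)
    (fun v _ => (a.restrictScalars ℝ).hasFDerivAt.hasFDerivWithinAt) hinj.injOn,
    abs_det_restrictScalars, integral_smul, Complex.real_smul]
  congr 1
  refine setIntegral_congr_fun hmeas fun v hv => ?_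
  simp only [hlog v hv.2.1, hP, hQ]

/-! ### The limit over a slice, in coordinates -/

theorem finrank_real_Cn (k : ℕ) : Module.finrank ℝ (Cn k) = 2 * k := by
  rw [← Module.finrank_mul_finrank ℝ ℂ (Cn k), Complex.finrank_real_complex,
    finrank_euclideanSpace_fin]

theorem exp_neg_mul_log {r : ℝ} (hr : 0 < r) (N : ℕ) (c : ℝ) :
    Real.exp (-(N : ℝ) * (2 * Real.log r + c)) = (r ^ (2 * N))⁻¹ * Real.exp (-(N : ℝ) * c) := by
  have h : -(N : ℝ) * (2 * Real.log r + c) = -(((2 * N : ℕ) : ℝ) * Real.log r) + -(N : ℝ) * c := by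
    push_cast
    ring
  rw [h, Real.exp_add, Real.exp_neg, Real.exp_nat_mul, Real.exp_log hr]

theorem cast_exponent {k p : ℕ} (hp : 1 ≤ p) : (p : ℝ) + k - 1 = ((k + (p - 1) : ℕ) : ℝ) := by
  push_cast [Nat.cast_sub hp]
  ring

theorem isBigO_eval_of_isHomogeneous {k q : ℕ} {P : MvPolynomial (Fin k) ℂ}
    (hP : P.IsHomogeneous q) (l : Filter (Cn k)) :
    (fun w : Cn k => MvPolynomial.eval (fun i => w i) P) =O[l] fun w => ‖w‖ ^ q := by
  obtain ⟨M, hM⟩ := (isCompact_closedBall (0 : Cn k) 1).exists_bound_of_continuousOn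
    (continuous_eval_euclidean P).continuousOn
  refine IsBigO.of_bound M (Eventually.of_forall fun w => ?_)
  rcases eq_or_ne w 0 with rfl | hw
  · rcases Nat.eq_zero_or_pos q with rfl | hq
    · simpa using hM 0 (by simp)
    · have h := eval_smul_of_isHomogeneous hP 0 (fun _ => (0 : ℂ))
      simp only [mul_zero, zero_pow hq.ne', zero_mul] at h
      have h' : MvPolynomial.eval (fun i => (0 : Cn k) i) P = 0 := h
      rw [h']
      simp [hq.ne']
  · have hn : ‖w‖ ≠ 0 := norm_ne_zero_iff.2 hw
    have h1 := eval_smul_of_isHomogeneous hP (‖w‖ : ℂ) (fun i => (((‖w‖ : ℂ)⁻¹ • w) : Cn k) i)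
    have h2 : ∀ i, (‖w‖ : ℂ) * (((‖w‖ : ℂ)⁻¹ • w) : Cn k) i = w i := fun i => by
      simp [hn]
    simp only [h2] at h1
    rw [h1, norm_mul, norm_pow, Complex.norm_real, norm_norm, mul_comm, Real.norm_of_nonneg
      (by positivity)]
    gcongr
    refine hM _ ?_
    simp [norm_smul, hn]

/-- The homogeneous model of the integrand. -/
def modelIntegrand (k p : ℕ) (γ : ℝ) (P Q : MvPolynomial (Fin k) ℂ) (u : Cn k) : ℂ :=
  MvPolynomial.eval (fun i => u i) P * conj (MvPolynomial.eval (fun i => u i) Q) *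
    (Real.exp (-((p : ℝ) + k - 1) * (2 * Real.log ‖u‖ + γ)) : ℂ)

theorem continuousOn_modelIntegrand (k p : ℕ) (γ : ℝ) (P Q : MvPolynomial (Fin k) ℂ) :
    ContinuousOn (modelIntegrand k p γ P Q) {0}ᶜ := by
  intro u hu
  refine ContinuousAt.continuousWithinAt ?_
  have h1 := (continuous_eval_euclidean P).continuousAt (x := u)
  have h2 := Complex.continuous_conj.continuousAt.comp
    (continuous_eval_euclidean Q).continuousAt (x := u)
  have h3 : ContinuousAt (fun u : Cn k => Real.log ‖u‖) u :=
    continuous_norm.continuousAt.log (norm_ne_zero_iff.2 hu)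
  refine (h1.mul h2).mul ?_
  refine Complex.continuous_ofReal.continuousAt.comp (Real.continuous_exp.continuousAt.comp ?_)
  exact continuousAt_const.mul ((continuousAt_const.mul h3).add continuousAt_const)

theorem modelIntegrand_smul {k p : ℕ} (hp : 1 ≤ p) (γ : ℝ) {P Q : MvPolynomial (Fin k) ℂ}
    (hP : P.IsHomogeneous (p - 1)) (hQ : Q.IsHomogeneous (p - 1)) {s : ℝ} (hs : 0 < s)
    {w : Cn k} (hw : w ≠ 0) :
    (s ^ (2 * k) : ℝ) • modelIntegrand k p γ P Q (s • w) = modelIntegrand k p γ P Q w := by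
  have hn : 0 < ‖w‖ := norm_pos_iff.2 hw
  have h1 : ∀ R : MvPolynomial (Fin k) ℂ, R.IsHomogeneous (p - 1) →
      MvPolynomial.eval (fun i => (s • w) i) R =
        (s : ℂ) ^ (p - 1) * MvPolynomial.eval (fun i => w i) R := by
    intro R hR
    rw [← eval_smul_of_isHomogeneous hR]
    simp
  simp only [modelIntegrand, h1 P hP, h1 Q hQ, cast_exponent hp]
  rw [norm_smul, Real.norm_of_nonneg hs.le, exp_neg_mul_log (by positivity),
    exp_neg_mul_log hn, Complex.real_smul, map_mul, map_pow, Complex.conj_ofReal]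
  have hsc : (s : ℂ) ≠ 0 := Complex.ofReal_ne_zero.2 hs.ne'
  have hnc : (‖w‖ : ℂ) ≠ 0 := Complex.ofReal_ne_zero.2 hn.ne'
  push_cast
  rw [mul_pow, mul_add, pow_add, pow_mul' _ 2 (p - 1)]
  field_simp

variable {n k m : ℕ} {D S : Set (Cn n)} {G : Cn n → EReal} {e e' : Coord n k m} {x : Cn n}

theorem mem_shell_iff_mem_vshell {γ : Cn n → ℝ} (hγ : IsGreenPart G e γ) {v : Cn m} {W : Set (Cn k)}
    (hWT : ∀ w ∈ W, (w, v) ∈ e.target) (t : ℝ) :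
    W ∩ (fun w => e.symm (w, v)) ⁻¹' shell G t =
      vshell W (fun w => (G (e.symm (w, v))).toReal) t := by
  ext w
  simp only [vshell, shell, Set.mem_inter_iff, Set.mem_preimage, Set.mem_ofPred_eq]
  refine and_congr_right fun hw => ?_
  have hT := hWT w hw
  have hsrc := e.map_target hT
  have hew : (e (e.symm (w, v))).1 = w := by rw [e.right_inv hT]
  rcases eq_or_ne w 0 with rfl | h0
  · rw [hγ.eq_bot hsrc hew]
    simp
  · rw [hγ.eq_coe hsrc (by rwa [hew])]
    simp only [EReal.coe_lt_coe_iff, EReal.toReal_coe, ne_eq, h0, not_false_eq_true, true_and]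

theorem continuousOn_green_slice {γ : Cn n → ℝ} (hγ : IsGreenPart G e γ) {v : Cn m} {W : Set (Cn k)}
    (hWT : ∀ w ∈ W, (w, v) ∈ e.target) :
    ContinuousOn (fun w => (G (e.symm (w, v))).toReal) (W \ {0}) := by
  have h1 : ContinuousOn (fun w => 2 * Real.log ‖w‖ + γ (e.symm (w, v))) (W \ {0}) := by
    refine ContinuousOn.add (continuousOn_const.mul ?_) ?_
    · exact continuous_norm.continuousOn.log fun w hw => norm_ne_zero_iff.2 hw.2
    · refine hγ.1.comp (e.continuousOn_symm.comp (by fun_prop) ?_) ?_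
      · exact fun w hw => hWT w hw.1
      · exact fun w hw => e.map_target (hWT w hw.1)
  refine h1.congr fun w hw => ?_
  have hT := hWT w hw.1
  have hew : (e (e.symm (w, v))).1 = w := by rw [e.right_inv hT]
  rw [hγ.eq_coe (e.map_target hT) (by rw [hew]; exact hw.2), EReal.toReal_coe, hew]

theorem isOpen_vshell {W : Set (Cn k)} (hW : IsOpen W) {g : Cn k → ℝ}
    (hg : ContinuousOn g (W \ {0})) (t : ℝ) : IsOpen (vshell W g t) := by
  have h1 : IsOpen (W \ {0}) := hW.sdiff isClosed_singleton
  have h2 := hg.isOpen_inter_preimage h1 (isOpen_Ioo (a := t) (b := t + 1))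
  convert h2 using 1
  ext w
  simp only [vshell, Set.mem_ofPred_eq, Set.mem_inter_iff, Set.mem_sdiff, Set.mem_singleton_iff,
    Set.mem_preimage, Set.mem_Ioo, and_assoc, ne_eq]

theorem tendsto_integral_slice (he : IsSubmanifoldCoord S e) (hx : x ∈ e.source) (hxS : x ∈ S)
    (hk : 1 ≤ k) {p : ℕ} (hp : 1 ≤ p) {γ : Cn n → ℝ} (hγ : IsGreenPart G e γ) {φ : Cn n → ℝ}
    (hφ : ContinuousOn φ e.source) {W : Set (Cn k)} (hW : IsOpen W) (hW0 : 0 ∈ W)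
    (hWT : ∀ w ∈ W, (w, (e x).2) ∈ e.target)
    (hlow : ∃ C, ∀ w ∈ W, -C ≤ γ (e.symm (w, (e x).2)))
    {a : Cn k → ℝ} (ha : ContinuousOn a W) {F H : Cn n → ℂ}
    (hF : AEStronglyMeasurable (fun w => F (e.symm (w, (e x).2))) (volume.restrict W))
    (hH : AEStronglyMeasurable (fun w => H (e.symm (w, (e x).2))) (volume.restrict W))
    {P Q : MvPolynomial (Fin k) ℂ} (hP : P.IsHomogeneous (p - 1)) (hQ : Q.IsHomogeneous (p - 1))
    (hFP : (fun w => F (e.symm (w, (e x).2)) - MvPolynomial.eval (fun i => w i) P)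
      =o[𝓝[≠] 0] fun w => ‖w‖ ^ (p - 1))
    (hHQ : (fun w => H (e.symm (w, (e x).2)) - MvPolynomial.eval (fun i => w i) Q)
      =o[𝓝[≠] 0] fun w => ‖w‖ ^ (p - 1)) :
    (∀ᶠ t in atBot, IntegrableOn (fun w => a w • integrand k p G φ F H (e.symm (w, (e x).2)))
      (vshell W (fun w => (G (e.symm (w, (e x).2))).toReal) t)) ∧
    Tendsto (fun t => ∫ w in vshell W (fun w => (G (e.symm (w, (e x).2))).toReal) t,
      a w • integrand k p G φ F H (e.symm (w, (e x).2))) atBot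
      (𝓝 (((a 0 * Real.exp (-φ x) : ℝ) : ℂ) * normalForm k p (γ x) P Q)) := by
  set v := (e x).2 with hv
  set ι : Cn k → Cn n := fun w => e.symm (w, v) with hι
  set g : Cn k → ℝ := fun w => (G (ι w)).toReal with hg
  set A₀ : ℂ := ((a 0 * Real.exp (-φ x) : ℝ) : ℂ) with hA₀
  have hι0 : ι 0 = x := he.symm_zero hx hxS
  have hιc : ContinuousOn ι W := e.continuousOn_symm.comp (by fun_prop) hWT
  have hιs : ∀ w ∈ W, ι w ∈ e.source := fun w hw => e.map_target (hWT w hw)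
  have hew : ∀ w ∈ W, (e (ι w)).1 = w := fun w hw => by rw [hι, e.right_inv (hWT w hw)]
  have hgc : ContinuousOn g (W \ {0}) := continuousOn_green_slice hγ hWT
  have hopen := isOpen_vshell hW hgc
  have hsub : ∀ t, vshell W g t ⊆ W \ {0} := fun t w hw => ⟨hw.1, hw.2.1⟩
  have hgeq : ∀ w ∈ W, w ≠ 0 → g w = 2 * Real.log ‖w‖ + γ (ι w) := by
    intro w hw h0
    have h1 := hew w hw
    simp only [hg]
    rw [hγ.eq_coe (hιs w hw) (by rwa [h1]), EReal.toReal_coe, h1]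
  have hWn : W ∈ 𝓝 (0 : Cn k) := hW.mem_nhds hW0
  have hγc : ContinuousAt (fun w => γ (ι w)) 0 := (hγ.1.comp hιc hιs).continuousAt hWn
  have hφc : ContinuousOn (fun w => φ (ι w)) W := hφ.comp hιc hιs
  have hev : ∀ᶠ w in 𝓝[≠] (0 : Cn k), w ∈ W ∧ w ≠ 0 :=
    Eventually.and (nhdsWithin_le_nhds hWn) self_mem_nhdsWithin
  have : Nontrivial (Cn k) := by
    have : Nonempty (Fin k) := ⟨⟨0, hk⟩⟩
    infer_instance
  have key := tendsto_integral_vshell (volume : Measure (Cn k)) (W := W) (g := g) (γ := γ x)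
    (Θ := fun w => a w • integrand k p G φ F H (ι w))
    (Θ₀ := fun w => A₀ * modelIntegrand k p (γ x) P Q w) hWn
    (fun t => (hopen t).measurableSet) ?_ ?_ ?_ ?_ ?_ ?_
  · refine ⟨key.1, ?_⟩
    have h2 := key.2
    rw [integral_const_mul] at h2
    exact h2
  · intro t
    have hm : volume.restrict (vshell W g t) ≤ (volume : Measure (Cn k)).restrict W :=
      Measure.restrict_mono (fun w hw => hw.1) le_rfl
    have h1 : AEStronglyMeasurable a (volume.restrict (vshell W g t)) :=
      (ha.mono fun w hw => hw.1).aestronglyMeasurable (hopen t).measurableSet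
    refine h1.smul ?_
    refine ((hF.mono_measure hm).mul (Complex.continuous_conj.comp_aestronglyMeasurable
      (hH.mono_measure hm))).mul ?_
    refine ContinuousOn.aestronglyMeasurable ?_ (hopen t).measurableSet
    refine Complex.continuous_ofReal.comp_continuousOn (Real.continuous_exp.comp_continuousOn ?_)
    exact ((hφc.mono fun w hw => hw.1).neg).sub (continuousOn_const.mul (hgc.mono (hsub t)))
  · obtain ⟨C, hC⟩ := hlow
    refine ⟨C, fun w hw h0 => ?_⟩
    rw [hgeq w hw h0]
    linarith [hC w hw]
  · have h1 := hγc.tendsto.mono_left (nhdsWithin_le_nhds (s := {0}ᶜ))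
    rw [hι0] at h1
    refine h1.congr' ?_
    filter_upwards [hev] with w hw
    rw [hgeq w hw.1 hw.2]
    ring
  · exact continuousOn_const.mul (continuousOn_modelIntegrand k p (γ x) P Q)
  · intro s hs w hw
    rw [finrank_real_Cn, ← mul_smul_comm, modelIntegrand_smul hp _ hP hQ hs hw]
  · rw [finrank_real_Cn]
    set N := k + (p - 1) with hN
    set A : Cn k → ℂ := fun w =>
      ((a w * Real.exp (-φ (ι w)) * Real.exp (-(N : ℝ) * γ (ι w)) : ℝ) : ℂ) with hA
    have hAlim : Tendsto A (𝓝[≠] 0) (𝓝 (A 0)) := by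
      have h1 : ContinuousAt (fun w =>
          a w * Real.exp (-φ (ι w)) * Real.exp (-(N : ℝ) * γ (ι w))) 0 :=
        ((ha.continuousAt hWn).mul (hφc.continuousAt hWn).neg.rexp).mul
          (continuousAt_const.mul hγc).rexp
      exact (Complex.continuous_ofReal.continuousAt.comp h1).tendsto.mono_left nhdsWithin_le_nhds
    have hAo : (fun w => A w - A 0) =o[𝓝[≠] 0] fun _ => (1 : ℝ) :=
      (isLittleO_one_iff ℝ).2 (tendsto_sub_nhds_zero_iff.2 hAlim)
    have hPO := isBigO_eval_of_isHomogeneous hP (𝓝[≠] 0)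
    have hQO := isBigO_eval_of_isHomogeneous hQ (𝓝[≠] 0)
    have hHO : (fun w => H (ι w)) =O[𝓝[≠] 0] fun w => ‖w‖ ^ (p - 1) := by
      simpa using hHQ.isBigO.add hQO
    have hFO : (fun w => F (ι w)) =O[𝓝[≠] 0] fun w => ‖w‖ ^ (p - 1) := by
      simpa using hFP.isBigO.add hPO
    have hconjO : ∀ {u : Cn k → ℂ}, u =O[𝓝[≠] 0] (fun w => ‖w‖ ^ (p - 1)) →
        (fun w => conj (u w)) =O[𝓝[≠] 0] fun w => ‖w‖ ^ (p - 1) := by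
      intro u hu
      exact hu.norm_left.congr_left (fun w => (RCLike.norm_conj (u w)).symm) |>.of_norm_left
    have hconjo : ∀ {u : Cn k → ℂ}, u =o[𝓝[≠] 0] (fun w => ‖w‖ ^ (p - 1)) →
        (fun w => conj (u w)) =o[𝓝[≠] 0] fun w => ‖w‖ ^ (p - 1) := by
      intro u hu
      exact hu.norm_left.congr_left (fun w => (RCLike.norm_conj (u w)).symm) |>.of_norm_left
    have t1 := hAo.mul_isBigO (hFO.mul (hconjO hHO))
    have t2 := (isBigO_const_const (A 0) (one_ne_zero (α := ℝ)) (𝓝[≠] (0 : Cn k))).mul_isLittleO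
      (hFP.mul_isBigO (hconjO hHO))
    have t3 := (isBigO_const_const (A 0) (one_ne_zero (α := ℝ)) (𝓝[≠] (0 : Cn k))).mul_isLittleO
      (hPO.mul_isLittleO (hconjo hHQ))
    have t4 := ((t1.add t2).add t3).norm_left.tendsto_div_nhds_zero
    rw [tendsto_zero_iff_norm_tendsto_zero]
    refine t4.congr' ?_
    filter_upwards [hev] with w hw
    have hn : 0 < ‖w‖ := norm_pos_iff.2 hw.2
    have e1 : a w • integrand k p G φ F H (ι w) =
        ((‖w‖ ^ (2 * N) : ℝ) : ℂ)⁻¹ * (A w * (F (ι w) * conj (H (ι w)))) := by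
      have h1 : (G (ι w)).toReal = 2 * Real.log ‖w‖ + γ (ι w) := hgeq w hw.1 hw.2
      simp only [integrand, h1, cast_exponent hp, ← hN]
      rw [sub_eq_add_neg, ← neg_mul, Real.exp_add, exp_neg_mul_log hn, Complex.real_smul, hA]
      push_cast
      ring
    have e2 : A₀ * modelIntegrand k p (γ x) P Q w = ((‖w‖ ^ (2 * N) : ℝ) : ℂ)⁻¹ *
        (A 0 * (MvPolynomial.eval (fun i => w i) P *
          conj (MvPolynomial.eval (fun i => w i) Q))) := by
      simp only [modelIntegrand, cast_exponent hp, ← hN]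
      rw [exp_neg_mul_log hn, hA]
      simp only [hι0, hA₀]
      push_cast
      ring
    rw [e1, e2, ← mul_sub, norm_smul, norm_mul, norm_inv, Complex.norm_real, norm_pow, norm_norm,
      norm_pow, norm_norm, hN, mul_add, pow_add, mul_inv, mul_assoc,
      mul_inv_cancel_left₀ (by positivity), div_eq_inv_mul, one_mul]
    congr 1
    · rw [two_mul, pow_add]
    · congr 1
      rw [map_sub]
      ring

/-! ### Integration against measures with a density on a parametrized set -/

section Push

set_option linter.unusedSectionVars false

variable {X Y : Type*} [TopologicalSpace X] [PolishSpace X] [MeasurableSpace X] [BorelSpace X]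
  [TopologicalSpace Y] [T2Space Y] [MeasurableSpace Y] [BorelSpace Y]
  [SecondCountableTopology Y] [TopologicalSpace.PseudoMetrizableSpace Y]
  {μ : Measure X} [SFinite μ] {W : Set X} {ι : X → Y} {a : X → ℝ}

/-- The image under `ι` of the measure `a dμ` on `W`. -/
def pushDensity (μ : Measure X) (W : Set X) (ι : X → Y) (a : X → ℝ) : Measure Y :=
  Measure.map ι ((μ.restrict W).withDensity fun w => ENNReal.ofReal (a w))

theorem aemeasurable_restrict_withDensity (hW : MeasurableSet W) (hι : ContinuousOn ι W) :
    AEMeasurable ι ((μ.restrict W).withDensity fun w => ENNReal.ofReal (a w)) :=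
  (hι.aemeasurable hW).mono_ac (withDensity_absolutelyContinuous _ _)

theorem exists_embedding_pushDensity (hW : MeasurableSet W) (hι : ContinuousOn ι W)
    (hinj : Set.InjOn ι W) :
    let ρ := (μ.restrict W).withDensity fun w => ENNReal.ofReal (a w)
    let ν : Measure W := ρ.comap Subtype.val
    MeasurableEmbedding (W.domRestrict ι) ∧ ν.map Subtype.val = ρ ∧
      pushDensity μ W ι a = ν.map (W.domRestrict ι) := by
  intro ρ ν
  have h1 : ν.map Subtype.val = ρ := by
    rw [map_comap_subtype_coe hW]
    refine Measure.restrict_eq_self_of_ae_mem ?_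
    exact (withDensity_absolutelyContinuous _ _).ae_le (ae_restrict_mem hW)
  refine ⟨hι.measurableEmbedding hW hinj, h1, ?_⟩
  have h2 : AEMeasurable ι (ν.map Subtype.val) := h1 ▸ aemeasurable_restrict_withDensity hW hι
  have h3 := AEMeasurable.map_map_of_aemeasurable h2 measurable_subtype_coe.aemeasurable
  rw [h1] at h3
  exact h3

theorem integrableOn_pushDensity (hW : MeasurableSet W) (hι : ContinuousOn ι W)
    (hinj : Set.InjOn ι W) (ha : AEMeasurable a (μ.restrict W)) (ha0 : ∀ w ∈ W, 0 ≤ a w)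
    (h : Y → ℂ) (s : Set Y) :
    IntegrableOn h s (pushDensity μ W ι a) ↔
      IntegrableOn (fun w => a w • h (ι w)) (W ∩ ι ⁻¹' s) μ := by
  obtain ⟨h1, h2, h3⟩ := exists_embedding_pushDensity (μ := μ) (a := a) hW hι hinj
  have hsub : MeasurableEmbedding (Subtype.val : W → X) := MeasurableEmbedding.subtype_coe hW
  have hm : AEMeasurable (fun w => ENNReal.ofReal (a w)) (μ.restrict (W ∩ ι ⁻¹' s)) :=
    (ha.mono_measure (Measure.restrict_mono Set.inter_subset_left le_rfl)).ennreal_ofReal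
  rw [IntegrableOn, h3, h1.restrict_map, h1.integrable_map_iff]
  change Integrable ((h ∘ ι) ∘ Subtype.val) (Measure.restrict _ (Subtype.val ⁻¹' (ι ⁻¹' s))) ↔ _
  rw [← hsub.integrable_map_iff, ← hsub.restrict_map, h2, restrict_withDensity',
    Measure.restrict_restrict' hW, Set.inter_comm, integrable_withDensity_iff_integrable_smul₀' hm
      (Eventually.of_forall fun _ => ENNReal.ofReal_lt_top), IntegrableOn]
  refine integrable_congr ?_
  have h4 : ∀ᵐ w ∂(μ.restrict (W ∩ ι ⁻¹' s)), w ∈ W :=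
    ae_mono (Measure.restrict_mono Set.inter_subset_left le_rfl) (ae_restrict_mem hW)
  filter_upwards [h4] with w hw
  simp [ENNReal.toReal_ofReal (ha0 w hw)]

theorem setIntegral_pushDensity (hW : MeasurableSet W) (hι : ContinuousOn ι W)
    (hinj : Set.InjOn ι W) (ha : AEMeasurable a (μ.restrict W)) (ha0 : ∀ w ∈ W, 0 ≤ a w)
    (h : Y → ℂ) (s : Set Y) :
    ∫ y in s, h y ∂(pushDensity μ W ι a) = ∫ w in W ∩ ι ⁻¹' s, a w • h (ι w) ∂μ := by
  obtain ⟨h1, h2, h3⟩ := exists_embedding_pushDensity (μ := μ) (a := a) hW hι hinj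
  have hsub : MeasurableEmbedding (Subtype.val : W → X) := MeasurableEmbedding.subtype_coe hW
  have hm : AEMeasurable (fun w => ENNReal.ofReal (a w)) (μ.restrict (W ∩ ι ⁻¹' s)) :=
    (ha.mono_measure (Measure.restrict_mono Set.inter_subset_left le_rfl)).ennreal_ofReal
  rw [h3, h1.restrict_map, h1.integral_map]
  change ∫ w, (h ∘ ι) (Subtype.val w) ∂(Measure.restrict _ (Subtype.val ⁻¹' (ι ⁻¹' s))) = _
  rw [← hsub.integral_map, ← hsub.restrict_map, h2, restrict_withDensity',
    Measure.restrict_restrict' hW, Set.inter_comm, integral_withDensity_eq_integral_toReal_smul₀ hm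
      (Eventually.of_forall fun _ => ENNReal.ofReal_lt_top)]
  refine integral_congr_ae ?_
  have h4 : ∀ᵐ w ∂(μ.restrict (W ∩ ι ⁻¹' s)), w ∈ W :=
    ae_mono (Measure.restrict_mono Set.inter_subset_left le_rfl) (ae_restrict_mem hW)
  filter_upwards [h4] with w hw
  simp [ENNReal.toReal_ofReal (ha0 w hw)]

theorem AEStronglyMeasurable.comp_pushDensity (hW : MeasurableSet W) (hι : ContinuousOn ι W)
    (ha : AEMeasurable a (μ.restrict W)) (ha0 : ∀ w ∈ W, 0 < a w)
    {h : Y → ℂ} (hh : AEStronglyMeasurable h (pushDensity μ W ι a)) :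
    AEStronglyMeasurable (fun w => h (ι w)) (μ.restrict W) := by
  have h1 := hh.comp_aemeasurable (aemeasurable_restrict_withDensity hW hι)
  refine h1.mono_ac (withDensity_absolutelyContinuous' ha.ennreal_ofReal ?_)
  filter_upwards [ae_restrict_mem hW] with w hw
  simpa using ha0 w hw

end Push

/-! ### The limit over a slice -/

section Slice

variable {n k m : ℕ} {D S : Set (Cn n)} {G : Cn n → EReal} {φ : Cn n → ℝ} {e e' : Coord n k m}
  {U U' : Set (Cn n)} {x : Cn n} {p : ℕ}

/-- The coordinates `z'` of the points of the slice `U_x`. -/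
def sliceDomain (e : Coord n k m) (U : Set (Cn n)) (x : Cn n) : Set (Cn k) :=
  {w : Cn k | (w, (e x).2) ∈ e.target ∧ e.symm (w, (e x).2) ∈ U}

theorem sliceVolume_eq (e : Coord n k m) (U : Set (Cn n)) (x : Cn n) :
    sliceVolume e U x = pushDensity volume (sliceDomain e U x) (fun w => e.symm (w, (e x).2))
      (fun w => ambientDensity e (w, (e x).2) / subDensity e (e x).2) := rfl

theorem isOpen_sliceDomain (hU : IsOpen U) : IsOpen (sliceDomain e U x) := by
  have h1 : IsOpen (e.target ∩ e.symm ⁻¹' U) := e.symm.isOpen_inter_preimage hU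
  exact h1.preimage (f := fun w : Cn k => (w, (e x).2)) (by fun_prop)

theorem IsSubmanifoldCoord.continuousOn_ambientDensity (he : IsSubmanifoldCoord S e) :
    ContinuousOn (ambientDensity e) e.target := by
  have h1 : ContinuousOn (fderiv ℂ e.symm) e.target := fun z hz =>
    (he.analyticAt_symm hz).fderiv.continuousAt.continuousWithinAt
  unfold ambientDensity gramDet Matrix.gram
  refine Complex.continuous_re.comp_continuousOn ?_
  refine Continuous.comp_continuousOn (Continuous.matrix_det continuous_id) ?_
  refine continuousOn_pi.2 fun i => continuousOn_pi.2 fun j => ?_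
  exact (h1.clm_apply continuousOn_const).inner (h1.clm_apply continuousOn_const)

theorem IsSubmanifoldCoord.continuousOn_subDensity (he : IsSubmanifoldCoord S e) :
    ContinuousOn (subDensity e) {w : Cn m | ((0 : Cn k), w) ∈ e.target} := by
  have h1 : ContinuousOn (fun w : Cn m => fderiv ℂ e.symm ((0 : Cn k), w))
      {w : Cn m | ((0 : Cn k), w) ∈ e.target} := by
    have h2 : ContinuousOn (fderiv ℂ e.symm) e.target := fun z hz =>
      (he.analyticAt_symm hz).fderiv.continuousAt.continuousWithinAt
    exact h2.comp (by fun_prop) fun w hw => hw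
  unfold subDensity gramDet Matrix.gram
  refine Complex.continuous_re.comp_continuousOn ?_
  refine Continuous.comp_continuousOn (Continuous.matrix_det continuous_id) ?_
  refine continuousOn_pi.2 fun i => continuousOn_pi.2 fun j => ?_
  exact (h1.clm_apply continuousOn_const).inner (h1.clm_apply continuousOn_const)

/-- The limit of the integrals over the shells of a slice. -/
def sliceForm (e : Coord n k m) (φ γ : Cn n → ℝ) (p : ℕ) (x : Cn n)
    (P Q : MvPolynomial (Fin k) ℂ) : ℂ :=
  ((ambientDensity e (0, (e x).2) / subDensity e (e x).2 * Real.exp (-φ x) : ℝ) : ℂ) *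
    normalForm k p (γ x) P Q

theorem hasShellLimit_slice (hk : 1 ≤ k) (hp : 1 ≤ p) (hφ : ContinuousOn φ D)
    (hU : IsAdaptedNhd D S G e U x) {γ : Cn n → ℝ} (hγ : IsGreenPart G e γ)
    {P Q : MvPolynomial (Fin k) ℂ} (hP : P.IsHomogeneous (p - 1)) (hQ : Q.IsHomogeneous (p - 1))
    {F H : Cn n → ℂ} (hF : AEStronglyMeasurable F (sliceVolume e U x))
    (hH : AEStronglyMeasurable H (sliceVolume e U x))
    (hFP : (fun y => F y - coordPoly e P y) =o[𝓝[slice e U x \ {x}] x]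
      (fun y => ‖(e y).1‖ ^ (p - 1)))
    (hHQ : (fun y => H y - coordPoly e Q y) =o[𝓝[slice e U x \ {x}] x]
      (fun y => ‖(e y).1‖ ^ (p - 1))) :
    HasShellLimit k p G φ (sliceVolume e U x) F H (sliceForm e φ γ p x P Q) := by
  have he := hU.adapted.toIsSubmanifoldCoord
  have hxS := hU.mem_S
  have hx : x ∈ e.source := hU.closure_subset (subset_closure hU.mem)
  have hφ' : ContinuousOn φ e.source := hφ.mono hU.adapted.source_subset
  set W := sliceDomain e U x with hWdef
  set ι : Cn k → Cn n := fun w => e.symm (w, (e x).2) with hι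
  set a : Cn k → ℝ := fun w => ambientDensity e (w, (e x).2) / subDensity e (e x).2 with ha
  have hW : IsOpen W := isOpen_sliceDomain hU.isOpen
  have hWT : ∀ w ∈ W, (w, (e x).2) ∈ e.target := fun w hw => hw.1
  have hι0 : ι 0 = x := he.symm_zero hx hxS
  have hW0 : (0 : Cn k) ∈ W := ⟨he.zero_mem_target hx hxS, by
    change ι 0 ∈ U
    rw [hι0]
    exact hU.mem⟩
  have hιc : ContinuousOn ι W := e.continuousOn_symm.comp (by fun_prop) hWT
  have hew : ∀ w ∈ W, (e (ι w)) = (w, (e x).2) := fun w hw => e.right_inv (hWT w hw)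
  have hinj : Set.InjOn ι W := fun w hw w' hw' h => by
    have h1 := hew w hw
    rw [h, hew w' hw'] at h1
    exact (congrArg Prod.fst h1).symm
  have hac : ContinuousOn a W :=
    (he.continuousOn_ambientDensity.comp (by fun_prop) hWT).div_const _
  have hsub := he.subDensity_pos (he.zero_mem_target hx hxS)
  have hapos : ∀ w ∈ W, 0 < a w := fun w hw => div_pos (he.ambientDensity_pos (hWT w hw)) hsub
  have ham : AEMeasurable a (volume.restrict W) := hac.aemeasurable hW.measurableSet
  have hlow : ∃ C, ∀ w ∈ W, -C ≤ γ (ι w) := by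
    obtain ⟨C, hC⟩ := hU.compact_closure.exists_bound_of_continuousOn
      (hγ.1.mono hU.closure_subset)
    exact ⟨C, fun w hw => (abs_le.1 (hC _ (subset_closure hw.2))).1⟩
  have htend : Tendsto ι (𝓝[≠] 0) (𝓝[slice e U x \ {x}] x) := by
    refine tendsto_nhdsWithin_iff.2 ⟨?_, ?_⟩
    · have := (hιc.continuousAt (hW.mem_nhds hW0)).tendsto
      rw [hι0] at this
      exact this.mono_left nhdsWithin_le_nhds
    · filter_upwards [nhdsWithin_le_nhds (hW.mem_nhds hW0), self_mem_nhdsWithin] with w hw h0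
      refine ⟨⟨hw.2, ?_⟩, fun h => h0 ?_⟩
      · rw [hew w hw]
      · exact hinj hw hW0 (h.trans hι0.symm)
  have hlittle : ∀ {F : Cn n → ℂ} {P : MvPolynomial (Fin k) ℂ},
      (fun y => F y - coordPoly e P y) =o[𝓝[slice e U x \ {x}] x]
        (fun y => ‖(e y).1‖ ^ (p - 1)) →
      (fun w => F (ι w) - MvPolynomial.eval (fun i => w i) P) =o[𝓝[≠] 0]
        fun w => ‖w‖ ^ (p - 1) := by
    intro F P hFP
    refine (hFP.comp_tendsto htend).congr' ?_ ?_
    · filter_upwards [nhdsWithin_le_nhds (hW.mem_nhds hW0)] with w hw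
      simp only [Function.comp, coordPoly, hew w hw]
    · filter_upwards [nhdsWithin_le_nhds (hW.mem_nhds hW0)] with w hw
      simp only [Function.comp, hew w hw]
  have hmain := tendsto_integral_slice he hx hxS hk hp hγ hφ' hW hW0 hWT hlow hac
    (AEStronglyMeasurable.comp_pushDensity hW.measurableSet hιc ham hapos hF)
    (AEStronglyMeasurable.comp_pushDensity hW.measurableSet hιc ham hapos hH)
    hP hQ (hlittle hFP) (hlittle hHQ)
  have hset := mem_shell_iff_mem_vshell hγ hWT
  unfold HasShellLimit
  rw [show sliceVolume e U x = pushDensity volume W ι a from rfl]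
  simp only [integrableOn_pushDensity hW.measurableSet hιc hinj ham (fun w hw => (hapos w hw).le),
    setIntegral_pushDensity hW.measurableSet hιc hinj ham (fun w hw => (hapos w hw).le)]
  simp only [hι, hset]
  exact hmain

theorem aestronglyMeasurable_sliceVolume (hU : IsAdaptedNhd D S G e U x) {F : Cn n → ℂ}
    (hF : ContinuousOn F e.source) : AEStronglyMeasurable F (sliceVolume e U x) := by
  have hW : IsOpen (sliceDomain e U x) := isOpen_sliceDomain hU.isOpen
  have hιc : ContinuousOn (fun w : Cn k => e.symm (w, (e x).2)) (sliceDomain e U x) :=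
    e.continuousOn_symm.comp (by fun_prop) fun w hw => hw.1
  have h1 : AEStronglyMeasurable F ((sliceVolume e U x).restrict U) :=
    (hF.mono (subset_closure.trans hU.closure_subset)).aestronglyMeasurable hU.isOpen.measurableSet
  rwa [Measure.restrict_eq_self_of_ae_mem] at h1
  rw [sliceVolume_eq, pushDensity, ae_map_iff (p := fun y => y ∈ U)
    (aemeasurable_restrict_withDensity hW.measurableSet hιc) hU.isOpen.measurableSet]
  refine (withDensity_absolutelyContinuous _ _).ae_le ?_
  filter_upwards [ae_restrict_mem hW.measurableSet] with w hw using hw.2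

theorem IsSubmanifoldCoord.continuousOn_coordPoly (P : MvPolynomial (Fin k) ℂ) :
    ContinuousOn (coordPoly e P) e.source :=
  (continuous_eval_euclidean P).comp_continuousOn (continuous_fst.comp_continuousOn e.continuousOn)

theorem hasShellLimit_coordPoly (hk : 1 ≤ k) (hp : 1 ≤ p) (hφ : ContinuousOn φ D)
    (hU : IsAdaptedNhd D S G e U x) {γ : Cn n → ℝ} (hγ : IsGreenPart G e γ)
    {P Q : MvPolynomial (Fin k) ℂ} (hP : P.IsHomogeneous (p - 1)) (hQ : Q.IsHomogeneous (p - 1)) :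
    HasShellLimit k p G φ (sliceVolume e U x) (coordPoly e P) (coordPoly e Q)
      (sliceForm e φ γ p x P Q) := by
  refine hasShellLimit_slice hk hp hφ hU hγ hP hQ
    (aestronglyMeasurable_sliceVolume hU (IsSubmanifoldCoord.continuousOn_coordPoly P))
    (aestronglyMeasurable_sliceVolume hU (IsSubmanifoldCoord.continuousOn_coordPoly Q)) ?_ ?_ <;>
  · simp only [sub_self]
    exact isLittleO_zero _ _

theorem HasShellLimit.unique {μ : Measure (Cn n)} {F H : Cn n → ℂ} {c c' : ℂ}
    (h : HasShellLimit k p G φ μ F H c) (h' : HasShellLimit k p G φ μ F H c') : c = c' :=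
  tendsto_nhds_unique h.2 h'.2

theorem sliceForm_eq (hp : 1 ≤ p) (he : IsSubmanifoldCoord S e) (he' : IsSubmanifoldCoord S e')
    (hx : x ∈ e.source) (hx' : x ∈ e'.source) (hxS : x ∈ S) {γ γ' : Cn n → ℝ}
    (hγ : IsGreenPart G e γ) (hγ' : IsGreenPart G e' γ') {f g : JetFibre S p x}
    {P Q P' Q' : MvPolynomial (Fin k) ℂ} (hP : CorrespondsTo S p e x f P)
    (hQ : CorrespondsTo S p e x g Q) (hP' : CorrespondsTo S p e' x f P')
    (hQ' : CorrespondsTo S p e' x g Q') :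
    sliceForm e φ γ p x P Q = sliceForm e' φ γ' p x P' Q' := by
  unfold sliceForm
  rw [normalForm_comp (normalD e e' x) (normalD_green he he' hx hx' hxS hγ hγ')
    (hP.eval_trans he he' hx hx' hxS hp hP') (hQ.eval_trans he he' hx hx' hxS hp hQ'),
    ← he.apply_eq hx hxS, ← he'.apply_eq hx' hxS, density_ratio_trans he he' hx hx' hxS]
  push_cast
  ring

theorem IsAdaptedNhd.mem_source (hU : IsAdaptedNhd D S G e U x) : x ∈ e.source :=
  hU.closure_subset (subset_closure hU.mem)

/-- The inner product is computed by the limit in any adapted coordinates. -/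
theorem jetInner_eq_sliceForm (hk : 1 ≤ k) (hp : 1 ≤ p) (hφ : ContinuousOn φ D)
    (hU : IsAdaptedNhd D S G e U x) {γ : Cn n → ℝ} (hγ : IsGreenPart G e γ) {f g : JetFibre S p x}
    {P Q : MvPolynomial (Fin k) ℂ} (hP : CorrespondsTo S p e x f P)
    (hQ : CorrespondsTo S p e x g Q) :
    jetInner k m D S G φ p x f g = sliceForm e φ γ p x P Q := by
  have hex : ∃ c : ℂ, ∃ (e : Coord n k m) (U : Set (Cn n)) (P Q : MvPolynomial (Fin k) ℂ),
      IsAdaptedNhd D S G e U x ∧ CorrespondsTo S p e x f P ∧ CorrespondsTo S p e x g Q ∧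
      HasShellLimit k p G φ (sliceVolume e U x) (coordPoly e P) (coordPoly e Q) c :=
    ⟨_, e, U, P, Q, hU, hP, hQ, hasShellLimit_coordPoly hk hp hφ hU hγ hP.1 hQ.1⟩
  obtain ⟨e', U', P', Q', hU', hP', hQ', hlim⟩ := Classical.epsilon_spec hex
  obtain ⟨γ', hγ'⟩ := hU'.adapted.green
  refine (hlim.unique (hasShellLimit_coordPoly hk hp hφ hU' hγ' hP'.1 hQ'.1)).trans ?_
  exact (sliceForm_eq hp hU.adapted.toIsSubmanifoldCoord hU'.adapted.toIsSubmanifoldCoord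
    hU.mem_source hU'.mem_source hU.mem_S hγ hγ' hP hQ hP' hQ').symm

end Slice

/-! ### The volume measure of `S` in coordinates -/

section SubVolume

variable {n k m : ℕ} {S : Set (Cn n)} {e e' : Coord n k m}

/-- The coordinates `z''` of the points of `S` in the domain of `e`. -/
def subDomain (e : Coord n k m) : Set (Cn m) := {w : Cn m | ((0 : Cn k), w) ∈ e.target}

theorem chartVolume_eq (e : Coord n k m) : chartVolume e =
    pushDensity volume (subDomain e) (fun w => e.symm (0, w)) (subDensity e) := rfl

theorem isOpen_subDomain (e : Coord n k m) : IsOpen (subDomain e) :=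
  e.open_target.preimage (f := fun w : Cn m => ((0 : Cn k), w)) (by fun_prop)

theorem continuousOn_subParam (e : Coord n k m) :
    ContinuousOn (fun w : Cn m => e.symm ((0 : Cn k), w)) (subDomain e) :=
  e.continuousOn_symm.comp (by fun_prop) fun _ hw => hw

theorem injOn_subParam (e : Coord n k m) :
    Set.InjOn (fun w : Cn m => e.symm ((0 : Cn k), w)) (subDomain e) := by
  intro w hw w' hw' h
  have h1 := congrArg e h
  simp only at h1
  rw [e.right_inv hw, e.right_inv hw'] at h1
  exact congrArg Prod.snd h1

theorem measurableSet_subDomain_inter (e : Coord n k m) {A : Set (Cn n)} (hA : MeasurableSet A) :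
    MeasurableSet (subDomain e ∩ (fun w : Cn m => e.symm ((0 : Cn k), w)) ⁻¹' A) := by
  have h := ((continuousOn_subParam e).measurableEmbedding (isOpen_subDomain e).measurableSet
    (injOn_subParam e)).measurable hA
  have h2 := (MeasurableEmbedding.subtype_coe (isOpen_subDomain e).measurableSet).measurableSet_image.2 h
  convert h2 using 1
  ext w
  simp [and_comm]

theorem chartVolume_apply (e : Coord n k m) {A : Set (Cn n)} (hA : MeasurableSet A) :
    chartVolume e A = ∫⁻ w in subDomain e ∩ (fun w : Cn m => e.symm ((0 : Cn k), w)) ⁻¹' A,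
      ENNReal.ofReal (subDensity e w) := by
  rw [chartVolume_eq, pushDensity, Measure.map_apply_of_aemeasurable
    (aemeasurable_restrict_withDensity (isOpen_subDomain e).measurableSet
      (continuousOn_subParam e)) hA, withDensity_apply',
    Measure.restrict_restrict' (isOpen_subDomain e).measurableSet, Set.inter_comm]

theorem chartVolume_le_of_subset (he : IsSubmanifoldCoord S e) (he' : IsSubmanifoldCoord S e')
    {A : Set (Cn n)} (hA : MeasurableSet A) (hAe : A ⊆ e.source) :
    chartVolume e' A ≤ chartVolume e A := by
  rw [chartVolume_apply e hA, chartVolume_apply e' hA]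
  set B' := subDomain e' ∩ (fun w : Cn m => e'.symm ((0 : Cn k), w)) ⁻¹' A with hB'
  set B := subDomain e ∩ (fun w : Cn m => e.symm ((0 : Cn k), w)) ⁻¹' A with hB
  have hmB' : MeasurableSet B' := measurableSet_subDomain_inter e' hA
  let τ : Cn m → Cn m := fun w => (e (e'.symm (0, w))).2
  have hfacts : ∀ w ∈ B', e'.symm (0, w) ∈ e'.source ∧ e'.symm (0, w) ∈ e.source ∧
      e'.symm (0, w) ∈ S ∧ e' (e'.symm (0, w)) = (0, w) := by
    intro w hw
    exact ⟨e'.map_target hw.1, hAe hw.2, (he'.symm_mem_iff hw.1).2 rfl, e'.right_inv hw.1⟩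
  have hτsymm : ∀ w ∈ B', e.symm (0, τ w) = e'.symm (0, w) := by
    intro w hw
    obtain ⟨-, h2, h3, -⟩ := hfacts w hw
    exact he.symm_zero h2 h3
  have hinj : Set.InjOn τ B' := by
    intro w hw w' hw' h
    have h1 := hτsymm w hw
    rw [h, hτsymm w' hw'] at h1
    exact (injOn_subParam e' hw'.1 hw.1 h1).symm
  have hder : ∀ w ∈ B', HasFDerivWithinAt τ
      ((tangentD e' e (e'.symm (0, w))).restrictScalars ℝ) B' w := by
    intro w hw
    obtain ⟨h1, h2, h3, h4⟩ := hfacts w hw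
    have h5 := hasFDerivAt_trans he' he h1 h2
    rw [h4] at h5
    have h6 := (h5.comp w (hasFDerivAt_prodMk_right (𝕜 := ℂ) (0 : Cn k) w)).snd
    exact (h6.restrictScalars ℝ).hasFDerivWithinAt
  have himg : τ '' B' ⊆ B := by
    rintro _ ⟨w, hw, rfl⟩
    obtain ⟨-, h2, h3, -⟩ := hfacts w hw
    refine ⟨he.zero_mem_target h2 h3, ?_⟩
    change e.symm (0, τ w) ∈ A
    rw [hτsymm w hw]
    exact hw.2
  refine le_trans (le_of_eq ?_) (lintegral_mono_set himg)
  rw [lintegral_image_eq_lintegral_abs_det_fderiv_mul volume hmB' hder hinj]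
  refine setLIntegral_congr_fun hmB' fun w hw => ?_
  obtain ⟨h1, h2, h3, h4⟩ := hfacts w hw
  have h5 := subDensity_trans he' he h1 h2 h3
  rw [h4] at h5
  rw [h5, ENNReal.ofReal_mul (by positivity), abs_det_restrictScalars]

theorem ae_chartVolume_mem (he : IsSubmanifoldCoord S e) {A : Set (Cn n)} (hA : MeasurableSet A)
    (h : e.source ∩ S ⊆ A) : ∀ᵐ y ∂(chartVolume e), y ∈ A := by
  rw [ae_iff, show {y | y ∉ A} = Aᶜ from rfl, chartVolume_apply e hA.compl]
  have : subDomain e ∩ (fun w : Cn m => e.symm ((0 : Cn k), w)) ⁻¹' Aᶜ = ∅ := by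
    ext w
    simp only [Set.mem_inter_iff, Set.mem_preimage, Set.mem_compl_iff, Set.mem_empty_iff_false,
      iff_false, not_and, not_not]
    intro hw
    exact h ⟨e.map_target hw, (he.symm_mem_iff hw).2 rfl⟩
  rw [this]
  simp

theorem subVolume_le {ν : Measure (Cn n)}
    (h : ∀ e : Coord n k m, IsSubmanifoldCoord S e → chartVolume e ≤ ν) : subVolume k m S ≤ ν :=
  iSup₂_le h

theorem top_restrict_apply {s A : Set (Cn n)} (hA : MeasurableSet A) (h : (A ∩ s).Nonempty) :
    ((⊤ : Measure (Cn n)).restrict s) A = ⊤ := by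
  rw [Measure.restrict_apply hA]
  obtain ⟨y, hy⟩ := h
  rw [← top_le_iff]
  have h1 : (⊤ : ℝ≥0∞) • Measure.dirac y ≤ (⊤ : Measure (Cn n)) := le_top
  refine le_trans ?_ (h1 (A ∩ s))
  simp [Set.indicator_of_mem hy]

/-- The volume measure of `S` is given by `chartVolume e` on the domain of `e`. -/
theorem subVolume_restrict (he : IsSubmanifoldCoord S e) :
    (subVolume k m S).restrict e.source = chartVolume e := by
  have hs := e.open_source.measurableSet
  have hself : (chartVolume e).restrict e.source = chartVolume e :=
    Measure.restrict_eq_self_of_ae_mem (ae_chartVolume_mem he hs Set.inter_subset_left)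
  refine le_antisymm ?_ ?_
  · have h1 : subVolume k m S ≤ chartVolume e + (⊤ : Measure (Cn n)).restrict e.sourceᶜ := by
      refine subVolume_le fun e' he' => Measure.le_iff.2 fun A hA => ?_
      by_cases h : A ⊆ e.source
      · exact (chartVolume_le_of_subset he he' hA h).trans (Measure.le_add_right le_rfl A)
      · obtain ⟨y, hy, hy'⟩ := Set.not_subset.1 h
        rw [Measure.add_apply, top_restrict_apply hA ⟨y, hy, hy'⟩, add_top]
        exact le_top
    refine (Measure.restrict_mono_measure h1 _).trans (le_of_eq ?_)
    rw [Measure.restrict_add, hself, Measure.restrict_restrict hs, Set.inter_compl_self,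
      Measure.restrict_empty, add_zero]
  · rw [← hself]
    exact Measure.restrict_mono_measure (le_iSup₂_of_le e he le_rfl) _

theorem ae_subVolume_mem (hS : MeasurableSet S) : ∀ᵐ y ∂(subVolume k m S), y ∈ S := by
  have h1 : subVolume k m S ≤ (⊤ : Measure (Cn n)).restrict S := by
    refine subVolume_le fun e' he' => Measure.le_iff.2 fun A hA => ?_
    by_cases h : (A ∩ S).Nonempty
    · rw [top_restrict_apply hA h]
      exact le_top
    · rw [Set.not_nonempty_iff_eq_empty] at h
      have h2 := ae_chartVolume_mem he' hA.compl fun y hy hyA => by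
        have : y ∈ A ∩ S := ⟨hyA, hy.2⟩
        rw [h] at this
        exact this
      rw [ae_iff] at h2
      simp only [Set.mem_compl_iff, not_not] at h2
      rw [show {y | y ∈ A} = A from rfl] at h2
      rw [h2]
      exact zero_le
  exact ae_mono h1 (ae_restrict_mem hS)

theorem subVolume_restrict_of_subset (he : IsSubmanifoldCoord S e) {V : Set (Cn n)}
    (hV : V ⊆ e.source) : (subVolume k m S).restrict V = (chartVolume e).restrict V := by
  rw [← subVolume_restrict he, Measure.restrict_restrict' e.open_source.measurableSet,
    Set.inter_eq_self_of_subset_left hV]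

end SubVolume

/-! ### Lebesgue measure in coordinates -/

section Ambient

variable {n k m : ℕ} {S : Set (Cn n)} {e : Coord n k m}

/-- The isometry from the Euclidean product `ℂᵏ × ℂᵐ` onto `ℂⁿ`. -/
def prodIsometry (hn : k + m = n) : WithLp 2 (Cn k × Cn m) ≃ₗᵢ[ℂ] Cn n :=
  ((EuclideanSpace.basisFun (Fin k) ℂ).prod (EuclideanSpace.basisFun (Fin m) ℂ)).equiv
    (EuclideanSpace.basisFun (Fin n) ℂ) (finSumFinEquiv.trans (finCongr hn))

/-- The linear identification of `ℂᵏ × ℂᵐ` with `ℂⁿ`. -/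
def prodEquiv (hn : k + m = n) : (Cn k × Cn m) ≃L[ℂ] Cn n :=
  (WithLp.prodContinuousLinearEquiv 2 ℂ (Cn k) (Cn m)).symm.trans
    (prodIsometry hn).toContinuousLinearEquiv

theorem prodEquiv_apply (hn : k + m = n) (z : Cn k × Cn m) :
    prodEquiv hn z = prodIsometry hn (WithLp.toLp 2 z) := rfl

theorem measurePreserving_prodEquiv (hn : k + m = n) :
    MeasurePreserving (prodEquiv hn : Cn k × Cn m → Cn n) := by
  let f : WithLp 2 (Cn k × Cn m) ≃ₗᵢ[ℝ] Cn n :=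
    { toLinearEquiv := (prodIsometry hn).toLinearEquiv.restrictScalars ℝ
      norm_map' := (prodIsometry hn).norm_map }
  exact f.measurePreserving.comp (WithLp.volume_preserving_toLp (Cn k) (Cn m))

theorem prodEquiv_prodBasis (hn : k + m = n) (s : Fin k ⊕ Fin m) :
    prodEquiv hn (prodBasis k m s) =
      EuclideanSpace.basisFun (Fin n) ℂ (finSumFinEquiv.trans (finCongr hn) s) := by
  have h : (WithLp.toLp 2 (prodBasis k m s) : WithLp 2 (Cn k × Cn m)) =
      (EuclideanSpace.basisFun (Fin k) ℂ).prod (EuclideanSpace.basisFun (Fin m) ℂ) s := by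
    rw [prodBasis_apply, OrthonormalBasis.prod_apply]
    rcases s with i | j <;> simp
  rw [prodEquiv_apply, h, prodIsometry, OrthonormalBasis.equiv_apply_basis]

theorem gramDet_prodEquiv (hn : k + m = n) :
    gramDet (fun s => prodEquiv hn (prodBasis k m s)) = 1 := by
  have h : Matrix.gram ℂ (fun s => prodEquiv hn (prodBasis k m s)) = 1 := by
    ext i j
    rw [Matrix.gram_apply, prodEquiv_prodBasis, prodEquiv_prodBasis,
      orthonormal_iff_ite.1 (EuclideanSpace.basisFun (Fin n) ℂ).orthonormal, Matrix.one_apply]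
    simp
  rw [gramDet, h]
  simp

theorem abs_det_eq_ambientDensity (hn : k + m = n) (z : Cn k × Cn m) :
    |(((fderiv ℂ e.symm z).comp ((prodEquiv hn).symm : Cn n →L[ℂ] Cn k × Cn m)).restrictScalars
      ℝ).det| = ambientDensity e z := by
  rw [abs_det_restrictScalars]
  have h := gramDet_comp (prodBasis k m) ((prodEquiv hn).toLinearEquiv : (Cn k × Cn m) →ₗ[ℂ] Cn n)
    (((prodEquiv hn).symm.toLinearEquiv : Cn n →ₗ[ℂ] (Cn k × Cn m)) ∘ₗ
      (fderiv ℂ e.symm z : (Cn k × Cn m) →ₗ[ℂ] Cn n))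
  have h1 := gramDet_prodEquiv (k := k) (m := m) hn
  simp only [LinearEquiv.coe_coe, ContinuousLinearEquiv.coe_toLinearEquiv, LinearMap.comp_apply,
    ContinuousLinearEquiv.apply_symm_apply, ContinuousLinearMap.coe_coe, h1, mul_one] at h
  unfold ambientDensity
  simp only [← prodBasis_apply]
  rw [h, ← LinearMap.det_conj _ (prodEquiv hn).toLinearEquiv]
  congr 3
  refine LinearMap.ext fun y => ?_
  simp

theorem hasFDerivWithinAt_symm_prodEquiv (he : IsSubmanifoldCoord S e) (hn : k + m = n)
    {B : Set (Cn k × Cn m)} (hBT : B ⊆ e.target) :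
    ∀ y ∈ prodEquiv hn '' B, HasFDerivWithinAt (fun y => e.symm ((prodEquiv hn).symm y))
      (((fderiv ℂ e.symm ((prodEquiv hn).symm y)).comp
        ((prodEquiv hn).symm : Cn n →L[ℂ] Cn k × Cn m)).restrictScalars ℝ)
      (prodEquiv hn '' B) y := by
  rintro _ ⟨z, hz, rfl⟩
  have h1 := (he.analyticAt_symm (hBT hz)).differentiableAt.hasFDerivAt
  have h2 := (prodEquiv hn).symm.hasFDerivAt (x := prodEquiv hn z)
  rw [(prodEquiv hn).symm_apply_apply]
  have h3 : HasFDerivAt e.symm (fderiv ℂ e.symm z) ((prodEquiv hn).symm (prodEquiv hn z)) := by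
    rwa [(prodEquiv hn).symm_apply_apply]
  exact ((h3.comp _ h2).restrictScalars ℝ).hasFDerivWithinAt

theorem injOn_symm_prodEquiv (hn : k + m = n) {B : Set (Cn k × Cn m)} (hBT : B ⊆ e.target) :
    Set.InjOn (fun y => e.symm ((prodEquiv hn).symm y)) (prodEquiv hn '' B) := by
  rintro _ ⟨z, hz, rfl⟩ _ ⟨z', hz', rfl⟩ h
  simp only [ContinuousLinearEquiv.symm_apply_apply] at h
  rw [e.symm.injOn (hBT hz) (hBT hz') h]

theorem image_symm_prodEquiv (hn : k + m = n) (B : Set (Cn k × Cn m)) :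
    (fun y => e.symm ((prodEquiv hn).symm y)) '' (prodEquiv hn '' B) = e.symm '' B := by
  rw [← Set.image_comp]
  refine Set.image_congr fun z _ => ?_
  simp

theorem measurableSet_prodEquiv_image (hn : k + m = n) {B : Set (Cn k × Cn m)}
    (hB : MeasurableSet B) : MeasurableSet (prodEquiv hn '' B) :=
  (prodEquiv hn).toHomeomorph.measurableEmbedding.measurableSet_image.2 hB

/-- Change of variables for Lebesgue measure. -/
theorem integral_symm_image (he : IsSubmanifoldCoord S e) (hn : k + m = n)
    {B : Set (Cn k × Cn m)} (hB : MeasurableSet B) (hBT : B ⊆ e.target) (h : Cn n → ℂ) :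
    ∫ y in e.symm '' B, h y = ∫ z in B, ambientDensity e z • h (e.symm z) := by
  rw [← image_symm_prodEquiv hn B, integral_image_eq_integral_abs_det_fderiv_smul volume
    (measurableSet_prodEquiv_image hn hB) (hasFDerivWithinAt_symm_prodEquiv he hn hBT)
    (injOn_symm_prodEquiv hn hBT)]
  simp only [abs_det_eq_ambientDensity]
  rw [(measurePreserving_prodEquiv hn).setIntegral_image_emb
    (prodEquiv hn).toHomeomorph.measurableEmbedding]
  simp only [ContinuousLinearEquiv.symm_apply_apply]

theorem integrableOn_symm_image (he : IsSubmanifoldCoord S e) (hn : k + m = n)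
    {B : Set (Cn k × Cn m)} (hB : MeasurableSet B) (hBT : B ⊆ e.target) (h : Cn n → ℂ) :
    IntegrableOn h (e.symm '' B) ↔
      IntegrableOn (fun z => ambientDensity e z • h (e.symm z)) B := by
  rw [← image_symm_prodEquiv hn B, integrableOn_image_iff_integrableOn_abs_det_fderiv_smul volume
    (measurableSet_prodEquiv_image hn hB) (hasFDerivWithinAt_symm_prodEquiv he hn hBT)
    (injOn_symm_prodEquiv hn hBT)]
  simp only [abs_det_eq_ambientDensity]
  rw [(measurePreserving_prodEquiv hn).integrableOn_image
    (prodEquiv hn).toHomeomorph.measurableEmbedding]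
  simp only [Function.comp_def, ContinuousLinearEquiv.symm_apply_apply]

end Ambient

/-! ### A uniform Taylor estimate -/

theorem coeff_eq_zero_of_isBigO : ∀ (q : ℕ) (c : ℕ → ℂ),
    (fun s : ℝ => ∑ j ∈ Finset.range q, (s ^ j : ℝ) • c j) =O[𝓝[>] 0] (fun s : ℝ => s ^ q) →
    ∀ j < q, c j = 0 := by
  intro q
  induction q with
  | zero => simp
  | succ q ih =>
    intro c h
    have h0 : c 0 = 0 := by
      have h1 : Tendsto (fun s : ℝ => ∑ j ∈ Finset.range (q + 1), (s ^ j : ℝ) • c j) (𝓝[>] 0)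
          (𝓝 (∑ j ∈ Finset.range (q + 1), ((0 : ℝ) ^ j : ℝ) • c j)) :=
        (Continuous.tendsto (by fun_prop) 0).mono_left nhdsWithin_le_nhds
      have h2 : Tendsto (fun s : ℝ => s ^ (q + 1)) (𝓝[>] 0) (𝓝 0) := by
        have : Continuous fun s : ℝ => s ^ (q + 1) := by fun_prop
        simpa using (this.tendsto 0).mono_left (nhdsWithin_le_nhds (s := Set.Ioi 0))
      have h3 := tendsto_nhds_unique h1 (h.trans_tendsto h2)
      rw [Finset.sum_range_succ'] at h3
      simpa using h3
    have h4 : (fun s : ℝ => ∑ j ∈ Finset.range q, (s ^ j : ℝ) • c (j + 1)) =O[𝓝[>] 0]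
        (fun s : ℝ => s ^ q) := by
      have h5 := (isBigO_refl (fun s : ℝ => s⁻¹) (𝓝[>] 0)).smul h
      refine h5.congr' ?_ ?_
      · filter_upwards [self_mem_nhdsWithin] with s hs
        have hs' : s ≠ 0 := ne_of_gt hs
        rw [Finset.sum_range_succ', h0, smul_zero, add_zero, Finset.smul_sum]
        refine Finset.sum_congr rfl fun j _ => ?_
        rw [smul_smul, pow_succ, mul_comm (s ^ j), inv_mul_cancel_left₀ hs']
      · filter_upwards [self_mem_nhdsWithin] with s hs
        have hs' : s ≠ 0 := ne_of_gt hs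
        rw [smul_eq_mul, pow_succ, mul_comm (s ^ q), inv_mul_cancel_left₀ hs']
    intro j hj
    rcases j with _ | j
    · exact h0
    · exact ih (fun j => c (j + 1)) h4 j (by omega)

theorem norm_le_of_iterated_hasDerivAt {q : ℕ} (f : ℕ → ℝ → ℂ) {C : ℝ}
    (hf : ∀ j, ∀ s ∈ Set.Icc (0 : ℝ) 1, HasDerivAt (f j) (f (j + 1) s) s)
    (hC : ∀ s ∈ Set.Icc (0 : ℝ) 1, ‖f (q + 1) s‖ ≤ C)
    (h0 : f 0 =O[𝓝[>] 0] fun s : ℝ => s ^ (q + 1)) :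
    ∀ s ∈ Set.Icc (0 : ℝ) 1, ‖f 0 s‖ ≤ C * s ^ (q + 1) := by
  have hu : UniqueDiffOn ℝ (Set.Icc (0 : ℝ) 1) := uniqueDiffOn_Icc zero_lt_one
  have hit : ∀ j, ∀ s ∈ Set.Icc (0 : ℝ) 1, iteratedDerivWithin j (f 0) (Set.Icc 0 1) s = f j s := by
    intro j
    induction j with
    | zero =>
      intro s _
      simp
    | succ j ih =>
      intro s hs
      rw [iteratedDerivWithin_succ, derivWithin_congr (fun y hy => ih y hy) (ih s hs)]
      exact (hf j s hs).hasDerivWithinAt.derivWithin (hu s hs)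
  have hcd : ContDiffOn ℝ ((q : ℕ∞ω) + 1) (f 0) (Set.Icc 0 1) := by
    have h1 : ContDiffOn ℝ ((q + 1 : ℕ) : ℕ∞ω) (f 0) (Set.Icc 0 1) := by
      refine contDiffOn_of_differentiableOn_deriv fun j _ s hs => ?_
      refine DifferentiableWithinAt.congr
        (hf j s hs).differentiableAt.differentiableWithinAt (fun y hy => hit j y hy) (hit j s hs)
    exact_mod_cast h1
  have htay : ∀ s ∈ Set.Icc (0 : ℝ) 1, ‖f 0 s - taylorWithinEval (f 0) q (Set.Icc 0 1) 0 s‖ ≤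
      C * s ^ (q + 1) / (q.factorial : ℝ) := by
    intro s hs
    have := taylor_mean_remainder_bound zero_le_one hcd hs (C := C) (fun y hy => by
      rw [hit _ y hy]
      exact hC y hy)
    simpa using this
  have hT : ∀ s, taylorWithinEval (f 0) q (Set.Icc 0 1) 0 s =
      ∑ j ∈ Finset.range (q + 1), (s ^ j : ℝ) • (((j.factorial : ℝ)⁻¹) • f j 0) := by
    intro s
    rw [taylor_within_apply]
    refine Finset.sum_congr rfl fun j _ => ?_
    rw [hit j 0 (by simp), smul_smul, sub_zero, mul_comm]
  have hC0 : 0 ≤ C := (norm_nonneg _).trans (hC 0 (by simp))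
  have hO : (fun s => taylorWithinEval (f 0) q (Set.Icc 0 1) 0 s) =O[𝓝[>] 0]
      fun s : ℝ => s ^ (q + 1) := by
    have h1 : (fun s => f 0 s - taylorWithinEval (f 0) q (Set.Icc 0 1) 0 s) =O[𝓝[>] 0]
        fun s : ℝ => s ^ (q + 1) := by
      refine IsBigO.of_bound (C / (q.factorial : ℝ)) ?_
      filter_upwards [Ioo_mem_nhdsGT (zero_lt_one (α := ℝ))] with s hs
      refine (htay s ⟨hs.1.le, hs.2.le⟩).trans (le_of_eq ?_)
      rw [Real.norm_of_nonneg (pow_nonneg hs.1.le _)]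
      ring
    simpa using h0.sub h1
  simp only [hT] at hO htay
  have hz := coeff_eq_zero_of_isBigO (q + 1) _ hO
  intro s hs
  have h1 := htay s hs
  rw [Finset.sum_eq_zero (fun j hj => by rw [hz j (Finset.mem_range.1 hj), smul_zero]),
    sub_zero] at h1
  refine h1.trans (div_le_self (mul_nonneg hC0 (pow_nonneg hs.1 _)) ?_)
  exact_mod_cast Nat.one_le_iff_ne_zero.2 (Nat.factorial_ne_zero q)

theorem exists_iterated_fst_deriv {E : Type*} [NormedAddCommGroup E] [NormedSpace ℝ E]
    {O : Set (ℝ × E)} (hO : IsOpen O) {f : ℝ × E → ℂ} (hf : ContDiffOn ℝ ∞ f O) :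
    ∃ Ψ : ℕ → ℝ × E → ℂ, Ψ 0 = f ∧ (∀ j, ContDiffOn ℝ ∞ (Ψ j) O) ∧
      ∀ j s z, (s, z) ∈ O → HasDerivAt (fun s => Ψ j (s, z)) (Ψ (j + 1) (s, z)) s := by
  let Ψ : ℕ → ℝ × E → ℂ := fun j => Nat.rec f (fun _ g y => fderiv ℝ g y (1, 0)) j
  have hsm : ∀ j, ContDiffOn ℝ ∞ (Ψ j) O := by
    intro j
    induction j with
    | zero => exact hf
    | succ j ih =>
      have h1 : ContDiffOn ℝ ∞ (fderiv ℝ (Ψ j)) O := ih.fderiv_of_isOpen hO (by simp)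
      exact h1.clm_apply contDiffOn_const
  refine ⟨Ψ, rfl, hsm, fun j s z hz => ?_⟩
  have h1 := ((hsm j).contDiffAt (hO.mem_nhds hz)).differentiableAt (by simp)
  have h2 : HasDerivAt (fun s : ℝ => (s, z)) (1, 0) s :=
    (hasDerivAt_id s).prodMk (hasDerivAt_const s _)
  exact h1.hasFDerivAt.comp_hasDerivAt s h2

/-- A smooth function vanishing to order `q` along `{w = 0}` is `O(‖w‖^q)` locally uniformly. -/
theorem exists_norm_le_mul_pow {k m : ℕ} {Φ : Cn k × Cn m → ℂ} {O : Set (Cn k × Cn m)}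
    (hO : IsOpen O) (hΦ : ContDiffOn ℝ ∞ Φ O) {r : ℝ} (hr : 0 < r) {v₀ : Cn m}
    (hbox : Metric.closedBall (0 : Cn k) r ×ˢ Metric.closedBall v₀ r ⊆ O) {q : ℕ} (hq : 1 ≤ q)
    (hvan : ∀ v ∈ Metric.closedBall v₀ r, (fun w => Φ (w, v)) =O[𝓝 0] fun w => ‖w‖ ^ q) :
    ∃ C, 0 ≤ C ∧ ∀ w ∈ Metric.closedBall (0 : Cn k) r, ∀ v ∈ Metric.closedBall v₀ r,
      ‖Φ (w, v)‖ ≤ C * ‖w‖ ^ q := by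
  obtain ⟨q, rfl⟩ : ∃ q', q = q' + 1 := ⟨q - 1, by omega⟩
  let T : ℝ × (Cn k × Cn m) → Cn k × Cn m := fun y => (y.1 • y.2.1, y.2.2)
  have hT : ContDiff ℝ ∞ T := by
    refine ContDiff.prodMk ?_ ?_
    · exact contDiff_fst.smul (contDiff_fst.comp contDiff_snd)
    · exact contDiff_snd.comp contDiff_snd
  set O' : Set (ℝ × (Cn k × Cn m)) := T ⁻¹' O with hO'
  have hO'o : IsOpen O' := hO.preimage hT.continuous
  obtain ⟨Ψ, hΨ0, hsm, hder⟩ := exists_iterated_fst_deriv hO'o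
    (hΦ.comp hT.contDiffOn fun y hy => hy)
  have hsph : IsCompact (Metric.sphere (0 : Cn k) r ×ˢ Metric.closedBall v₀ r) :=
    (isCompact_sphere _ _).prod (isCompact_closedBall _ _)
  have hcomp : IsCompact (Set.Icc (0 : ℝ) 1 ×ˢ
      (Metric.sphere (0 : Cn k) r ×ˢ Metric.closedBall v₀ r)) := isCompact_Icc.prod hsph
  have hsubO : Set.Icc (0 : ℝ) 1 ×ˢ (Metric.sphere (0 : Cn k) r ×ˢ Metric.closedBall v₀ r) ⊆ O' := by
    rintro ⟨s, w, v⟩ ⟨hs, hw, hv⟩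
    refine hbox ⟨?_, hv⟩
    simp only [Set.mem_Icc, mem_sphere_zero_iff_norm, mem_closedBall_zero_iff, T] at hs hw ⊢
    rw [norm_smul, Real.norm_of_nonneg hs.1, hw]
    nlinarith [hs.2]
  obtain ⟨C, hC⟩ := hcomp.exists_bound_of_continuousOn ((hsm (q + 1)).continuousOn.mono hsubO)
  have hmain : ∀ w ∈ Metric.sphere (0 : Cn k) r, ∀ v ∈ Metric.closedBall v₀ r,
      ∀ s ∈ Set.Icc (0 : ℝ) 1, ‖Φ (s • w, v)‖ ≤ C * s ^ (q + 1) := by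
    intro w hw v hv
    have h3 := norm_le_of_iterated_hasDerivAt (fun j s => Ψ j (s, (w, v))) (C := C) (q := q)
      (fun j s hs => hder j s (w, v) (hsubO ⟨hs, hw, hv⟩)) (fun s hs => hC _ ⟨hs, hw, hv⟩) ?_
    · intro s hs
      have h4 := h3 s hs
      rw [hΨ0] at h4
      exact h4
    · have h1 : Tendsto (fun s : ℝ => s • w) (𝓝[>] 0) (𝓝 0) := by
        have : Continuous fun s : ℝ => s • w := by fun_prop
        simpa using (this.tendsto 0).mono_left (nhdsWithin_le_nhds (s := Set.Ioi 0))
      have h2 := (hvan v hv).comp_tendsto h1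
      have h5 : (fun s => Ψ 0 (s, (w, v))) = (fun w => Φ (w, v)) ∘ fun s : ℝ => s • w := by
        funext s
        rw [hΨ0]
        rfl
      rw [h5]
      refine h2.trans (IsBigO.of_bound (‖w‖ ^ (q + 1)) (Eventually.of_forall fun s => ?_))
      simp only [Function.comp, norm_smul, mul_pow, norm_mul, norm_pow, norm_norm]
      rw [mul_comm]
  have hC0 : ∀ w ∈ Metric.closedBall (0 : Cn k) r, ∀ v ∈ Metric.closedBall v₀ r,
      ‖Φ (w, v)‖ ≤ |C| / r ^ (q + 1) * ‖w‖ ^ (q + 1) := by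
    intro w hw v hv
    rw [mem_closedBall_zero_iff] at hw
    rcases eq_or_ne w 0 with rfl | hw0
    · have h1 := (hvan v hv).eq_zero_imp.self_of_nhds (by simp)
      simp [h1]
    · have hn : 0 < ‖w‖ := norm_pos_iff.2 hw0
      have h1 := hmain ((r / ‖w‖) • w) (by
        rw [mem_sphere_zero_iff_norm, norm_smul, Real.norm_of_nonneg (by positivity)]
        field_simp) v hv (‖w‖ / r) ⟨by positivity, (div_le_one hr).2 hw⟩
      have h2 : (‖w‖ / r) • ((r / ‖w‖) • w) = w := by
        rw [smul_smul, div_mul_div_cancel₀ hr.ne', div_self hn.ne', one_smul]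
      rw [h2] at h1
      refine h1.trans ?_
      rw [div_pow, div_mul_eq_mul_div, ← mul_div_assoc]
      gcongr
      exact le_abs_self C
  exact ⟨_, by positivity, hC0⟩

/-! ### Smooth extensions in coordinates -/

section Extension

variable {n k m p : ℕ} {D S : Set (Cn n)} {G : Cn n → EReal} {φ : Cn n → ℝ} {e : Coord n k m}
  {x : Cn n} {f : ∀ x, JetFibre S p x} {F : Cn n → ℂ}

theorem IsSmoothExtension.isLittleO_slice (hF : IsSmoothExtension D S p f F)
    (he : IsSubmanifoldCoord S e) (hx : x ∈ e.source) (hxS : x ∈ S) (hp : 1 ≤ p)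
    {P : MvPolynomial (Fin k) ℂ} (hP : CorrespondsTo S p e x (f x) P) :
    (fun w => F (e.symm (w, (e x).2)) - MvPolynomial.eval (fun i => w i) P)
      =o[𝓝 0] fun w => ‖w‖ ^ (p - 1) := by
  obtain ⟨H, hH, hFH⟩ := hF.2 x hxS
  have h1 := hH.sub_isBigO hxS hp hP.2
  have h2 : (fun y : Cn n => ‖y - x‖ ^ p) =o[𝓝 x] fun y => ‖y - x‖ ^ (p - 1) := by
    have h3 : Tendsto (fun y : Cn n => ‖y - x‖) (𝓝 x) (𝓝 0) := by
      have : Continuous fun y : Cn n => ‖y - x‖ := by fun_prop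
      simpa using this.tendsto x
    exact (isLittleO_pow_pow (by omega : p - 1 < p)).comp_tendsto h3
  have h4 := hFH.add (h1.trans_isLittleO h2)
  simp only [sub_add_sub_cancel] at h4
  have hT := he.zero_mem_target hx hxS
  have hd : DifferentiableAt ℂ (fun w : Cn k => e.symm (w, (e x).2)) 0 := by
    refine DifferentiableAt.comp (g := e.symm) (f := fun w : Cn k => (w, (e x).2)) _
      (he.analyticAt_symm hT).differentiableAt ?_
    fun_prop
  have htend : Tendsto (fun w : Cn k => e.symm (w, (e x).2)) (𝓝 0) (𝓝 x) := by
    have := hd.continuousAt.tendsto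
    rwa [he.symm_zero hx hxS] at this
  have hO : (fun w : Cn k => ‖e.symm (w, (e x).2) - x‖ ^ (p - 1)) =O[𝓝 0]
      fun w => ‖w‖ ^ (p - 1) := by
    have := hd.isBigO_sub
    simp only [sub_zero, he.symm_zero hx hxS] at this
    exact this.norm_norm.pow _
  have hev : ∀ᶠ w : Cn k in 𝓝 0, (w, (e x).2) ∈ e.target := by
    have hc : Continuous fun w : Cn k => (w, (e x).2) := by fun_prop
    exact hc.continuousAt.eventually (e.open_target.mem_nhds hT)
  refine ((h4.comp_tendsto htend).trans_isBigO hO).congr' ?_ EventuallyEq.rfl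
  filter_upwards [hev] with w hw
  simp only [Function.comp, coordPoly, e.right_inv hw]

theorem IsSmoothExtension.isBigO_slice (hF : IsSmoothExtension D S p f F)
    (he : IsSubmanifoldCoord S e) (hx : x ∈ e.source) (hxS : x ∈ S) (hp : 1 ≤ p) :
    (fun w => F (e.symm (w, (e x).2))) =O[𝓝 0] fun w => ‖w‖ ^ (p - 1) := by
  obtain ⟨P, hP⟩ := exists_correspondsTo he hx hxS p (f x)
  simpa using (hF.isLittleO_slice he hx hxS hp hP).isBigO.add
    (isBigO_eval_of_isHomogeneous hP.1 (𝓝 0))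

theorem IsSubmanifoldCoord.contDiffOn_symm (he : IsSubmanifoldCoord S e) :
    ContDiffOn ℝ ∞ e.symm e.target := fun _ hz =>
  ((he.analyticAt_symm hz).contDiffAt.restrict_scalars ℝ).contDiffWithinAt

theorem IsSmoothExtension.exists_bound (hF : IsSmoothExtension D S p f F)
    (he : IsSubmanifoldCoord S e) (heD : e.source ⊆ D) (hp : 2 ≤ p) {r : ℝ} (hr : 0 < r)
    {v₀ : Cn m} (hbox : Metric.closedBall (0 : Cn k) r ×ˢ Metric.closedBall v₀ r ⊆ e.target) :
    ∃ C, 0 ≤ C ∧ ∀ w ∈ Metric.closedBall (0 : Cn k) r, ∀ v ∈ Metric.closedBall v₀ r,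
      ‖F (e.symm (w, v))‖ ≤ C * ‖w‖ ^ (p - 1) := by
  refine exists_norm_le_mul_pow (Φ := fun z => F (e.symm z)) e.open_target
    (hF.1.comp he.contDiffOn_symm fun z hz => heD (e.map_target hz)) hr hbox (by omega)
    fun v hv => ?_
  have hT : ((0 : Cn k), v) ∈ e.target := hbox ⟨Metric.mem_closedBall_self hr.le, hv⟩
  have h := hF.isBigO_slice he (e.map_target hT) ((he.symm_mem_iff hT).2 rfl) (by omega)
  rwa [e.right_inv hT] at h

variable {g : ∀ x, JetFibre S p x} {H : Cn n → ℂ}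

theorem weighted_product_le {s A A' F F' H H' E E' T T' : ℝ} {k q N : ℕ} (hs : 0 < s)
    (hN : N = k + q) (hA : 0 ≤ A) (hA' : A ≤ A') (hF : 0 ≤ F) (hF' : F ≤ F' * s ^ q)
    (hF0 : 0 ≤ F') (hH : 0 ≤ H) (hH' : H ≤ H' * s ^ q) (hH0 : 0 ≤ H') (hE : 0 ≤ E) (hE' : E ≤ E')
    (hT : 0 ≤ T) (hT' : T ≤ T') :
    s ^ (2 * k) * (A * (F * H * (E * ((s ^ (2 * N))⁻¹ * T)))) ≤ A' * (F' * H' * (E' * T')) := by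
  have hA0 := hA.trans hA'
  have hE0 := hE.trans hE'
  have hT0 := hT.trans hT'
  calc s ^ (2 * k) * (A * (F * H * (E * ((s ^ (2 * N))⁻¹ * T))))
      ≤ s ^ (2 * k) * (A' * ((F' * s ^ q) * (H' * s ^ q) * (E' * ((s ^ (2 * N))⁻¹ * T')))) := by
        gcongr
    _ = (s ^ (2 * k) * s ^ q * s ^ q * (s ^ (2 * N))⁻¹) * (A' * (F' * H' * (E' * T'))) := by ring
    _ = A' * (F' * H' * (E' * T')) := by
      rw [← pow_add, ← pow_add, show 2 * k + q + q = 2 * N by omega,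
        mul_inv_cancel₀ (by positivity), one_mul]

theorem IsGreenPart.norm_integrand_symm {γ : Cn n → ℝ} (hγ : IsGreenPart G e γ) (hp : 1 ≤ p)
    {w : Cn k} {v : Cn m} (hz : (w, v) ∈ e.target) (hw0 : w ≠ 0) :
    (G (e.symm (w, v))).toReal = 2 * Real.log ‖w‖ + γ (e.symm (w, v)) ∧
    ‖integrand k p G φ F H (e.symm (w, v))‖ =
      ‖F (e.symm (w, v))‖ * ‖H (e.symm (w, v))‖ * (Real.exp (-φ (e.symm (w, v))) *
        ((‖w‖ ^ (2 * (k + (p - 1))))⁻¹ *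
          Real.exp (-((k + (p - 1) : ℕ) : ℝ) * γ (e.symm (w, v))))) := by
  have hn : 0 < ‖w‖ := norm_pos_iff.2 hw0
  have hew : (e (e.symm (w, v))).1 = w := by rw [e.right_inv hz]
  have hG : (G (e.symm (w, v))).toReal = 2 * Real.log ‖w‖ + γ (e.symm (w, v)) := by
    rw [hγ.eq_coe (e.map_target hz) (by rwa [hew]), EReal.toReal_coe, hew]
  refine ⟨hG, ?_⟩
  rw [integrand, norm_mul, norm_mul, RCLike.norm_conj, Complex.norm_real, Real.norm_eq_abs,
    Real.abs_exp, hG, cast_exponent hp, sub_eq_add_neg, ← neg_mul, Real.exp_add,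
    exp_neg_mul_log hn]

theorem exists_abs_le_of_continuousOn {h : Cn n → ℝ} (hh : ContinuousOn h e.source) {r : ℝ} {v₀ : Cn m}
    (hbox : Metric.closedBall (0 : Cn k) r ×ˢ Metric.closedBall v₀ r ⊆ e.target) :
    ∃ C, ∀ v ∈ Metric.closedBall v₀ r, ∀ w ∈ Metric.closedBall (0 : Cn k) r,
      |h (e.symm (w, v))| ≤ C := by
  have hcomp : IsCompact (Metric.closedBall (0 : Cn k) r ×ˢ Metric.closedBall v₀ r) :=
    (isCompact_closedBall _ _).prod (isCompact_closedBall _ _)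
  obtain ⟨C, hC⟩ := hcomp.exists_bound_of_continuousOn
    (hh.comp (e.continuousOn_symm.mono hbox) fun z hz => e.map_target (hbox hz))
  exact ⟨C, fun v hv w hw => hC (w, v) ⟨hw, hv⟩⟩

theorem exists_ambientDensity_le (he : IsSubmanifoldCoord S e) {r : ℝ} {v₀ : Cn m}
    (hbox : Metric.closedBall (0 : Cn k) r ×ˢ Metric.closedBall v₀ r ⊆ e.target) :
    ∃ C, ∀ v ∈ Metric.closedBall v₀ r, ∀ w ∈ Metric.closedBall (0 : Cn k) r,
      ambientDensity e (w, v) ≤ C := by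
  have hcomp : IsCompact (Metric.closedBall (0 : Cn k) r ×ˢ Metric.closedBall v₀ r) :=
    (isCompact_closedBall _ _).prod (isCompact_closedBall _ _)
  obtain ⟨C, hC⟩ := hcomp.exists_bound_of_continuousOn (he.continuousOn_ambientDensity.mono hbox)
  exact ⟨C, fun v hv w hw => (le_abs_self _).trans (hC (w, v) ⟨hw, hv⟩)⟩

/-- On a box, the integrand is bounded by `‖w‖^(-2k)`. -/
theorem exists_integrand_bound (hF : IsSmoothExtension D S p f F) (hH : IsSmoothExtension D S p g H)
    (he : IsAdaptedCoord D S G e) {γ : Cn n → ℝ} (hγ : IsGreenPart G e γ) (hφ : ContinuousOn φ D)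
    (hp : 2 ≤ p) {r : ℝ} (hr : 0 < r) {v₀ : Cn m}
    (hbox : Metric.closedBall (0 : Cn k) r ×ˢ Metric.closedBall v₀ r ⊆ e.target) :
    ∃ M C, 0 ≤ M ∧ ∀ v ∈ Metric.closedBall v₀ r, ∀ w ∈ Metric.closedBall (0 : Cn k) r, w ≠ 0 →
      |(G (e.symm (w, v))).toReal - 2 * Real.log ‖w‖| ≤ C ∧
      ‖w‖ ^ (2 * k) * (ambientDensity e (w, v) * ‖integrand k p G φ F H (e.symm (w, v))‖) ≤ M := by
  have he' := he.toIsSubmanifoldCoord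
  obtain ⟨CF, hCF0, hCF⟩ := hF.exists_bound he' he.source_subset hp hr hbox
  obtain ⟨CH, hCH0, hCH⟩ := hH.exists_bound he' he.source_subset hp hr hbox
  obtain ⟨CA, hCA⟩ := exists_ambientDensity_le he' hbox
  obtain ⟨Cγ, hCγ⟩ := exists_abs_le_of_continuousOn hγ.1 hbox
  obtain ⟨Cφ, hCφ⟩ := exists_abs_le_of_continuousOn (hφ.mono he.source_subset) hbox
  refine ⟨|CA| * (CF * CH * (Real.exp Cφ * Real.exp (((k + (p - 1) : ℕ) : ℝ) * Cγ))), Cγ,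
    by positivity, fun v hv w hw hw0 => ?_⟩
  have hz := hbox (Set.mk_mem_prod hw hv)
  obtain ⟨hG, hnorm⟩ := hγ.norm_integrand_symm (φ := φ) (F := F) (H := H)
    (by omega : 1 ≤ p) hz hw0
  have h1 := hCγ v hv w hw
  refine ⟨by rw [hG, add_sub_cancel_left]; exact h1, ?_⟩
  rw [hnorm]
  refine weighted_product_le (norm_pos_iff.2 hw0) rfl (he'.ambientDensity_pos hz).le
    ((hCA v hv w hw).trans (le_abs_self _)) (norm_nonneg _) (hCF w hw v hv) hCF0 (norm_nonneg _)
    (hCH w hw v hv) hCH0 (Real.exp_pos _).le (Real.exp_le_exp.2 ?_) (Real.exp_pos _).le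
    (Real.exp_le_exp.2 ?_)
  · linarith [(abs_le.1 (hCφ v hv w hw)).1]
  · rw [neg_mul, ← mul_neg]
    exact mul_le_mul_of_nonneg_left (by linarith [(abs_le.1 h1).1]) (Nat.cast_nonneg _)

theorem IsGreenType.eq_bot (hG : IsGreenType k m D S G) {y : Cn n} (hy : y ∈ S) : G y = ⊥ := by
  obtain ⟨e, hye, he⟩ := hG.coord y hy
  obtain ⟨γ, hγ⟩ := he.green
  exact IsGreenPart.eq_bot hγ hye ((he.mem_iff y hye).1 hy)

theorem isOpen_diff_of_relClosed (hD : IsOpen D) (hS : closure S ∩ D ⊆ S) : IsOpen (D \ S) := by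
  have : D \ S = D \ closure S := by
    ext y
    refine ⟨fun h => ⟨h.1, fun hc => h.2 (hS ⟨hc, h.1⟩)⟩, fun h => ⟨h.1, fun hc => h.2 (subset_closure hc)⟩⟩
  rw [this]
  exact hD.sdiff isClosed_closure

theorem IsGreenType.isOpen_shell_inter (hG : IsGreenType k m D S G) (hD : IsOpen D)
    (hS : closure S ∩ D ⊆ S) (t : ℝ) : IsOpen (shell G t ∩ D) := by
  have h1 : shell G t ∩ D = (D \ S) ∩ G ⁻¹' Set.Ioo (t : EReal) ((t + 1 : ℝ) : EReal) := by
    ext y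
    constructor
    · rintro ⟨h1, h2⟩
      refine ⟨⟨h2, fun h => ?_⟩, h1⟩
      have := h1.1
      rw [hG.eq_bot h] at this
      exact not_lt_bot this
    · rintro ⟨h1, h2⟩
      exact ⟨h2, h1.1⟩
  rw [h1]
  exact hG.cont.isOpen_inter_preimage (isOpen_diff_of_relClosed hD hS) isOpen_Ioo

/-- The box of radius `r` around the point of `S` with coordinates `(0, v₀)`. -/
def coordBox (e : Coord n k m) (r : ℝ) (v₀ : Cn m) : Set (Cn n) :=
  e.symm '' (Metric.ball (0 : Cn k) r ×ˢ Metric.ball v₀ r)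

theorem isOpen_coordBox {r : ℝ} {v₀ : Cn m}
    (hbox : Metric.closedBall (0 : Cn k) r ×ˢ Metric.closedBall v₀ r ⊆ e.target) :
    IsOpen (coordBox e r v₀) :=
  e.symm.isOpen_image_of_subset_source (Metric.isOpen_ball.prod Metric.isOpen_ball)
    ((Set.prod_mono Metric.ball_subset_closedBall Metric.ball_subset_closedBall).trans hbox)

theorem isAdaptedNhd_coordBox (he : IsAdaptedCoord D S G e) {r : ℝ} (hr : 0 < r) {v₀ : Cn m}
    (hbox : Metric.closedBall (0 : Cn k) r ×ˢ Metric.closedBall v₀ r ⊆ e.target) {v : Cn m}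
    (hv : v ∈ Metric.ball v₀ r) :
    IsAdaptedNhd D S G e (coordBox e r v₀) (e.symm (0, v)) := by
  have hcomp : IsCompact (e.symm '' (Metric.closedBall (0 : Cn k) r ×ˢ Metric.closedBall v₀ r)) :=
    ((isCompact_closedBall _ _).prod (isCompact_closedBall _ _)).image_of_continuousOn
      (e.continuousOn_symm.mono hbox)
  have hsub : closure (coordBox e r v₀) ⊆
      e.symm '' (Metric.closedBall (0 : Cn k) r ×ˢ Metric.closedBall v₀ r) :=
    closure_minimal (Set.image_mono
      (Set.prod_mono Metric.ball_subset_closedBall Metric.ball_subset_closedBall)) hcomp.isClosed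
  have h0 : ((0 : Cn k), v) ∈ Metric.ball (0 : Cn k) r ×ˢ Metric.ball v₀ r :=
    ⟨Metric.mem_ball_self hr, hv⟩
  exact
    { adapted := he
      isOpen := isOpen_coordBox hbox
      compact_closure := hcomp.of_isClosed_subset isClosed_closure hsub
      closure_subset := by
        refine hsub.trans ?_
        rintro _ ⟨z, hz, rfl⟩
        exact e.map_target (hbox hz)
      mem := ⟨_, h0, rfl⟩
      mem_S := (he.symm_mem_iff (hbox ⟨Metric.ball_subset_closedBall h0.1,
        Metric.ball_subset_closedBall h0.2⟩)).2 rfl }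

end Extension

/-! ### Integrals over shells near a point -/

/-- Dominated convergence for iterated integrals over a family of sets in a product. -/
theorem tendsto_setIntegral_prod {X Y : Type*} [MeasurableSpace X] [MeasurableSpace Y]
    {μ : Measure X} {ν : Measure Y} [SFinite μ] [SFinite ν] {B : Set Y} (hB : MeasurableSet B)
    (hBν : ν B ≠ ⊤) {A : ℝ → Set (X × Y)} (hA : ∀ t, MeasurableSet (A t))
    (hAB : ∀ t, ∀ z ∈ A t, z.2 ∈ B) {Θ : X × Y → ℂ} (hΘ : ∀ t, IntegrableOn Θ (A t) (μ.prod ν))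
    {M : ℝ} (hM : ∀ t, ∀ v ∈ B, ‖∫ w in {w | (w, v) ∈ A t}, Θ (w, v) ∂μ‖ ≤ M) {L : Y → ℂ}
    (hL : ∀ v ∈ B, Tendsto (fun t => ∫ w in {w | (w, v) ∈ A t}, Θ (w, v) ∂μ) atBot (𝓝 (L v))) :
    IntegrableOn L B ν ∧
      Tendsto (fun t => ∫ z in A t, Θ z ∂(μ.prod ν)) atBot (𝓝 (∫ v in B, L v ∂ν)) := by
  set I : ℝ → Y → ℂ := fun t v => ∫ w in {w | (w, v) ∈ A t}, Θ (w, v) ∂μ with hI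
  have hind : ∀ t v, ∫ w, (A t).indicator Θ (w, v) ∂μ = I t v := by
    intro t v
    have hm : MeasurableSet {w | (w, v) ∈ A t} := measurable_prodMk_right (hA t)
    simp only [hI]
    rw [← integral_indicator hm]
    rfl
  have hint : ∀ t, Integrable ((A t).indicator Θ) (μ.prod ν) := fun t =>
    (integrable_indicator_iff (hA t)).2 (hΘ t)
  have hImeas : ∀ t, AEStronglyMeasurable (I t) ν := by
    intro t
    have := (hint t).integral_prod_right.aestronglyMeasurable
    simpa only [hind] using this
  have hIz : ∀ t, ∀ v, v ∉ B → I t v = 0 := by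
    intro t v hv
    have : {w | (w, v) ∈ A t} = ∅ := by
      ext w
      simp only [Set.mem_ofPred_eq, Set.mem_empty_iff_false, iff_false]
      exact fun h => hv (hAB t _ h)
    simp only [hI, this, Measure.restrict_empty, integral_zero_measure]
  have hFub : ∀ t, ∫ z in A t, Θ z ∂(μ.prod ν) = ∫ v in B, I t v ∂ν := by
    intro t
    rw [← integral_indicator (hA t), integral_prod_symm _ (hint t)]
    simp only [hind]
    exact (setIntegral_eq_integral_of_forall_compl_eq_zero fun v hv => hIz t v hv).symm
  have hfin : IsFiniteMeasure (ν.restrict B) := ⟨by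
    rw [Measure.restrict_apply_univ]; exact hBν.lt_top⟩
  have hLae : ∀ᵐ v ∂(ν.restrict B), Tendsto (fun t => I t v) atBot (𝓝 (L v)) :=
    (ae_restrict_iff' hB).2 (Eventually.of_forall hL)
  have hMae : ∀ t, ∀ᵐ v ∂(ν.restrict B), ‖I t v‖ ≤ M := fun t =>
    (ae_restrict_iff' hB).2 (Eventually.of_forall (hM t))
  refine ⟨?_, ?_⟩
  · have hLm : AEStronglyMeasurable L (ν.restrict B) :=
      aestronglyMeasurable_of_tendsto_ae atBot (fun t => (hImeas t).restrict) hLae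
    refine Integrable.of_bound hLm M ((ae_restrict_iff' hB).2 (Eventually.of_forall ?_))
    exact fun v hv => le_of_tendsto (hL v hv).norm (Eventually.of_forall fun t => hM t v hv)
  · simp only [hFub]
    exact tendsto_integral_filter_of_dominated_convergence (fun _ => M)
      (Eventually.of_forall fun t => (hImeas t).restrict)
      (Eventually.of_forall hMae) (integrable_const M) hLae

section Local

variable {n k m p : ℕ} {D S : Set (Cn n)} {G : Cn n → EReal} {φ : Cn n → ℝ} {e : Coord n k m}
  {f g : ∀ x, JetFibre S p x} {F H : Cn n → ℂ}

theorem jetInner_slice_limit (hk : 1 ≤ k) (hp : 2 ≤ p) (hφ : ContinuousOn φ D)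
    (hF : IsSmoothExtension D S p f F) (hH : IsSmoothExtension D S p g H)
    (he : IsAdaptedCoord D S G e) {r : ℝ} (hr : 0 < r) {v₀ : Cn m}
    (hbox : Metric.closedBall (0 : Cn k) r ×ˢ Metric.closedBall v₀ r ⊆ e.target) {v : Cn m}
    (hv : v ∈ Metric.ball v₀ r) {χ : Cn n → ℝ} (hχ : Continuous χ) :
    Tendsto (fun t => ∫ w in vshell (Metric.ball 0 r) (fun w => (G (e.symm (w, v))).toReal) t,
      ambientDensity e (w, v) • χ (e.symm (w, v)) • integrand k p G φ F H (e.symm (w, v))) atBot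
      (𝓝 (subDensity e v • χ (e.symm (0, v)) • jetInner k m D S G φ p (e.symm (0, v))
        (f (e.symm (0, v))) (g (e.symm (0, v))))) := by
  have he' := he.toIsSubmanifoldCoord
  obtain ⟨γ, hγ⟩ := he.green
  have hvc := Metric.ball_subset_closedBall hv
  have hWT : ∀ w ∈ Metric.closedBall (0 : Cn k) r, (w, v) ∈ e.target := fun w hw =>
    hbox (Set.mk_mem_prod hw hvc)
  have hT : ((0 : Cn k), v) ∈ e.target := hWT 0 (Metric.mem_closedBall_self hr.le)
  have hx := e.map_target hT
  have hxS : e.symm (0, v) ∈ S := (he'.symm_mem_iff hT).2 rfl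
  have hex : (e (e.symm (0, v))).2 = v := by rw [e.right_inv hT]
  obtain ⟨P, hP⟩ := exists_correspondsTo he' hx hxS p (f (e.symm (0, v)))
  obtain ⟨Q, hQ⟩ := exists_correspondsTo he' hx hxS p (g (e.symm (0, v)))
  obtain ⟨C, hC⟩ := exists_abs_le_of_continuousOn hγ.1 hbox
  have hsl : ContinuousOn (fun w : Cn k => e.symm (w, v)) (Metric.ball 0 r) :=
    e.continuousOn_symm.comp (by fun_prop) fun w hw => hWT w (Metric.ball_subset_closedBall hw)
  have hmeas : ∀ {F' : Cn n → ℂ}, ContDiffOn ℝ ∞ F' D → AEStronglyMeasurable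
      (fun w => F' (e.symm (w, v))) (volume.restrict (Metric.ball (0 : Cn k) r)) := fun hF' =>
    (hF'.continuousOn.comp hsl fun w hw => he.source_subset
      (e.map_target (hWT w (Metric.ball_subset_closedBall hw)))).aestronglyMeasurable
      Metric.isOpen_ball.measurableSet
  have ha : ContinuousOn (fun w => ambientDensity e (w, v) * χ (e.symm (w, v)))
      (Metric.ball (0 : Cn k) r) := by
    refine ContinuousOn.mul ?_ (hχ.comp_continuousOn hsl)
    exact he'.continuousOn_ambientDensity.comp (f := fun w : Cn k => (w, v)) (by fun_prop)
      fun w hw => hWT w (Metric.ball_subset_closedBall hw)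
  have hoF := (hF.isLittleO_slice he' hx hxS (by omega) hP).mono (nhdsWithin_le_nhds (s := {0}ᶜ))
  have hoH := (hH.isLittleO_slice he' hx hxS (by omega) hQ).mono (nhdsWithin_le_nhds (s := {0}ᶜ))
  have key := (tendsto_integral_slice he' hx hxS hk (by omega : 1 ≤ p) hγ
    (hφ.mono he.source_subset) Metric.isOpen_ball (Metric.mem_ball_self hr)
    (by rw [hex]; exact fun w hw => hWT w (Metric.ball_subset_closedBall hw))
    ⟨C, fun w hw => by
      rw [hex]
      exact (abs_le.1 (hC v hvc w (Metric.ball_subset_closedBall hw))).1⟩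
    ha (by rw [hex]; exact hmeas hF.1) (by rw [hex]; exact hmeas hH.1) hP.1 hQ.1 hoF hoH).2
  rw [jetInner_eq_sliceForm hk (by omega) hφ (isAdaptedNhd_coordBox he hr hbox hv) hγ hP hQ,
    sliceForm]
  rw [hex] at key ⊢
  have hs := (he'.subDensity_pos hT).ne'
  convert key using 2
  · simp only [mul_smul]
  · simp only [Complex.real_smul]
    push_cast
    have hs' : (subDensity e v : ℂ) ≠ 0 := by exact_mod_cast hs
    field_simp

theorem subDomain_inter_preimage_coordBox {r : ℝ} (hr : 0 < r) {v₀ : Cn m}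
    (hbox : Metric.closedBall (0 : Cn k) r ×ˢ Metric.closedBall v₀ r ⊆ e.target) :
    subDomain e ∩ (fun v => e.symm (0, v)) ⁻¹' coordBox e r v₀ = Metric.ball v₀ r := by
  ext v
  constructor
  · rintro ⟨hv, z, hz, h⟩
    have hzT := hbox (Set.mk_mem_prod (Metric.ball_subset_closedBall hz.1)
      (Metric.ball_subset_closedBall hz.2))
    have h1 : z = (0, v) := e.symm.injOn hzT hv h
    rw [h1] at hz
    exact hz.2
  · intro hv
    have h0 : (0 : Cn k) ∈ Metric.ball (0 : Cn k) r := Metric.mem_ball_self hr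
    exact ⟨hbox (Set.mk_mem_prod (Metric.ball_subset_closedBall h0)
      (Metric.ball_subset_closedBall hv)), _, Set.mk_mem_prod h0 hv, rfl⟩

theorem subVolume_integral_coordBox (he : IsSubmanifoldCoord S e) {r : ℝ} (hr : 0 < r) {v₀ : Cn m}
    (hbox : Metric.closedBall (0 : Cn k) r ×ˢ Metric.closedBall v₀ r ⊆ e.target) {h : Cn n → ℂ}
    (hh : ∀ y, y ∉ coordBox e r v₀ → h y = 0) :
    (Integrable h (subVolume k m S) ↔
      IntegrableOn (fun v => subDensity e v • h (e.symm (0, v))) (Metric.ball v₀ r)) ∧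
    ∫ y, h y ∂(subVolume k m S) =
      ∫ v in Metric.ball v₀ r, subDensity e v • h (e.symm (0, v)) := by
  have hV : coordBox e r v₀ ⊆ e.source := by
    rintro _ ⟨z, hz, rfl⟩
    exact e.map_target (hbox (Set.mk_mem_prod (Metric.ball_subset_closedBall hz.1)
      (Metric.ball_subset_closedBall hz.2)))
  have hm := (isOpen_subDomain e).measurableSet
  have ha : AEMeasurable (subDensity e) (volume.restrict (subDomain e)) :=
    (he.continuousOn_subDensity).aemeasurable hm
  have ha0 : ∀ w ∈ subDomain e, 0 ≤ subDensity e w := fun w hw => (he.subDensity_pos hw).le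
  rw [← subDomain_inter_preimage_coordBox hr hbox]
  constructor
  · rw [← integrableOn_pushDensity hm (continuousOn_subParam e) (injOn_subParam e) ha ha0,
      ← chartVolume_eq, IntegrableOn, ← subVolume_restrict_of_subset he hV]
    exact (integrableOn_iff_integrable_of_support_subset
      fun y hy => by_contra fun hc => hy (hh y hc)).symm
  · rw [← setIntegral_pushDensity hm (continuousOn_subParam e) (injOn_subParam e) ha ha0,
      ← chartVolume_eq, ← subVolume_restrict_of_subset he hV]
    exact (setIntegral_eq_integral_of_forall_compl_eq_zero hh).symm

theorem norm_integral_slice_le {r M C : ℝ} (hM0 : 0 ≤ M) {v : Cn m}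
    (hpos : ∀ w ∈ Metric.ball (0 : Cn k) r, 0 ≤ ambientDensity e (w, v))
    (hMC : ∀ w ∈ Metric.ball (0 : Cn k) r, w ≠ 0 →
      |(G (e.symm (w, v))).toReal - 2 * Real.log ‖w‖| ≤ C ∧
      ‖w‖ ^ (2 * k) * (ambientDensity e (w, v) * ‖integrand k p G φ F H (e.symm (w, v))‖) ≤ M)
    {χ : Cn n → ℝ} (hχ1 : ∀ y, |χ y| ≤ 1) (t : ℝ) :
    ‖∫ w in vshell (Metric.ball 0 r) (fun w => (G (e.symm (w, v))).toReal) t,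
      ambientDensity e (w, v) • χ (e.symm (w, v)) • integrand k p G φ F H (e.symm (w, v))‖ ≤
      M * Real.exp (C + 1 / 2) ^ (2 * k) *
        (volume : Measure (Cn k)).real (Metric.closedBall 0 1) := by
  rw [← finrank_real_Cn k]
  refine norm_integral_vshell_le volume hM0 (fun w hw hw0 => (hMC w hw hw0).1)
    (fun w hw hw0 => ?_) t
  rw [finrank_real_Cn]
  refine le_trans ?_ (hMC w hw hw0).2
  rw [norm_smul, norm_smul, Real.norm_eq_abs, Real.norm_eq_abs, abs_of_nonneg (hpos w hw)]
  have h0 := hpos w hw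
  gcongr
  exact mul_le_of_le_one_left (norm_nonneg _) (hχ1 _)

theorem setIntegral_shell_coordBox (hn : k + m = n) (he : IsAdaptedCoord D S G e)
    (hG : IsGreenType k m D S G) (hD : IsOpen D) (hS : closure S ∩ D ⊆ S) {r : ℝ} {v₀ : Cn m}
    (hbox : Metric.closedBall (0 : Cn k) r ×ˢ Metric.closedBall v₀ r ⊆ e.target) {h : Cn n → ℂ}
    (hh : ∀ y, y ∉ coordBox e r v₀ → h y = 0) (t : ℝ) (hint : IntegrableOn h (shell G t ∩ D)) :
    IsOpen ((Metric.ball (0 : Cn k) r ×ˢ Metric.ball v₀ r) ∩ e.symm ⁻¹' shell G t) ∧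
    IntegrableOn (fun z => ambientDensity e z • h (e.symm z))
      ((Metric.ball (0 : Cn k) r ×ˢ Metric.ball v₀ r) ∩ e.symm ⁻¹' shell G t) ∧
    ∫ y in shell G t ∩ D, h y =
      ∫ z in (Metric.ball (0 : Cn k) r ×ˢ Metric.ball v₀ r) ∩ e.symm ⁻¹' shell G t,
        ambientDensity e z • h (e.symm z) := by
  have he' := he.toIsSubmanifoldCoord
  set B := Metric.ball (0 : Cn k) r ×ˢ Metric.ball v₀ r with hB
  have hBT : B ⊆ e.target :=
    (Set.prod_mono Metric.ball_subset_closedBall Metric.ball_subset_closedBall).trans hbox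
  have hAD : B ∩ e.symm ⁻¹' shell G t = B ∩ e.symm ⁻¹' (shell G t ∩ D) := by
    ext z
    refine and_congr_right fun hz => (and_iff_left ?_).symm
    exact he.source_subset (e.map_target (hBT hz))
  have hopen : IsOpen (B ∩ e.symm ⁻¹' shell G t) := by
    rw [hAD]
    exact (e.continuousOn_symm.mono hBT).isOpen_inter_preimage
      (Metric.isOpen_ball.prod Metric.isOpen_ball) (hG.isOpen_shell_inter hD hS t)
  have hsub : e.symm '' (B ∩ e.symm ⁻¹' shell G t) ⊆ shell G t ∩ D := by
    rw [hAD]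
    rintro _ ⟨z, hz, rfl⟩
    exact hz.2
  have hT : B ∩ e.symm ⁻¹' shell G t ⊆ e.target := Set.inter_subset_left.trans hBT
  refine ⟨hopen, (integrableOn_symm_image he' hn hopen.measurableSet hT h).1 (hint.mono_set hsub),
    ?_⟩
  rw [← integral_symm_image he' hn hopen.measurableSet hT]
  refine setIntegral_eq_of_subset_of_forall_sdiff_eq_zero (f := h)
    (hG.isOpen_shell_inter hD hS t).measurableSet hsub ?_
  rintro y ⟨hy, hy'⟩
  refine hh y ?_
  rintro ⟨z, hz, rfl⟩
  exact hy' ⟨z, ⟨hz, hy.1⟩, rfl⟩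

theorem tendsto_integral_coordBox (hn : k + m = n) (hk : 1 ≤ k) (hp : 2 ≤ p)
    (hφ : ContinuousOn φ D) (hF : IsSmoothExtension D S p f F) (hH : IsSmoothExtension D S p g H)
    (he : IsAdaptedCoord D S G e)
    (hG : IsGreenType k m D S G) (hD : IsOpen D) (hS : closure S ∩ D ⊆ S)
    (hint : ∀ t, IntegrableOn (integrand k p G φ F H) (shell G t ∩ D)) {r : ℝ} (hr : 0 < r)
    {v₀ : Cn m} (hbox : Metric.closedBall (0 : Cn k) r ×ˢ Metric.closedBall v₀ r ⊆ e.target)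
    {χ : Cn n → ℝ} (hχ : Continuous χ) (hχ1 : ∀ y, |χ y| ≤ 1)
    (hχV : ∀ y, y ∉ coordBox e r v₀ → χ y = 0) :
    Integrable (fun x => χ x • jetInner k m D S G φ p x (f x) (g x)) (subVolume k m S) ∧
    Tendsto (fun t => ∫ y in shell G t ∩ D, χ y • integrand k p G φ F H y) atBot
      (𝓝 (∫ x, χ x • jetInner k m D S G φ p x (f x) (g x) ∂(subVolume k m S))) := by
  have he' := he.toIsSubmanifoldCoord
  obtain ⟨γ, hγ⟩ := he.green
  obtain ⟨M, C, hM0, hMC⟩ := exists_integrand_bound hF hH he hγ hφ hp hr hbox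
  obtain ⟨h1, h2⟩ := subVolume_integral_coordBox he' hr hbox
    (h := fun x => χ x • jetInner k m D S G φ p x (f x) (g x))
    (fun y hy => by simp only [hχV y hy, zero_smul])
  have hχint : ∀ t, IntegrableOn (fun y => χ y • integrand k p G φ F H y) (shell G t ∩ D) :=
    fun t => (hint t).bdd_smul 1 hχ.aestronglyMeasurable (Eventually.of_forall hχ1)
  have h3 := fun t => setIntegral_shell_coordBox hn he hG hD hS hbox
    (h := fun y => χ y • integrand k p G φ F H y)
    (fun y hy => by simp only [hχV y hy, zero_smul]) t (hχint t)
  rw [h1, h2]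
  simp only [(h3 _).2.2]
  have hslice : ∀ t, ∀ v ∈ Metric.ball v₀ r,
      {w : Cn k | (w, v) ∈ (Metric.ball (0 : Cn k) r ×ˢ Metric.ball v₀ r) ∩
        e.symm ⁻¹' shell G t} =
      vshell (Metric.ball 0 r) (fun w => (G (e.symm (w, v))).toReal) t := by
    intro t v hv
    rw [← mem_shell_iff_mem_vshell hγ (fun w hw => hbox (Set.mk_mem_prod
      (Metric.ball_subset_closedBall hw) (Metric.ball_subset_closedBall hv))) t]
    ext w
    simp only [Set.mem_ofPred_eq, Set.mem_inter_iff, Set.mem_prod, Set.mem_preimage, hv, and_true]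
  refine tendsto_setIntegral_prod Metric.isOpen_ball.measurableSet measure_ball_lt_top.ne
    (fun t => (h3 t).1.measurableSet) (fun t z hz => hz.1.2) (fun t => (h3 t).2.1)
    (M := M * Real.exp (C + 1 / 2) ^ (2 * k) *
        (volume : Measure (Cn k)).real (Metric.closedBall 0 1)) ?_ ?_
  · intro t v hv
    rw [hslice t v hv]
    refine norm_integral_slice_le hM0 (fun w hw => ?_) (fun w hw hw0 => ?_) hχ1 t
    · exact (he'.ambientDensity_pos (hbox (Set.mk_mem_prod
        (Metric.ball_subset_closedBall hw) (Metric.ball_subset_closedBall hv)))).le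
    · exact hMC v (Metric.ball_subset_closedBall hv) w (Metric.ball_subset_closedBall hw) hw0
  · intro v hv
    simp only [hslice _ v hv]
    exact jetInner_slice_limit hk hp hφ hF hH he hr hbox hv hχ

end Local

/-! ### Integration over the submanifold -/

section Global

variable {n k m p : ℕ} {D S : Set (Cn n)} {G : Cn n → EReal} {φ : Cn n → ℝ} {e : Coord n k m}
  {f g : ∀ x, JetFibre S p x} {F H : Cn n → ℂ}

theorem IsSubmanifoldCoord.exists_box_subset (he : IsSubmanifoldCoord S e) {x : Cn n}
    (hx : x ∈ e.source) (hxS : x ∈ S) {O : Set (Cn n)} (hO : O ∈ 𝓝 x) :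
    ∃ r > 0, Metric.closedBall (0 : Cn k) r ×ˢ Metric.closedBall (e x).2 r ⊆
      e.target ∩ e.symm ⁻¹' O := by
  have hT := he.zero_mem_target hx hxS
  have h1 : e.target ∩ e.symm ⁻¹' O ∈ 𝓝 ((0 : Cn k), (e x).2) := by
    refine inter_mem (e.open_target.mem_nhds hT) ?_
    refine (e.continuousAt_symm hT).preimage_mem_nhds ?_
    rwa [he.symm_zero hx hxS]
  obtain ⟨r, hr, h⟩ := Metric.nhds_basis_closedBall.mem_iff.1 h1
  refine ⟨r, hr, ?_⟩
  rwa [closedBall_prod_same]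

theorem jetInner_eq_zero (hk : 1 ≤ k) (hp : 2 ≤ p) (hφ : ContinuousOn φ D)
    (hF : IsSmoothExtension D S p f F) (hH : IsSmoothExtension D S p g H)
    (hG : IsGreenType k m D S G) {x : Cn n} (hxS : x ∈ S)
    (hzero : ∀ᶠ y in 𝓝 x, F y * conj (H y) = 0) :
    jetInner k m D S G φ p x (f x) (g x) = 0 := by
  obtain ⟨e, hx, he⟩ := hG.coord x hxS
  have he' := he.toIsSubmanifoldCoord
  obtain ⟨r, hr, hb⟩ := he'.exists_box_subset hx hxS hzero
  have hbox := hb.trans Set.inter_subset_left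
  have hv : (e x).2 ∈ Metric.ball (e x).2 r := Metric.mem_ball_self hr
  have h := jetInner_slice_limit hk hp hφ hF hH he hr hbox hv
    (continuous_const (y := (1 : ℝ)))
  rw [he'.symm_zero hx hxS, one_smul] at h
  have h0 : ∀ t, ∫ w in vshell (Metric.ball (0 : Cn k) r)
      (fun w => (G (e.symm (w, (e x).2))).toReal) t,
      ambientDensity e (w, (e x).2) • (1 : ℝ) • integrand k p G φ F H (e.symm (w, (e x).2)) =
      0 := by
    intro t
    refine setIntegral_eq_zero_of_forall_eq_zero fun w hw => ?_
    have h2 : F (e.symm (w, (e x).2)) * conj (H (e.symm (w, (e x).2))) = 0 :=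
      (hb (Set.mk_mem_prod (Metric.ball_subset_closedBall hw.1)
        (Metric.mem_closedBall_self hr.le))).2
    rw [integrand, h2, zero_mul, smul_zero, smul_zero]
  simp only [h0] at h
  have h1 := tendsto_nhds_unique h tendsto_const_nhds
  exact (smul_eq_zero.1 h1).resolve_left
    (he'.subDensity_pos (he'.zero_mem_target hx hxS)).ne'

theorem IsGreenType.continuousOn_integrand (hG : IsGreenType k m D S G) (hφ : ContinuousOn φ D)
    (hF : ContinuousOn F D) (hH : ContinuousOn H D) :
    ContinuousOn (integrand k p G φ F H) (D \ S) := by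
  have hGr : ContinuousOn (fun y => (G y).toReal) (D \ S) :=
    EReal.continuousOn_toReal.comp hG.cont fun y hy => by
      simp only [Set.mem_compl_iff, Set.mem_insert_iff, Set.mem_singleton_iff, not_or]
      exact ⟨hG.finite y hy, ((hG.neg y hy.1).trans_le le_top).ne⟩
  have hsub : D \ S ⊆ D := Set.sdiff_subset
  unfold integrand
  refine ContinuousOn.mul ((hF.mono hsub).mul
    (Complex.continuous_conj.comp_continuousOn (hH.mono hsub))) ?_
  exact Complex.continuous_ofReal.comp_continuousOn (Real.continuous_exp.comp_continuousOn
    (((hφ.mono hsub).neg).sub (continuousOn_const.mul hGr)))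

theorem IsGreenType.shell_inter_subset (hG : IsGreenType k m D S G) (t : ℝ) :
    shell G t ∩ D ⊆ D \ S := by
  rintro y ⟨hy, hyD⟩
  refine ⟨hyD, fun h => ?_⟩
  have := hy.1
  rw [hG.eq_bot h] at this
  exact not_lt_bot this

theorem lt_toReal_of_mem_shell {t : ℝ} {y : Cn n} (hy : y ∈ shell G t) : t < (G y).toReal := by
  have h1 : G y ≠ ⊥ := (bot_le.trans_lt hy.1).ne'
  have h2 : G y ≠ ⊤ := (hy.2.trans_le le_top).ne
  rw [← EReal.coe_lt_coe_iff, EReal.coe_toReal h2 h1]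
  exact hy.1

theorem integrableOn_shell (hG : IsGreenType k m D S G) (hD : IsOpen D)
    (hDb : Bornology.IsBounded D) (hS : closure S ∩ D ⊆ S) (hp : 1 ≤ p) (hφ : ContinuousOn φ D)
    (hF : ContinuousOn F D) (hH : ContinuousOn H D) {K : Set (Cn n)} (hK : IsCompact K)
    (hKD : K ⊆ D) (hzero : ∀ z ∈ D \ K, F z * conj (H z) = 0) (t : ℝ) :
    IntegrableOn (integrand k p G φ F H) (shell G t ∩ D) := by
  have hopen := hG.isOpen_shell_inter hD hS t
  have hm : AEStronglyMeasurable (integrand k p G φ F H) (volume.restrict (shell G t ∩ D)) :=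
    ((hG.continuousOn_integrand hφ hF hH).mono (hG.shell_inter_subset t)).aestronglyMeasurable
      hopen.measurableSet
  have hfin : volume (shell G t ∩ D) ≠ ⊤ :=
    ((measure_mono Set.inter_subset_right).trans_lt hDb.measure_lt_top).ne
  have hFHφ : ContinuousOn (fun y => F y * conj (H y) * (Real.exp (-φ y) : ℂ)) K := by
    refine ContinuousOn.mul ((hF.mono hKD).mul
      (Complex.continuous_conj.comp_continuousOn (hH.mono hKD))) ?_
    have h1 : ContinuousOn (fun y => Real.exp (-φ y)) K :=
      Real.continuous_exp.comp_continuousOn (hφ.mono hKD).neg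
    exact Complex.continuous_ofReal.comp_continuousOn h1
  obtain ⟨C, hC⟩ := hK.exists_bound_of_continuousOn hFHφ
  have : IsFiniteMeasure (volume.restrict (shell G t ∩ D)) := ⟨by
    rw [Measure.restrict_apply_univ]; exact hfin.lt_top⟩
  refine Integrable.of_bound hm (|C| * Real.exp (-((p : ℝ) + k - 1) * t)) ?_
  refine (ae_restrict_iff' hopen.measurableSet).2 (Eventually.of_forall fun y hy => ?_)
  by_cases hyK : y ∈ K
  · have hN : (0 : ℝ) ≤ (p : ℝ) + k - 1 := by
      have h1 : (1 : ℝ) ≤ p := by exact_mod_cast hp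
      have h2 : (0 : ℝ) ≤ k := Nat.cast_nonneg k
      linarith
    have h1 : integrand k p G φ F H y = F y * conj (H y) * (Real.exp (-φ y) : ℂ) *
        (Real.exp (-((p : ℝ) + k - 1) * (G y).toReal) : ℂ) := by
      rw [integrand, mul_assoc, mul_assoc, mul_assoc, ← Complex.ofReal_mul, ← Real.exp_add,
        neg_mul, ← sub_eq_add_neg]
    rw [h1, norm_mul, Complex.norm_real, Real.norm_eq_abs, Real.abs_exp]
    refine mul_le_mul ((hC y hyK).trans (le_abs_self _)) (Real.exp_le_exp.2 ?_)
      (Real.exp_pos _).le (abs_nonneg _)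
    rw [neg_mul, neg_mul]
    exact neg_le_neg (mul_le_mul_of_nonneg_left (lt_toReal_of_mem_shell hy.1).le hN)
  · rw [integrand, hzero y ⟨hy.2, hyK⟩, zero_mul, norm_zero]
    positivity

/-- The shell limit, localized by cut-off functions supported in `V`. -/
def HasLocalShellLimit (k m p : ℕ) (D S : Set (Cn n)) (G : Cn n → EReal) (φ : Cn n → ℝ)
    (f g : ∀ x, JetFibre S p x) (F H : Cn n → ℂ) (V : Set (Cn n)) : Prop :=
  ∀ χ : Cn n → ℝ, Continuous χ → (∀ y, |χ y| ≤ 1) → (∀ y, y ∉ V → χ y = 0) →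
    Integrable (fun x => χ x • jetInner k m D S G φ p x (f x) (g x)) (subVolume k m S) ∧
    Tendsto (fun t => ∫ y in shell G t ∩ D, χ y • integrand k p G φ F H y) atBot
      (𝓝 (∫ x, χ x • jetInner k m D S G φ p x (f x) (g x) ∂(subVolume k m S)))

theorem measurableSet_of_relClosed (hD : IsOpen D) (hSD : S ⊆ D) (hS : closure S ∩ D ⊆ S) :
    MeasurableSet S := by
  rw [show S = closure S ∩ D from (Set.subset_inter subset_closure hSD).antisymm hS]
  exact isClosed_closure.measurableSet.inter hD.measurableSet

theorem exists_hasLocalShellLimit_of_notMem (hG : IsGreenType k m D S G) (hD : IsOpen D)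
    (hSD : S ⊆ D) (hS : closure S ∩ D ⊆ S) {x : Cn n} (hx : x ∈ D \ S) :
    ∃ V, IsOpen V ∧ x ∈ V ∧ HasLocalShellLimit k m p D S G φ f g F H V := by
  obtain ⟨r, hr, hball⟩ := Metric.nhds_basis_closedBall.mem_iff.1
    ((isOpen_diff_of_relClosed hD hS).mem_nhds hx)
  refine ⟨Metric.ball x r, Metric.isOpen_ball, Metric.mem_ball_self hr, fun χ _ _ hχV => ?_⟩
  obtain ⟨y₀, hy₀, hmin⟩ := (isCompact_closedBall x r).exists_isMinOn
    ⟨x, Metric.mem_closedBall_self hr.le⟩ (hG.cont.mono hball)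
  have hJ : (fun x => χ x • jetInner k m D S G φ p x (f x) (g x)) =ᵐ[subVolume k m S]
      fun _ => 0 := by
    filter_upwards [ae_subVolume_mem (measurableSet_of_relClosed hD hSD hS)] with y hy
    rw [hχV y fun h => (hball (Metric.ball_subset_closedBall h)).2 hy, zero_smul]
  refine ⟨(integrable_zero _ _ _).congr hJ.symm, ?_⟩
  rw [integral_congr_ae hJ, integral_zero]
  refine tendsto_const_nhds.congr' ?_
  filter_upwards [eventually_le_atBot ((G y₀).toReal - 1)] with t ht
  refine (setIntegral_eq_zero_of_forall_eq_zero fun y hy => ?_).symm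
  by_cases hyV : y ∈ Metric.ball x r
  · exfalso
    have h1 : G y₀ ≤ G y := hmin (Metric.ball_subset_closedBall hyV)
    have h2 := h1.trans_lt hy.1.2
    have h3 : ((t + 1 : ℝ) : EReal) ≤ G y₀ := by
      rw [← EReal.coe_toReal (((hG.neg y₀ (hball hy₀).1).trans_le le_top).ne)
        (hG.finite y₀ (hball hy₀)), EReal.coe_le_coe_iff]
      linarith
    exact absurd h2 (not_lt.2 h3)
  · rw [hχV y hyV, zero_smul]

theorem exists_hasLocalShellLimit (hn : k + m = n) (hk : 1 ≤ k) (hp : 2 ≤ p)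
    (hφ : ContinuousOn φ D) (hF : IsSmoothExtension D S p f F) (hH : IsSmoothExtension D S p g H)
    (hG : IsGreenType k m D S G) (hD : IsOpen D) (hSD : S ⊆ D) (hS : closure S ∩ D ⊆ S)
    (hint : ∀ t, IntegrableOn (integrand k p G φ F H) (shell G t ∩ D)) {x : Cn n} (hx : x ∈ D) :
    ∃ V, IsOpen V ∧ x ∈ V ∧ HasLocalShellLimit k m p D S G φ f g F H V := by
  by_cases hxS : x ∈ S
  · obtain ⟨e, hxe, he⟩ := hG.coord x hxS
    have he' := he.toIsSubmanifoldCoord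
    obtain ⟨r, hr, hb⟩ := he'.exists_box_subset hxe hxS univ_mem
    have hbox := hb.trans Set.inter_subset_left
    refine ⟨coordBox e r (e x).2, isOpen_coordBox hbox,
      ⟨(0, (e x).2), Set.mk_mem_prod (Metric.mem_ball_self hr) (Metric.mem_ball_self hr),
        he'.symm_zero hxe hxS⟩, fun χ hχ hχ1 hχV => ?_⟩
    exact tendsto_integral_coordBox hn hk hp hφ hF hH he hG hD hS hint hr hbox hχ hχ1 hχV
  · exact exists_hasLocalShellLimit_of_notMem hG hD hSD hS ⟨hx, hxS⟩

/-- A compact set is covered by the supports of a finite partition of unity subordinate to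
sets with a given local property. -/
theorem exists_partition_of_local {K : Set (Cn n)} (hK : IsCompact K) {L : Set (Cn n) → Prop}
    (hL : ∀ x ∈ K, ∃ V, IsOpen V ∧ x ∈ V ∧ L V) :
    ∃ (N : ℕ) (V : Fin N → Set (Cn n)) (χ : Fin N → Cn n → ℝ), (∀ i, L (V i)) ∧
      (∀ i, Continuous (χ i)) ∧ (∀ i y, |χ i y| ≤ 1) ∧ (∀ i y, y ∉ V i → χ i y = 0) ∧
      ∀ y ∈ K, ∑ i, χ i y = 1 := by
  choose! V hVo hVx hVL using hL
  obtain ⟨s, hsK, hs⟩ := hK.elim_nhds_subcover V fun x hx => (hVo x hx).mem_nhds (hVx x hx)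
  let ε := s.equivFin.symm
  obtain ⟨χ, h1, h2, h3, -⟩ := exists_continuous_sum_one_of_isOpen_isCompact
    (s := fun i => V (ε i)) (fun i => hVo _ (hsK _ (ε i).2)) hK (by
      intro y hy
      obtain ⟨x, hx, hyx⟩ := Set.mem_iUnion₂.1 (hs hy)
      refine Set.mem_iUnion.2 ⟨ε.symm ⟨x, hx⟩, ?_⟩
      rwa [Equiv.apply_symm_apply])
  refine ⟨_, fun i => V (ε i), fun i => χ i, fun i => hVL _ (hsK _ (ε i).2),
    fun i => (χ i).continuous, fun i y => ?_, fun i y hy => ?_, fun y hy => ?_⟩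
  · rw [abs_of_nonneg (h3 i y).1]
    exact (h3 i y).2
  · exact image_eq_zero_of_notMem_tsupport fun h => hy (h1 i h)
  · simpa using h2 hy

theorem integrable_jetInner_and_hasShellLimit (hn : k + m = n) (hk : 1 ≤ k) (hp : 2 ≤ p)
    (hφ : ContinuousOn φ D) (hF : IsSmoothExtension D S p f F) (hH : IsSmoothExtension D S p g H)
    (hG : IsGreenType k m D S G) (hD : IsOpen D) (hDb : Bornology.IsBounded D) (hSD : S ⊆ D)
    (hS : closure S ∩ D ⊆ S) {K : Set (Cn n)} (hK : IsCompact K) (hKD : K ⊆ D)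
    (hzero : ∀ z ∈ D \ K, F z * conj (H z) = 0) :
    Integrable (fun x => jetInner k m D S G φ p x (f x) (g x)) (subVolume k m S) ∧
      HasShellLimit k p G φ (volume.restrict D) F H
        (∫ x, jetInner k m D S G φ p x (f x) (g x) ∂(subVolume k m S)) := by
  have hint := integrableOn_shell hG hD hDb hS (by omega : 1 ≤ p) hφ hF.1.continuousOn
    hH.1.continuousOn hK hKD hzero
  obtain ⟨N, V, χ, hL, hχ, hχ1, hχV, hsum⟩ := exists_partition_of_local hK fun x hx =>
    exists_hasLocalShellLimit hn hk hp hφ hF hH hG hD hSD hS hint (hKD hx)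
  have hloc := fun i => hL i (χ i) (hχ i) (hχ1 i) (hχV i)
  have hJ : (fun x => ∑ i, χ i x • jetInner k m D S G φ p x (f x) (g x)) =ᵐ[subVolume k m S]
      fun x => jetInner k m D S G φ p x (f x) (g x) := by
    filter_upwards [ae_subVolume_mem (measurableSet_of_relClosed hD hSD hS)] with x hx
    rw [← Finset.sum_smul]
    by_cases hxK : x ∈ K
    · rw [hsum x hxK, one_smul]
    · rw [jetInner_eq_zero hk hp hφ hF hH hG hx, smul_zero]
      filter_upwards [(hD.sdiff hK.isClosed).mem_nhds ⟨hSD hx, hxK⟩] with y hy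
      exact hzero y hy
  have hχint : ∀ i t, IntegrableOn (fun y => χ i y • integrand k p G φ F H y) (shell G t ∩ D) :=
    fun i t => (hint t).bdd_smul 1 (hχ i).aestronglyMeasurable (Eventually.of_forall (hχ1 i))
  have hI : ∀ t, ∫ y in shell G t ∩ D, integrand k p G φ F H y =
      ∑ i, ∫ y in shell G t ∩ D, χ i y • integrand k p G φ F H y := by
    intro t
    rw [← integral_finsetSum _ fun i _ => hχint i t]
    refine setIntegral_congr_fun (hG.isOpen_shell_inter hD hS t).measurableSet fun y hy => ?_
    rw [← Finset.sum_smul]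
    by_cases hyK : y ∈ K
    · rw [hsum y hyK, one_smul]
    · rw [integrand, hzero y ⟨hy.2, hyK⟩, zero_mul, smul_zero]
  have hrestr : ∀ t, (volume.restrict D).restrict (shell G t) = volume.restrict (shell G t ∩ D) :=
    fun t => Measure.restrict_restrict' hD.measurableSet
  refine ⟨(integrable_finsetSum _ fun i _ => (hloc i).1).congr hJ,
    Eventually.of_forall fun t => ?_, ?_⟩
  · rw [IntegrableOn, hrestr]
    exact hint t
  · simp only [hrestr, hI]
    rw [← integral_congr_ae hJ, integral_finsetSum _ fun i _ => (hloc i).1]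
    exact tendsto_finsetSum _ fun i _ => (hloc i).2

end Global

end JetMetric

end

open JetMetric in
theorem mainTheorem2 (n k m p : ℕ) (hn : k + m = n) (hk : 1 ≤ k) (hp : 2 ≤ p)
    (D S : Set (Cn n)) (hD : IsPseudoconvexDomain D) (hDb : Bornology.IsBounded D)
    (hSD : S ⊆ D) (hS : closure S ∩ D ⊆ S)
    (φ : Cn n → ℝ) (hφ : ContinuousOn φ D) (hφ' : IsPSHOn (fun z => (φ z : EReal)) D)
    (G : Cn n → EReal) (hG : IsGreenType k m D S G) :
    -- in adapted coordinates, elements of the fibre correspond to homogeneous polynomials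
    (∀ (x : Cn n) (e : Coord n k m) (U : Set (Cn n)), IsAdaptedNhd D S G e U x →
      ∀ f : JetFibre S p x, ∃! P : MvPolynomial (Fin k) ℂ, CorrespondsTo S p e x f P) ∧
    -- (1) the limit exists
    (∀ (x : Cn n) (e : Coord n k m) (U : Set (Cn n)), IsAdaptedNhd D S G e U x →
      ∀ (f g : JetFibre S p x) (P Q : MvPolynomial (Fin k) ℂ),
        CorrespondsTo S p e x f P → CorrespondsTo S p e x g Q →
        ∃ c : ℂ, HasShellLimit k p G φ (sliceVolume e U x) (coordPoly e P) (coordPoly e Q) c) ∧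
    -- (2) the limit does not change under perturbations of order `o(|z'|^(p-1))`
    (∀ (x : Cn n) (e : Coord n k m) (U : Set (Cn n)), IsAdaptedNhd D S G e U x →
      ∀ (f g : JetFibre S p x) (P Q : MvPolynomial (Fin k) ℂ),
        CorrespondsTo S p e x f P → CorrespondsTo S p e x g Q →
        ∀ F H : Cn n → ℂ,
          AEStronglyMeasurable F (sliceVolume e U x) →
          AEStronglyMeasurable H (sliceVolume e U x) →
          (fun y => F y - coordPoly e P y) =o[𝓝[slice e U x \ {x}] x]
            (fun y => ‖(e y).1‖ ^ (p - 1)) →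
          (fun y => H y - coordPoly e Q y) =o[𝓝[slice e U x \ {x}] x]
            (fun y => ‖(e y).1‖ ^ (p - 1)) →
          ∀ c : ℂ,
            HasShellLimit k p G φ (sliceVolume e U x) (coordPoly e P) (coordPoly e Q) c →
            HasShellLimit k p G φ (sliceVolume e U x) F H c) ∧
    -- (3) the limit is the same in all adapted coordinates
    (∀ (x : Cn n) (e : Coord n k m) (U : Set (Cn n)), IsAdaptedNhd D S G e U x →
      ∀ (f g : JetFibre S p x) (P Q : MvPolynomial (Fin k) ℂ),
        CorrespondsTo S p e x f P → CorrespondsTo S p e x g Q →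
        HasShellLimit k p G φ (sliceVolume e U x) (coordPoly e P) (coordPoly e Q)
          (jetInner k m D S G φ p x f g)) ∧
    -- (4) integration over `S`
    (∀ f g : (∀ x, JetFibre S p x), IsSmoothSection k m S p f → IsSmoothSection k m S p g →
      ∀ F H : Cn n → ℂ, IsSmoothExtension D S p f F → IsSmoothExtension D S p g H →
        (∃ K ⊆ D, IsCompact K ∧ ∀ z ∈ D \ K, F z * starRingEnd ℂ (H z) = 0) →
        Integrable (fun x => jetInner k m D S G φ p x (f x) (g x)) (subVolume k m S) ∧
        HasShellLimit k p G φ (volume.restrict D) F H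
          (∫ x, jetInner k m D S G φ p x (f x) (g x) ∂(subVolume k m S))) := by
  refine ⟨fun x e U hU f => ?_, fun x e U hU f g P Q hP hQ => ?_,
    fun x e U hU f g P Q hP hQ F H hF hH hFP hHQ c hc => ?_,
    fun x e U hU f g P Q hP hQ => ?_, fun f g _ _ F H hF hH hFH => ?_⟩
  · have he := hU.adapted.toIsSubmanifoldCoord
    obtain ⟨P, hP⟩ := exists_correspondsTo he hU.mem_source hU.mem_S p f
    exact ⟨P, hP, fun Q hQ =>
      CorrespondsTo.unique he hU.mem_source hU.mem_S (by omega : 1 ≤ p) hQ hP⟩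
  · obtain ⟨γ, hγ⟩ := hU.adapted.green
    exact ⟨_, hasShellLimit_coordPoly hk (by omega : 1 ≤ p) hφ hU hγ hP.1 hQ.1⟩
  · obtain ⟨γ, hγ⟩ := hU.adapted.green
    rw [hc.unique (hasShellLimit_coordPoly hk (by omega : 1 ≤ p) hφ hU hγ hP.1 hQ.1)]
    exact hasShellLimit_slice hk (by omega : 1 ≤ p) hφ hU hγ hP.1 hQ.1 hF hH hFP hHQ
  · obtain ⟨γ, hγ⟩ := hU.adapted.green
    rw [jetInner_eq_sliceForm hk (by omega : 1 ≤ p) hφ hU hγ hP hQ]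
    exact hasShellLimit_coordPoly hk (by omega : 1 ≤ p) hφ hU hγ hP.1 hQ.1
  · obtain ⟨K, hKD, hK, hzero⟩ := hFH
    exact integrable_jetInner_and_hasShellLimit hn hk hp hφ hF hH hG hD.1 hDb hSD hS hK hKD hzero
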